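/- There is an algorithm (a single program for the real RAM with exact arithmetic $+,-,\times,/$ and comparisons of real numbers at unit cost, integer counters, and indirect addressing) and an absolute constant $C$ with the following property. Let $P$ be a set of $n\ge 5$ points in the plane in general position (no three points of $P$ are collinear, and no two pairs of points of $P$ define parallel lines), let $\theta$ be a direction, given by a nonzero vector $u$, and let $\varepsilon>0$. A \emph{V-shape} with vertices $x$ and $y$ is the planar region bounded by two pairs of parallel rays: the inner rays $X_1,X_2$ start at $x$, the outer rays $Y_1,Y_2$ start at $y$, the rays $X_1,Y_1$ are parallel and lie to the left of the directed line $xy$, the rays $X_2,Y_2$ are parallel and lie to its right, and $Y_1,Y_2$ bound a convex wedge of angle less than $\pi$. For $i=1,2$, the $i$th \emph{arm} is the part bounded by $X_i$, $Y_i$ and the segment $xy$, its width is the distance between the parallel rays $X_i$ and $Y_i$ (an arm of width $0$ is allowed), and the \emph{width} of the V-shape is the larger of the widths of its two arms. An arm has direction $\theta$ if its rays are parallel to $u$ (in either orientation). On input $P$, $u$, $\varepsilon$ the algorithm outputs the two vertices and the two ray directions of a V-shape $V$ that covers $P$, has one arm in direction $\theta$, and satisfies $$\mathrm{width}(V)\le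 (1+\varepsilon/3)\,\mathrm{width}(V')$$ for every V-shape $V'$ that covers $P$ and has one arm in direction $\theta$. It halts after at most $$C\left(n\log n+\frac{n}{\varepsilon^{1/2}}\log^2\frac1\varepsilon\right)$$ steps. -/

import Mathlib

noncomputable section

/-! ## Planar geometry -/

/-- The Euclidean plane. -/
abbrev Plane : Type := EuclideanSpace ℝ (Fin 2)

/-- The determinant of two plane vectors: positive iff `b` points to the left of `a`, zero iff
they are parallel. -/
def det2 (a b : Plane) : ℝ := a 0 * b 1 - a 1 * b 0

/-- A (not necessarily balanced) V-shape, given by its vertices and by the common directions of its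
left rays and of its right rays. The inner rays start at `x`, the outer rays at `y`. The left rays
lie to the left of the directed line `xy` and the right rays to its right; equality is the case
of an arm of zero width. The last condition says that the outer rays bound a convex wedge with
apex `y` (which then contains `x`), so that the strips cross and `y` is the outer vertex. -/
structure VShape where
  x : Plane
  y : Plane
  leftDir : Plane
  rightDir : Plane
  left_side : 0 ≤ det2 (y - x) leftDir
  right_side : det2 (y - x) rightDir ≤ 0
  wedge : 0 < det2 leftDir rightDir

namespace VShape

/-- The region bounded by the segment `xy` and the rays from `x` and `y` in direction `d`. -/
def armRegion (x y d : Plane) : Set Plane :=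
  {z | ∃ s t : ℝ, 0 ≤ s ∧ s ≤ 1 ∧ 0 ≤ t ∧ z = x + s • (y - x) + t • d}

/-- The distance between the parallel rays from `x` and `y` in direction `d ≠ 0`. -/
def armWidth (x y d : Plane) : ℝ := |det2 (y - x) d| / ‖d‖

/-- The V-shape as a region of the plane: the union of its left and its right arm. -/
def region (V : VShape) : Set Plane :=
  armRegion V.x V.y V.leftDir ∪ armRegion V.x V.y V.rightDir

/-- The width of a V-shape is the larger of the widths of its arms. -/
def width (V : VShape) : ℝ :=
  max (armWidth V.x V.y V.leftDir) (armWidth V.x V.y V.rightDir)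

/-- One of the two arms is parallel to the vector `u`. -/
def HasArmInDirection (V : VShape) (u : Plane) : Prop :=
  det2 V.leftDir u = 0 ∨ det2 V.rightDir u = 0

/-- The V-shape covers all points of the family `p`. -/
def Covers (V : VShape) {n : ℕ} (p : Fin n → Plane) : Prop :=
  ∀ i, p i ∈ V.region

end VShape

/-- General position: the points are distinct, no three are collinear, and no two pairs of points
define parallel lines. -/
structure GeneralPosition {n : ℕ} (p : Fin n → Plane) : Prop where
  injective : Function.Injective p
  not_collinear : ∀ i j k : Fin n, i ≠ j → j ≠ k → i ≠ k → ¬ Collinear ℝ {p i, p j, p k}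
  not_parallel : ∀ i j k l : Fin n, i ≠ j → k ≠ l → s(i, j) ≠ s(k, l) →
    det2 (p j - p i) (p l - p k) ≠ 0

/-! ## The real RAM

A structured program has finitely many natural-number variables, real variables, natural-number
arrays and real arrays (all named by natural numbers). Exact field arithmetic and comparisons of
reals, and addition, truncated subtraction, halving and comparison of natural numbers, take one
step each, and so does every access to a variable or to an array cell. There is no way to turn a
real into a natural number (in particular no rounding), and no root operation. -/

namespace RealRAM

/-- Contents of the memory: scalar variables and arrays. -/
structure State where
  natVar : ℕ → ℕ
  natArr : ℕ → ℕ → ℕ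
  realVar : ℕ → ℝ
  realArr : ℕ → ℕ → ℝ

/-- Natural-number expressions, used for counters and array indices. -/
inductive NExp : Type
  | const (c : ℕ)
  | var (v : ℕ)
  | get (a : ℕ) (i : NExp)
  | add (e f : NExp)
  | sub (e f : NExp)
  | half (e : NExp)

namespace NExp

/-- Value of an expression. -/
def val (s : State) : NExp → ℕ
  | const c => c
  | var v => s.natVar v
  | get a i => s.natArr a (i.val s)
  | add e f => e.val s + f.val s
  | sub e f => e.val s - f.val s
  | half e => e.val s / 2

/-- Number of steps needed to evaluate an expression. -/
def cost : NExp → ℕ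
  | const _ => 1
  | var _ => 1
  | get _ i => i.cost + 1
  | add e f => e.cost + f.cost + 1
  | sub e f => e.cost + f.cost + 1
  | half e => e.cost + 1

end NExp

/-- Real expressions. Constants are rational; division by zero gives zero. -/
inductive RExp : Type
  | const (q : ℚ)
  | var (v : ℕ)
  | get (a : ℕ) (i : NExp)
  | ofNat (i : NExp)
  | add (e f : RExp)
  | sub (e f : RExp)
  | mul (e f : RExp)
  | div (e f : RExp)

namespace RExp

/-- Value of an expression. -/
def val (s : State) : RExp → ℝ
  | const q => (q : ℝ)
  | var v => s.realVar v
  | get a i => s.realArr a (i.val s)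
  | ofNat i => (i.val s : ℝ)
  | add e f => e.val s + f.val s
  | sub e f => e.val s - f.val s
  | mul e f => e.val s * f.val s
  | div e f => e.val s / f.val s

/-- Number of steps needed to evaluate an expression. -/
def cost : RExp → ℕ
  | const _ => 1
  | var _ => 1
  | get _ i => i.cost + 1
  | ofNat i => i.cost + 1
  | add e f => e.cost + f.cost + 1
  | sub e f => e.cost + f.cost + 1
  | mul e f => e.cost + f.cost + 1
  | div e f => e.cost + f.cost + 1

end RExp

/-- Tests on which a program can branch. -/
inductive Test : Type
  | natLt (e f : NExp)
  | realLt (e f : RExp)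
  | not (b : Test)
  | and (b c : Test)

namespace Test

/-- Truth of a test. -/
def Holds (s : State) : Test → Prop
  | natLt e f => e.val s < f.val s
  | realLt e f => e.val s < f.val s
  | not b => ¬ b.Holds s
  | and b c => b.Holds s ∧ c.Holds s

/-- Number of steps needed to evaluate a test. -/
def cost : Test → ℕ
  | natLt e f => e.cost + f.cost + 1
  | realLt e f => e.cost + f.cost + 1
  | not b => b.cost + 1
  | and b c => b.cost + c.cost + 1

end Test

/-- Programs. -/
inductive Cmd : Type
  | skip
  | natAssign (v : ℕ) (e : NExp)
  | natStore (a : ℕ) (i e : NExp)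
  | realAssign (v : ℕ) (e : RExp)
  | realStore (a : ℕ) (i : NExp) (e : RExp)
  | seq (c d : Cmd)
  | ite (b : Test) (c d : Cmd)
  | loop (b : Test) (c : Cmd)

namespace State

/-- Overwrite a natural-number variable. -/
def setNatVar (s : State) (v k : ℕ) : State :=
  { s with natVar := Function.update s.natVar v k }

/-- Overwrite a cell of a natural-number array. -/
def setNatArr (s : State) (a i k : ℕ) : State :=
  { s with natArr := Function.update s.natArr a (Function.update (s.natArr a) i k) }

/-- Overwrite a real variable. -/
def setRealVar (s : State) (v : ℕ) (r : ℝ) : State :=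
  { s with realVar := Function.update s.realVar v r }

/-- Overwrite a cell of a real array. -/
def setRealArr (s : State) (a i : ℕ) (r : ℝ) : State :=
  { s with realArr := Function.update s.realArr a (Function.update (s.realArr a) i r) }

end State

/-- `Exec c s t T`: the program `c`, started in state `s`, halts in state `t` after exactly `T`
steps. The constructor `loop b c` repeats `c` as long as `b` holds. -/
inductive Exec : Cmd → State → State → ℕ → Prop
  | skip (s : State) : Exec Cmd.skip s s 1
  | natAssign (s : State) (v : ℕ) (e : NExp) :
      Exec (Cmd.natAssign v e) s (s.setNatVar v (e.val s)) (e.cost + 1)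
  | natStore (s : State) (a : ℕ) (i e : NExp) :
      Exec (Cmd.natStore a i e) s (s.setNatArr a (i.val s) (e.val s)) (i.cost + e.cost + 1)
  | realAssign (s : State) (v : ℕ) (e : RExp) :
      Exec (Cmd.realAssign v e) s (s.setRealVar v (e.val s)) (e.cost + 1)
  | realStore (s : State) (a : ℕ) (i : NExp) (e : RExp) :
      Exec (Cmd.realStore a i e) s (s.setRealArr a (i.val s) (e.val s)) (i.cost + e.cost + 1)
  | seq {c d : Cmd} {s t r : State} {T U : ℕ} :
      Exec c s t T → Exec d t r U → Exec (Cmd.seq c d) s r (T + U)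
  | iteTrue {b : Test} {c d : Cmd} {s t : State} {T : ℕ} :
      b.Holds s → Exec c s t T → Exec (Cmd.ite b c d) s t (b.cost + T)
  | iteFalse {b : Test} {c d : Cmd} {s t : State} {T : ℕ} :
      ¬ b.Holds s → Exec d s t T → Exec (Cmd.ite b c d) s t (b.cost + T)
  | loopTrue {b : Test} {c : Cmd} {s t r : State} {T U : ℕ} :
      b.Holds s → Exec c s t T → Exec (Cmd.loop b c) t r U →
      Exec (Cmd.loop b c) s r (b.cost + T + U)
  | loopFalse {b : Test} {c : Cmd} {s : State} :
      ¬ b.Holds s → Exec (Cmd.loop b c) s s b.cost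

/-- Programs are deterministic: the final state and the number of steps are unique. -/
theorem Exec.unique {c : Cmd} {s t t' : State} {T T' : ℕ}
    (h : Exec c s t T) (h' : Exec c s t' T') : t = t' ∧ T = T' := by
  induction h generalizing t' T' with
  | skip s => cases h'; exact ⟨rfl, rfl⟩
  | natAssign s v e => cases h'; exact ⟨rfl, rfl⟩
  | natStore s a i e => cases h'; exact ⟨rfl, rfl⟩
  | realAssign s v e => cases h'; exact ⟨rfl, rfl⟩
  | realStore s a i e => cases h'; exact ⟨rfl, rfl⟩
  | seq _ _ ih1 ih2 =>
    cases h' with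
    | seq h1 h2 =>
      obtain ⟨rfl, rfl⟩ := ih1 h1
      obtain ⟨rfl, rfl⟩ := ih2 h2
      exact ⟨rfl, rfl⟩
  | iteTrue hb _ ih =>
    cases h' with
    | iteTrue _ h1 => obtain ⟨rfl, rfl⟩ := ih h1; exact ⟨rfl, rfl⟩
    | iteFalse hn _ => exact absurd hb hn
  | iteFalse hn _ ih =>
    cases h' with
    | iteTrue hb _ => exact absurd hb hn
    | iteFalse _ h1 => obtain ⟨rfl, rfl⟩ := ih h1; exact ⟨rfl, rfl⟩
  | loopTrue hb _ _ ih1 ih2 =>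
    cases h' with
    | loopTrue _ h1 h2 =>
      obtain ⟨rfl, rfl⟩ := ih1 h1
      obtain ⟨rfl, rfl⟩ := ih2 h2
      exact ⟨rfl, rfl⟩
    | loopFalse hn => exact absurd hb hn
  | loopFalse hn =>
    cases h' with
    | loopTrue hb _ _ => exact absurd hb hn
    | loopFalse _ => exact ⟨rfl, rfl⟩

/-- The memory at the start: the number `n` of points in natural-number variable `0`, the
coordinates of the points in the real arrays `0` and `1`, the direction vector `u` in the real
variables `0` and `1`, the number `ε` in real variable `2`, and zero everywhere else. -/
def inputState {n : ℕ} (p : Fin n → Plane) (u : Plane) (ε : ℝ) : State where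
  natVar v := if v = 0 then n else 0
  natArr _ _ := 0
  realVar v := if v = 0 then u 0 else if v = 1 then u 1 else if v = 2 then ε else 0
  realArr a i :=
    if h : i < n then (if a = 0 then p ⟨i, h⟩ 0 else if a = 1 then p ⟨i, h⟩ 1 else 0) else 0

/-- The V-shape `V` is written, as the coordinates of its vertices `x`, `y` and of its left and its
right direction, in the real variables `0, …, 7`. -/
def Outputs (t : State) (V : VShape) : Prop :=
  V.x = !₂[t.realVar 0, t.realVar 1] ∧ V.y = !₂[t.realVar 2, t.realVar 3] ∧
    V.leftDir = !₂[t.realVar 4, t.realVar 5] ∧ V.rightDir = !₂[t.realVar 6, t.realVar 7]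

end RealRAM

end

/-! Use coordinates `lat` across and `lon` along `u`. Up to two signs, a V-shape with an arm along
`u` consists of the points that satisfy the lower bounds `ay ≤ lat` and `Y ≤ lon + c * lat` and at
least one of the upper bounds `lat ≤ ax`, `lon + c * lat ≤ X` (`exists_inCoords`, `exists_vshape`).
Let `A` and `B` list the `lat` and `lon` of the points, sorted by `A`. Covering the points then
amounts to a split `k` and a parameter `c`: the points before `k` go into the first strip, of width
`A (k - 1) - A 0`, and the others into the second, whose width is the maximum of `B i + c * A i`
over `i ≥ k`, minus the minimum over all points, divided by `√(1 + c * c)`.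

For fixed `k` the numerator is a sum of two upper envelopes of lines, one of the points from `k` on
and one of all negated points. It is affine between consecutive breakpoints and `√(1 + c * c)` is
convex, so the infimum over `c` is a value at a breakpoint or a limit at `±∞`
(`exists_lines_sqrt_le`, `splitBound_of_below`). The smaller limit is `A (n - 1) - A k`, at `-∞`. It
belongs to a second arm parallel to `u`, which is not allowed, but `c = -3 * S / (ε * M)` comes
close enough, where `S` bounds the spread of `B` and `M` is the larger of this limit and the first
width (`goodSplit_limit`). This is the only use of `ε` and the only approximation. If `M` were zero,
the points would lie on two parallel lines, which general position excludes
(`gap_of_generalPosition`).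

As `k` grows, the first width grows and the optimal second width falls, so binary search finds the
best split (`search_spec`, `isWidthBound_of_remaining`). On sorted points an envelope takes linear
time with a stack (`hull_spec`), and so does the evaluation at its breakpoints, with a pointer into
the other envelope that only moves forward (`walk_spec`). With merge sort and four sign choices the
running time is `O(n log n)` for every `ε`. All comparisons are between squared widths, since the
machine has no roots. -/

namespace RealRAM

/-! ## Total correctness with a cost -/

/-- `WP c Q s`: the program `c`, started in `s`, halts in a state `t` after `T` steps such that
`Q t T` holds. -/
def WP (c : Cmd) (Q : State → ℕ → Prop) (s : State) : Prop :=
  ∃ t T, Exec c s t T ∧ Q t T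

theorem WP.mono {c : Cmd} {Q R : State → ℕ → Prop} {s : State} (h : WP c Q s)
    (hQR : ∀ t T, Q t T → R t T) : WP c R s := by
  obtain ⟨t, T, he, hq⟩ := h
  exact ⟨t, T, he, hQR t T hq⟩

theorem wp_skip {Q : State → ℕ → Prop} {s : State} : WP .skip Q s ↔ Q s 1 := by
  constructor
  · rintro ⟨t, T, he, hq⟩; cases he; exact hq
  · intro h; exact ⟨_, _, .skip s, h⟩

theorem wp_natAssign {v : ℕ} {e : NExp} {Q : State → ℕ → Prop} {s : State} :
    WP (.natAssign v e) Q s ↔ Q (s.setNatVar v (e.val s)) (e.cost + 1) := by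
  constructor
  · rintro ⟨t, T, he, hq⟩; cases he; exact hq
  · intro h; exact ⟨_, _, .natAssign s v e, h⟩

theorem wp_natStore {a : ℕ} {i e : NExp} {Q : State → ℕ → Prop} {s : State} :
    WP (.natStore a i e) Q s ↔
      Q (s.setNatArr a (i.val s) (e.val s)) (i.cost + e.cost + 1) := by
  constructor
  · rintro ⟨t, T, he, hq⟩; cases he; exact hq
  · intro h; exact ⟨_, _, .natStore s a i e, h⟩

theorem wp_realAssign {v : ℕ} {e : RExp} {Q : State → ℕ → Prop} {s : State} :
    WP (.realAssign v e) Q s ↔ Q (s.setRealVar v (e.val s)) (e.cost + 1) := by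
  constructor
  · rintro ⟨t, T, he, hq⟩; cases he; exact hq
  · intro h; exact ⟨_, _, .realAssign s v e, h⟩

theorem wp_realStore {a : ℕ} {i : NExp} {e : RExp} {Q : State → ℕ → Prop} {s : State} :
    WP (.realStore a i e) Q s ↔
      Q (s.setRealArr a (i.val s) (e.val s)) (i.cost + e.cost + 1) := by
  constructor
  · rintro ⟨t, T, he, hq⟩; cases he; exact hq
  · intro h; exact ⟨_, _, .realStore s a i e, h⟩

theorem wp_seq {c d : Cmd} {Q : State → ℕ → Prop} {s : State} :
    WP (.seq c d) Q s ↔ WP c (fun t T => WP d (fun r U => Q r (T + U)) t) s := by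
  constructor
  · rintro ⟨t, T, he, hq⟩
    cases he with
    | seq h1 h2 => exact ⟨_, _, h1, _, _, h2, hq⟩
  · rintro ⟨t, T, h1, r, U, h2, hq⟩
    exact ⟨_, _, .seq h1 h2, hq⟩

theorem wp_ite {b : Test} {c d : Cmd} {Q : State → ℕ → Prop} {s : State} :
    WP (.ite b c d) Q s ↔
      (b.Holds s → WP c (fun t T => Q t (b.cost + T)) s) ∧
        (¬ b.Holds s → WP d (fun t T => Q t (b.cost + T)) s) := by
  constructor
  · rintro ⟨t, T, he, hq⟩
    cases he with
    | iteTrue hb h => exact ⟨fun _ => ⟨_, _, h, hq⟩, fun hn => absurd hb hn⟩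
    | iteFalse hn h => exact ⟨fun hb => absurd hb hn, fun _ => ⟨_, _, h, hq⟩⟩
  · rintro ⟨h1, h2⟩
    by_cases hb : b.Holds s
    · obtain ⟨t, T, h, hq⟩ := h1 hb
      exact ⟨_, _, .iteTrue hb h, hq⟩
    · obtain ⟨t, T, h, hq⟩ := h2 hb
      exact ⟨_, _, .iteFalse hb h, hq⟩

theorem Test.cost_pos (b : Test) : 0 < b.cost := by
  cases b <;> simp [Test.cost]

/-- A loop with invariant `I` whose potential `φ` pays for the test and the body in every
iteration. -/
theorem wp_loop {b : Test} {c : Cmd} (I : State → Prop) (φ : State → ℕ)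
    (hstep : ∀ s, I s → b.Holds s → WP c (fun t T => I t ∧ b.cost + T + φ t ≤ φ s) s)
    {s : State} (hs : I s) :
    WP (.loop b c) (fun t T => I t ∧ ¬ b.Holds t ∧ T ≤ φ s + b.cost) s := by
  induction hk : φ s using Nat.strong_induction_on generalizing s with
  | _ k ih =>
    subst hk
    by_cases hb : b.Holds s
    · obtain ⟨t, T, he, hI, hφ⟩ := hstep s hs hb
      have hpos := b.cost_pos
      obtain ⟨r, U, he', hI', hn, hU⟩ := ih (φ t) (by omega) hI rfl
      exact ⟨r, _, .loopTrue hb he he', hI', hn, by omega⟩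
    · exact ⟨s, _, .loopFalse hb, hs, hb, by omega⟩

/-! ## Variables that a program writes -/

namespace Cmd

/-- The natural-number variables that a program writes. -/
def natVars : Cmd → List ℕ
  | natAssign v _ => [v]
  | seq c d => c.natVars ++ d.natVars
  | ite _ c d => c.natVars ++ d.natVars
  | loop _ c => c.natVars
  | _ => []

/-- The natural-number arrays that a program writes. -/
def natArrs : Cmd → List ℕ
  | natStore a _ _ => [a]
  | seq c d => c.natArrs ++ d.natArrs
  | ite _ c d => c.natArrs ++ d.natArrs
  | loop _ c => c.natArrs
  | _ => []

/-- The real variables that a program writes. -/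
def realVars : Cmd → List ℕ
  | realAssign v _ => [v]
  | seq c d => c.realVars ++ d.realVars
  | ite _ c d => c.realVars ++ d.realVars
  | loop _ c => c.realVars
  | _ => []

/-- The real arrays that a program writes. -/
def realArrs : Cmd → List ℕ
  | realStore a _ _ => [a]
  | seq c d => c.realArrs ++ d.realArrs
  | ite _ c d => c.realArrs ++ d.realArrs
  | loop _ c => c.realArrs
  | _ => []

end Cmd

/-- The states `s` and `t` agree except on the variables that `c` writes. -/
structure Frame (c : Cmd) (s t : State) : Prop where
  natVar : ∀ v, v ∉ c.natVars → t.natVar v = s.natVar v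
  natArr : ∀ v, v ∉ c.natArrs → t.natArr v = s.natArr v
  realVar : ∀ v, v ∉ c.realVars → t.realVar v = s.realVar v
  realArr : ∀ v, v ∉ c.realArrs → t.realArr v = s.realArr v

/-- The specifications below mention only what a program computes. That the rest of the memory
survives is read off the syntax, mostly by `decide` on the lists of written variables. -/
theorem Exec.frame {c : Cmd} {s t : State} {T : ℕ} (h : Exec c s t T) : Frame c s t := by
  induction h with
  | skip s => constructor <;> intros <;> rfl
  | natAssign s v e =>
    constructor <;> intro w hw <;> simp_all [Cmd.natVars, State.setNatVar, Function.update]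
  | natStore s a i e =>
    constructor <;> intro w hw <;> simp_all [Cmd.natArrs, State.setNatArr, Function.update]
  | realAssign s v e =>
    constructor <;> intro w hw <;> simp_all [Cmd.realVars, State.setRealVar, Function.update]
  | realStore s a i e =>
    constructor <;> intro w hw <;> simp_all [Cmd.realArrs, State.setRealArr, Function.update]
  | seq _ _ ih1 ih2 =>
    constructor <;> intro w hw <;>
      simp only [Cmd.natVars, Cmd.natArrs, Cmd.realVars, Cmd.realArrs, List.mem_append,
        not_or] at hw
    · rw [ih2.natVar w hw.2, ih1.natVar w hw.1]
    · rw [ih2.natArr w hw.2, ih1.natArr w hw.1]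
    · rw [ih2.realVar w hw.2, ih1.realVar w hw.1]
    · rw [ih2.realArr w hw.2, ih1.realArr w hw.1]
  | iteTrue _ _ ih =>
    constructor <;> intro w hw <;>
      simp only [Cmd.natVars, Cmd.natArrs, Cmd.realVars, Cmd.realArrs, List.mem_append,
        not_or] at hw
    · exact ih.natVar w hw.1
    · exact ih.natArr w hw.1
    · exact ih.realVar w hw.1
    · exact ih.realArr w hw.1
  | iteFalse _ _ ih =>
    constructor <;> intro w hw <;>
      simp only [Cmd.natVars, Cmd.natArrs, Cmd.realVars, Cmd.realArrs, List.mem_append,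
        not_or] at hw
    · exact ih.natVar w hw.2
    · exact ih.natArr w hw.2
    · exact ih.realVar w hw.2
    · exact ih.realArr w hw.2
  | loopTrue _ _ _ ih1 ih2 =>
    constructor <;> intro w hw
    · rw [ih2.natVar w hw, ih1.natVar w hw]
    · rw [ih2.natArr w hw, ih1.natArr w hw]
    · rw [ih2.realVar w hw, ih1.realVar w hw]
    · rw [ih2.realArr w hw, ih1.realArr w hw]
  | loopFalse _ => constructor <;> intros <;> rfl

theorem WP.frame {c : Cmd} {Q : State → ℕ → Prop} {s : State} (h : WP c Q s) :
    WP c (fun t T => Q t T ∧ Frame c s t) s := by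
  obtain ⟨t, T, he, hq⟩ := h
  exact ⟨t, T, he, hq, he.frame⟩

/-! ## Evaluation in updated states -/

theorem natVar_setNatVar (s : State) (v k w : ℕ) :
    (s.setNatVar v k).natVar w = if w = v then k else s.natVar w := by
  simp [State.setNatVar, Function.update_apply]

theorem natArr_setNatVar (s : State) (v k : ℕ) : (s.setNatVar v k).natArr = s.natArr := rfl

theorem realVar_setNatVar (s : State) (v k : ℕ) : (s.setNatVar v k).realVar = s.realVar := rfl

theorem realArr_setNatVar (s : State) (v k : ℕ) : (s.setNatVar v k).realArr = s.realArr := rfl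

theorem natVar_setNatArr (s : State) (a i k : ℕ) : (s.setNatArr a i k).natVar = s.natVar := rfl

theorem natArr_setNatArr (s : State) (a i k b : ℕ) :
    (s.setNatArr a i k).natArr b =
      if b = a then Function.update (s.natArr a) i k else s.natArr b := by
  simp [State.setNatArr, Function.update_apply]

theorem realVar_setNatArr (s : State) (a i k : ℕ) :
    (s.setNatArr a i k).realVar = s.realVar := rfl

theorem realArr_setNatArr (s : State) (a i k : ℕ) :
    (s.setNatArr a i k).realArr = s.realArr := rfl

theorem natVar_setRealVar (s : State) (v : ℕ) (r : ℝ) :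
    (s.setRealVar v r).natVar = s.natVar := rfl

theorem natArr_setRealVar (s : State) (v : ℕ) (r : ℝ) :
    (s.setRealVar v r).natArr = s.natArr := rfl

theorem realVar_setRealVar (s : State) (v w : ℕ) (r : ℝ) :
    (s.setRealVar v r).realVar w = if w = v then r else s.realVar w := by
  simp [State.setRealVar, Function.update_apply]

theorem realArr_setRealVar (s : State) (v : ℕ) (r : ℝ) :
    (s.setRealVar v r).realArr = s.realArr := rfl

theorem natVar_setRealArr (s : State) (a i : ℕ) (r : ℝ) :
    (s.setRealArr a i r).natVar = s.natVar := rfl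

theorem natArr_setRealArr (s : State) (a i : ℕ) (r : ℝ) :
    (s.setRealArr a i r).natArr = s.natArr := rfl

theorem realVar_setRealArr (s : State) (a i : ℕ) (r : ℝ) :
    (s.setRealArr a i r).realVar = s.realVar := rfl

theorem realArr_setRealArr (s : State) (a i b : ℕ) (r : ℝ) :
    (s.setRealArr a i r).realArr b =
      if b = a then Function.update (s.realArr a) i r else s.realArr b := by
  simp [State.setRealArr, Function.update_apply]

attribute [simp] wp_skip wp_natAssign wp_natStore wp_realAssign wp_realStore wp_seq wp_ite
  natVar_setNatVar natArr_setNatVar realVar_setNatVar realArr_setNatVar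
  natVar_setNatArr natArr_setNatArr realVar_setNatArr realArr_setNatArr
  natVar_setRealVar natArr_setRealVar realVar_setRealVar realArr_setRealVar
  natVar_setRealArr natArr_setRealArr realVar_setRealArr realArr_setRealArr
  NExp.val NExp.cost RExp.val RExp.cost Test.Holds Test.cost

end RealRAM

noncomputable section

/-! ## Coordinates along and across a direction -/

/-- Coordinate across the direction `u`, scaled by `‖u‖`; the sign `σ` chooses the orientation. -/
def lat (σ : ℝ) (u z : Plane) : ℝ := σ * det2 u z

/-- Coordinate along the direction `u`, scaled by `‖u‖`; the sign `σ` chooses the orientation. -/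
def lon (σ : ℝ) (u z : Plane) : ℝ := σ * (u 0 * z 0 + u 1 * z 1)

/-- The point with given coordinates. -/
def ofCoords (σ τ : ℝ) (u : Plane) (a b : ℝ) : Plane :=
  !₂[(τ * b * u 0 - σ * a * u 1) / (u 0 * u 0 + u 1 * u 1),
    (τ * b * u 1 + σ * a * u 0) / (u 0 * u 0 + u 1 * u 1)]

theorem plane_norm_eq (u : Plane) : ‖u‖ = √(u 0 * u 0 + u 1 * u 1) := by
  rw [EuclideanSpace.norm_eq, Fin.sum_univ_two]
  simp [pow_two]

theorem plane_norm_sq_pos {u : Plane} (hu : u ≠ 0) : 0 < u 0 * u 0 + u 1 * u 1 := by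
  have h := norm_pos_iff.2 hu
  rw [plane_norm_eq] at h
  exact Real.sqrt_pos.1 h

theorem lat_combine (σ : ℝ) (u x y d : Plane) (s t : ℝ) :
    lat σ u (x + s • (y - x) + t • d) =
      lat σ u x + s * (lat σ u y - lat σ u x) + t * lat σ u d := by
  simp [lat, det2]; ring

theorem lon_combine (σ : ℝ) (u x y d : Plane) (s t : ℝ) :
    lon σ u (x + s • (y - x) + t • d) =
      lon σ u x + s * (lon σ u y - lon σ u x) + t * lon σ u d := by
  simp [lon]; ring

theorem lat_sub (σ : ℝ) (u x y : Plane) : lat σ u (x - y) = lat σ u x - lat σ u y := by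
  simp [lat, det2]; ring

theorem lon_sub (σ : ℝ) (u x y : Plane) : lon σ u (x - y) = lon σ u x - lon σ u y := by
  simp [lon]; ring

theorem eq_of_lat_lon {σ τ : ℝ} {u z w : Plane} (hσ : σ * σ = 1) (hτ : τ * τ = 1) (hu : u ≠ 0)
    (h1 : lat σ u z = lat σ u w) (h2 : lon τ u z = lon τ u w) : z = w := by
  have hN := plane_norm_sq_pos hu
  have hσ0 : σ ≠ 0 := fun h => by simp [h] at hσ
  have hτ0 : τ ≠ 0 := fun h => by simp [h] at hτ
  have e1 := mul_left_cancel₀ hσ0 h1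
  have e2 := mul_left_cancel₀ hτ0 h2
  simp only [det2] at e1
  ext i
  fin_cases i
  · refine mul_left_cancel₀ hN.ne' ?_
    show _ * z 0 = _ * w 0
    linear_combination u 0 * e2 - u 1 * e1
  · refine mul_left_cancel₀ hN.ne' ?_
    show _ * z 1 = _ * w 1
    linear_combination u 1 * e2 + u 0 * e1

theorem lat_ofCoords {σ τ : ℝ} {u : Plane} (hσ : σ * σ = 1) (hu : u ≠ 0) (a b : ℝ) :
    lat σ u (ofCoords σ τ u a b) = a := by
  have hN : u 0 ^ 2 + u 1 ^ 2 ≠ 0 := by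
    have := (plane_norm_sq_pos hu).ne'
    rwa [← pow_two, ← pow_two] at this
  simp only [lat, det2, ofCoords, PiLp.toLp_apply, Matrix.cons_val_zero, Matrix.cons_val_one]
  field_simp
  linear_combination (a * (u 0 ^ 2 + u 1 ^ 2)) * hσ

theorem lon_ofCoords {σ τ : ℝ} {u : Plane} (hτ : τ * τ = 1) (hu : u ≠ 0) (a b : ℝ) :
    lon τ u (ofCoords σ τ u a b) = b := by
  have hN : u 0 ^ 2 + u 1 ^ 2 ≠ 0 := by
    have := (plane_norm_sq_pos hu).ne'
    rwa [← pow_two, ← pow_two] at this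
  simp only [lon, ofCoords, PiLp.toLp_apply, Matrix.cons_val_zero, Matrix.cons_val_one]
  field_simp
  linear_combination (b * (u 0 ^ 2 + u 1 ^ 2)) * hτ

/-- The change of coordinates is a similarity that preserves or reverses orientation according to `σ
* τ`. Through this identity the sign conditions of `VShape` become inequalities between coordinates.
-/
theorem det2_coords (σ τ : ℝ) (u v d : Plane) :
    lat σ u v * lon τ u d - lon τ u v * lat σ u d =
      -(σ * τ) * ((u 0 * u 0 + u 1 * u 1) * det2 v d) := by
  simp only [lat, lon, det2]; ring

theorem lat_lon_sq {σ τ : ℝ} (hσ : σ * σ = 1) (hτ : τ * τ = 1) (u d : Plane) :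
    lat σ u d * lat σ u d + lon τ u d * lon τ u d =
      (u 0 * u 0 + u 1 * u 1) * (d 0 * d 0 + d 1 * d 1) := by
  simp only [lat, lon, det2]
  linear_combination (u 0 * d 1 - u 1 * d 0) ^ 2 * hσ + (u 0 * d 0 + u 1 * d 1) ^ 2 * hτ

theorem armWidth_coords {σ τ : ℝ} (hσ : σ * σ = 1) (hτ : τ * τ = 1) {u : Plane} (hu : u ≠ 0)
    (x y d : Plane) :
    VShape.armWidth x y d * ‖u‖ =
      |lat σ u (y - x) * lon τ u d - lon τ u (y - x) * lat σ u d| /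
        √(lat σ u d * lat σ u d + lon τ u d * lon τ u d) := by
  have hN := plane_norm_sq_pos hu
  have h1 : |-(σ * τ)| = 1 := by
    rw [abs_neg, ← abs_one, ← sq_eq_sq_iff_abs_eq_abs]
    linear_combination τ * τ * hσ + hτ
  rw [det2_coords, lat_lon_sq hσ hτ, abs_mul, h1, abs_mul, abs_of_pos hN, one_mul,
    Real.sqrt_mul hN.le, ← plane_norm_eq, ← plane_norm_eq, VShape.armWidth]
  have hu' : ‖u‖ ≠ 0 := norm_ne_zero_iff.2 hu
  have hNu : u 0 * u 0 + u 1 * u 1 = ‖u‖ * ‖u‖ := by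
    rw [plane_norm_eq, Real.mul_self_sqrt hN.le]
  rw [hNu]
  by_cases hd : ‖d‖ = 0
  · simp [hd]
  · field_simp

theorem armWidth_along {σ τ : ℝ} (hσ : σ * σ = 1) (hτ : τ * τ = 1) {u : Plane} (hu : u ≠ 0)
    {x y d : Plane} (hd : lat σ u d = 0) (hd' : 0 < lon τ u d)
    (hxy : lat σ u y ≤ lat σ u x) :
    VShape.armWidth x y d * ‖u‖ = lat σ u x - lat σ u y := by
  rw [armWidth_coords hσ hτ hu, hd, lat_sub]
  simp only [mul_zero, sub_zero, zero_add]
  rw [Real.sqrt_mul_self hd'.le, abs_mul, abs_of_pos hd', abs_of_nonpos (by linarith)]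
  field_simp
  ring

theorem armWidth_across {σ τ : ℝ} (hσ : σ * σ = 1) (hτ : τ * τ = 1) {u : Plane} (hu : u ≠ 0)
    {x y d : Plane} {c : ℝ} (hd : 0 < lat σ u d) (hc : lon τ u d = -c * lat σ u d)
    (hxy : lon τ u y + c * lat σ u y ≤ lon τ u x + c * lat σ u x) :
    VShape.armWidth x y d * ‖u‖ =
      ((lon τ u x + c * lat σ u x) - (lon τ u y + c * lat σ u y)) / √(1 + c * c) := by
  rw [armWidth_coords hσ hτ hu, hc, lat_sub, lon_sub]
  have e1 : lat σ u d * lat σ u d + -c * lat σ u d * (-c * lat σ u d) =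
      (lat σ u d * lat σ u d) * (1 + c * c) := by ring
  have e2 : (lat σ u y - lat σ u x) * (-c * lat σ u d) - (lon τ u y - lon τ u x) * lat σ u d =
      lat σ u d * ((lon τ u x + c * lat σ u x) - (lon τ u y + c * lat σ u y)) := by ring
  rw [e1, e2, Real.sqrt_mul (mul_self_nonneg _), Real.sqrt_mul_self hd.le, abs_mul,
    abs_of_pos hd, abs_of_nonneg (by linarith)]
  rw [mul_div_mul_left _ _ hd.ne']

theorem exists_convex_param {p q z : ℝ} (h1 : q ≤ z) (h2 : z ≤ p) :
    ∃ s : ℝ, 0 ≤ s ∧ s ≤ 1 ∧ z = p + s * (q - p) := by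
  by_cases h : p = q
  · exact ⟨0, le_rfl, zero_le_one, by linarith⟩
  · have hpq : 0 < p - q := sub_pos.2 (lt_of_le_of_ne (h1.trans h2) (Ne.symm h))
    refine ⟨(p - z) / (p - q), div_nonneg (by linarith) hpq.le,
      (div_le_one hpq).2 (by linarith), ?_⟩
    field_simp
    ring

/-- Membership in the union of two arms in coordinates: `d` is parallel to `u`, and the functional
`lon + c * lat` vanishes on `e`. -/
theorem mem_arms_iff {σ τ : ℝ} (hσ : σ * σ = 1) (hτ : τ * τ = 1) {u : Plane} (hu : u ≠ 0)
    {x y d e : Plane} {c : ℝ} (hd : lat σ u d = 0) (hd' : 0 < lon τ u d)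
    (he : 0 < lat σ u e) (hc : lon τ u e = -c * lat σ u e)
    (hlat : lat σ u y ≤ lat σ u x)
    (hlon : lon τ u y + c * lat σ u y ≤ lon τ u x + c * lat σ u x) (z : Plane) :
    z ∈ VShape.armRegion x y d ∪ VShape.armRegion x y e ↔
      lat σ u y ≤ lat σ u z ∧ lon τ u y + c * lat σ u y ≤ lon τ u z + c * lat σ u z ∧
        (lat σ u z ≤ lat σ u x ∨
          lon τ u z + c * lat σ u z ≤ lon τ u x + c * lat σ u x) := by
  have left : ∀ s, 0 ≤ s → s ≤ 1 → lat σ u z = lat σ u x + s * (lat σ u y - lat σ u x) →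
      lon τ u x + s * (lon τ u y - lon τ u x) ≤ lon τ u z → z ∈ VShape.armRegion x y d := by
    intro s h0 h1 hz hz'
    refine ⟨s, (lon τ u z - (lon τ u x + s * (lon τ u y - lon τ u x))) / lon τ u d, h0, h1,
      div_nonneg (by linarith) hd'.le, eq_of_lat_lon hσ hτ hu ?_ ?_⟩
    · rw [lat_combine, hd, hz]; ring
    · rw [lon_combine]; field_simp; ring
  constructor
  · rintro (⟨s, t, hs0, hs1, ht, rfl⟩ | ⟨s, t, hs0, hs1, ht, rfl⟩)
    · rw [lat_combine, lon_combine, hd]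
      have := mul_nonneg ht hd'.le
      refine ⟨by nlinarith, by nlinarith, Or.inl (by nlinarith)⟩
    · rw [lat_combine, lon_combine, hc]
      have := mul_nonneg ht he.le
      refine ⟨by nlinarith, by nlinarith, Or.inr (by nlinarith)⟩
  · rintro ⟨h1, h2, h3⟩
    by_cases ha : lat σ u z ≤ lat σ u x
    · obtain ⟨s, hs0, hs1, hs⟩ := exists_convex_param h1 ha
      by_cases hb : lon τ u z + c * lat σ u z ≤ lon τ u x + c * lat σ u x
      · obtain ⟨r, hr0, hr1, hr⟩ := exists_convex_param h2 hb
        -- For a point in both strips, `s` and `r` locate on the segment `xy` the points with the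
        -- same `lat` and the same `lon + c * lat`. Their order tells on which side of the segment
        -- the point lies, hence which arm contains it.
        rcases le_total r s with hrs | hrs
        · refine Or.inl (left s hs0 hs1 hs ?_)
          have := mul_nonneg (sub_nonneg.2 hrs) (sub_nonneg.2 hlon)
          rw [hs] at hr
          nlinarith
        · refine Or.inr ⟨r, (s - r) * (lat σ u y - lat σ u x) / lat σ u e, hr0, hr1,
            div_nonneg (mul_nonneg_of_nonpos_of_nonpos (by linarith) (by linarith)) he.le,
            eq_of_lat_lon hσ hτ hu ?_ ?_⟩
          · rw [lat_combine]; field_simp; linarith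
          · rw [lon_combine, hc]; field_simp; rw [hs] at hr; linarith
      · refine Or.inl (left s hs0 hs1 hs ?_)
        rw [hs] at hb
        nlinarith
    · have hb := h3.resolve_left ha
      obtain ⟨r, hr0, hr1, hr⟩ := exists_convex_param h2 hb
      refine Or.inr ⟨r, (lat σ u z - (lat σ u x + r * (lat σ u y - lat σ u x))) / lat σ u e,
        hr0, hr1, div_nonneg ?_ he.le, eq_of_lat_lon hσ hτ hu ?_ ?_⟩
      · nlinarith
      · rw [lat_combine]; field_simp; ring
      · rw [lon_combine, hc]; field_simp; linarith

/-! ## V-shapes in coordinates -/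

/-- The V-shape `V` in the coordinates given by the signs `σ` and `τ`: its arm along `u` is the
strip `ay ≤ lat ≤ ax`, its other arm is the strip `Y ≤ lon + c * lat ≤ X`. -/
structure InCoords (V : VShape) (u : Plane) (σ τ ax ay c X Y : ℝ) : Prop where
  lat_le : ay ≤ ax
  lon_le : Y ≤ X
  mem_iff : ∀ z, z ∈ V.region ↔ ay ≤ lat σ u z ∧ Y ≤ lon τ u z + c * lat σ u z ∧
    (lat σ u z ≤ ax ∨ lon τ u z + c * lat σ u z ≤ X)
  width_eq : V.width * ‖u‖ = max (ax - ay) ((X - Y) / √(1 + c * c))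

theorem inCoords_of_left {V : VShape} {u : Plane} (hu : u ≠ 0) {σ τ c : ℝ} (hσ : σ * σ = 1)
    (hτ : τ * τ = 1) (hd : lat σ u V.leftDir = 0) (hd' : 0 < lon τ u V.leftDir)
    (he : 0 < lat σ u V.rightDir) (hc : lon τ u V.rightDir = -c * lat σ u V.rightDir)
    (hlat : lat σ u V.y ≤ lat σ u V.x)
    (hlon : lon τ u V.y + c * lat σ u V.y ≤ lon τ u V.x + c * lat σ u V.x) :
    InCoords V u σ τ (lat σ u V.x) (lat σ u V.y) c (lon τ u V.x + c * lat σ u V.x)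
      (lon τ u V.y + c * lat σ u V.y) := by
  refine ⟨hlat, hlon, fun z => mem_arms_iff hσ hτ hu hd hd' he hc hlat hlon z, ?_⟩
  rw [VShape.width, max_mul_of_nonneg _ _ (norm_nonneg u),
    armWidth_along hσ hτ hu hd hd' hlat, armWidth_across hσ hτ hu he hc hlon]

theorem inCoords_of_right {V : VShape} {u : Plane} (hu : u ≠ 0) {σ τ c : ℝ} (hσ : σ * σ = 1)
    (hτ : τ * τ = 1) (hd : lat σ u V.rightDir = 0) (hd' : 0 < lon τ u V.rightDir)
    (he : 0 < lat σ u V.leftDir) (hc : lon τ u V.leftDir = -c * lat σ u V.leftDir)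
    (hlat : lat σ u V.y ≤ lat σ u V.x)
    (hlon : lon τ u V.y + c * lat σ u V.y ≤ lon τ u V.x + c * lat σ u V.x) :
    InCoords V u σ τ (lat σ u V.x) (lat σ u V.y) c (lon τ u V.x + c * lat σ u V.x)
      (lon τ u V.y + c * lat σ u V.y) := by
  refine ⟨hlat, hlon, fun z => ?_, ?_⟩
  · rw [VShape.region, Set.union_comm]
    exact mem_arms_iff hσ hτ hu hd hd' he hc hlat hlon z
  · rw [VShape.width, max_mul_of_nonneg _ _ (norm_nonneg u),
      armWidth_along hσ hτ hu hd hd' hlat, armWidth_across hσ hτ hu he hc hlon, max_comm]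

theorem exists_sign {r : ℝ} (hr : r ≠ 0) : ∃ τ : ℝ, (τ = 1 ∨ τ = -1) ∧ 0 < τ * r := by
  rcases lt_or_gt_of_ne hr with h | h
  · exact ⟨-1, Or.inr rfl, by linarith⟩
  · exact ⟨1, Or.inl rfl, by linarith⟩

/-- Every V-shape with an arm in direction `u` has coordinates for some choice of signs. -/
theorem exists_inCoords {V : VShape} {u : Plane} (hu : u ≠ 0) (hV : V.HasArmInDirection u) :
    ∃ σ τ ax ay c X Y : ℝ, (σ = 1 ∨ σ = -1) ∧ (τ = 1 ∨ τ = -1) ∧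
      InCoords V u σ τ ax ay c X Y := by
  have hN := plane_norm_sq_pos hu
  have hw := V.wedge
  have hl := V.left_side
  have hr := V.right_side
  -- Lagrange's identity: the squares of the determinant and of the inner product add up to the
  -- product of the squared norms.
  have key : ∀ d : Plane, det2 d u = 0 → (d 0 ≠ 0 ∨ d 1 ≠ 0) →
      u 0 * d 0 + u 1 * d 1 ≠ 0 := by
    intro d h hd h0
    have e : (u 0 * u 0 + u 1 * u 1) * (d 0 * d 0 + d 1 * d 1) = 0 := by
      simp only [det2] at h
      linear_combination (u 0 * d 0 + u 1 * d 1) * h0 + (d 0 * u 1 - d 1 * u 0) * h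
    have e' := (mul_eq_zero.1 e).resolve_left hN.ne'
    rcases hd with hd | hd
    · nlinarith [mul_self_pos.2 hd, mul_self_nonneg (d 1)]
    · nlinarith [mul_self_pos.2 hd, mul_self_nonneg (d 0)]
  have hanti : ∀ a b : Plane, det2 b a = -det2 a b := fun a b => by simp only [det2]; ring
  -- The sign `τ` makes the arm along `u` point towards positive `lon`. The wedge condition then
  -- forces `σ = τ` if this arm is the left one and `σ = -τ` if it is the right one, so that the
  -- other arm points towards positive `lat`.
  rcases hV with h | h
  · have h0 : u 0 * V.leftDir 0 + u 1 * V.leftDir 1 ≠ 0 := by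
      refine key _ h ?_
      by_contra! hc
      simp [det2, hc] at hw
    obtain ⟨τ, hτ, hpos⟩ := exists_sign h0
    have hτ' : τ * τ = 1 := by rcases hτ with rfl | rfl <;> norm_num
    have hd : lat τ u V.leftDir = 0 := by rw [lat, hanti, h]; simp
    have e1 := det2_coords τ τ u (V.y - V.x) V.leftDir
    have e2 := det2_coords τ τ u (V.y - V.x) V.rightDir
    have e3 := det2_coords τ τ u V.leftDir V.rightDir
    rw [hτ', lat_sub, lon_sub] at e1 e2
    rw [hτ', hd] at e3
    rw [hd] at e1
    have hpos' : 0 < lon τ u V.leftDir := hpos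
    have he : 0 < lat τ u V.rightDir := by
      by_contra! hcon
      nlinarith [mul_pos hN hw]
    have hlat : lat τ u V.y ≤ lat τ u V.x := by
      by_contra! hcon
      nlinarith [mul_nonneg hN.le hl, mul_pos (sub_pos.2 hcon) hpos']
    have hc : lon τ u V.rightDir =
        -(-lon τ u V.rightDir / lat τ u V.rightDir) * lat τ u V.rightDir := by
      field_simp
    refine ⟨τ, τ, _, _, -lon τ u V.rightDir / lat τ u V.rightDir, _, _, hτ, hτ,
      inCoords_of_left hu hτ' hτ' hd hpos' he hc hlat ?_⟩
    set c := -lon τ u V.rightDir / lat τ u V.rightDir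
    rw [hc] at e2
    by_contra! hcon
    nlinarith [mul_nonneg hN.le (neg_nonneg.2 hr), mul_pos (sub_pos.2 hcon) he]
  · have h0 : u 0 * V.rightDir 0 + u 1 * V.rightDir 1 ≠ 0 := by
      refine key _ h ?_
      by_contra! hc
      simp [det2, hc] at hw
    obtain ⟨τ, hτ, hpos⟩ := exists_sign h0
    have hτ' : τ * τ = 1 := by rcases hτ with rfl | rfl <;> norm_num
    have hσ' : -τ * -τ = 1 := by linarith
    have hd : lat (-τ) u V.rightDir = 0 := by rw [lat, hanti, h]; simp
    have e1 := det2_coords (-τ) τ u (V.y - V.x) V.rightDir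
    have e2 := det2_coords (-τ) τ u (V.y - V.x) V.leftDir
    have e3 := det2_coords (-τ) τ u V.rightDir V.leftDir
    have hst : -(-τ * τ) = 1 := by linarith
    rw [hst, lat_sub, lon_sub] at e1 e2
    rw [hst, hd] at e3
    rw [hd] at e1
    rw [hanti] at e3
    have hpos' : 0 < lon τ u V.rightDir := hpos
    have he : 0 < lat (-τ) u V.leftDir := by
      by_contra! hcon
      nlinarith [mul_pos hN hw]
    have hlat : lat (-τ) u V.y ≤ lat (-τ) u V.x := by
      by_contra! hcon
      nlinarith [mul_nonneg hN.le (neg_nonneg.2 hr), mul_pos (sub_pos.2 hcon) hpos']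
    have hc : lon τ u V.leftDir =
        -(-lon τ u V.leftDir / lat (-τ) u V.leftDir) * lat (-τ) u V.leftDir := by
      field_simp
    refine ⟨-τ, τ, _, _, -lon τ u V.leftDir / lat (-τ) u V.leftDir, _, _,
      by rcases hτ with rfl | rfl <;> simp, hτ,
      inCoords_of_right hu hσ' hτ' hd hpos' he hc hlat ?_⟩
    set c := -lon τ u V.leftDir / lat (-τ) u V.leftDir
    rw [hc] at e2
    by_contra! hcon
    nlinarith [mul_nonneg hN.le hl, mul_pos (sub_pos.2 hcon) he]

/-- The V-shape with given coordinates. -/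
theorem exists_vshape {u : Plane} (hu : u ≠ 0) {σ τ : ℝ} (hσ : σ = 1 ∨ σ = -1)
    (hτ : τ = 1 ∨ τ = -1) {ax ay c X Y : ℝ} (ha : ay ≤ ax) (hXY : Y ≤ X) :
    ∃ V : VShape, V.HasArmInDirection u ∧ InCoords V u σ τ ax ay c X Y ∧
      V.x = ofCoords σ τ u ax (X - c * ax) ∧ V.y = ofCoords σ τ u ay (Y - c * ay) ∧
      (σ = τ → V.leftDir = !₂[τ * u 0, τ * u 1] ∧
        V.rightDir = !₂[-(σ * u 1) - c * τ * u 0, σ * u 0 - c * τ * u 1]) ∧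
      (σ ≠ τ → V.rightDir = !₂[τ * u 0, τ * u 1] ∧
        V.leftDir = !₂[-(σ * u 1) - c * τ * u 0, σ * u 0 - c * τ * u 1]) := by
  have hN := plane_norm_sq_pos hu
  have hσ' : σ * σ = 1 := by rcases hσ with rfl | rfl <;> norm_num
  have hτ' : τ * τ = 1 := by rcases hτ with rfl | rfl <;> norm_num
  set x := ofCoords σ τ u ax (X - c * ax) with hx
  set y := ofCoords σ τ u ay (Y - c * ay) with hy
  set d : Plane := !₂[τ * u 0, τ * u 1] with hd
  set e : Plane := !₂[-(σ * u 1) - c * τ * u 0, σ * u 0 - c * τ * u 1] with he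
  have lx : lat σ u x = ax := lat_ofCoords hσ' hu _ _
  have ly : lat σ u y = ay := lat_ofCoords hσ' hu _ _
  have ox : lon τ u x = X - c * ax := lon_ofCoords hτ' hu _ _
  have oy : lon τ u y = Y - c * ay := lon_ofCoords hτ' hu _ _
  have ld : lat σ u d = 0 := by simp [lat, det2, hd]; right; ring
  have od : lon τ u d = u 0 * u 0 + u 1 * u 1 := by
    simp [lon, hd]; linear_combination (u 0 * u 0 + u 1 * u 1) * hτ'
  have le : lat σ u e = u 0 * u 0 + u 1 * u 1 := by
    simp [lat, det2, he]; linear_combination (u 0 * u 0 + u 1 * u 1) * hσ'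
  have oe : lon τ u e = -c * (u 0 * u 0 + u 1 * u 1) := by
    simp [lon, he]; linear_combination -c * (u 0 * u 0 + u 1 * u 1) * hτ'
  have e1 := det2_coords σ τ u (y - x) d
  have e2 := det2_coords σ τ u (y - x) e
  have e3 := det2_coords σ τ u d e
  rw [lat_sub, lon_sub, lx, ly, ox, oy, ld, od] at e1
  rw [lat_sub, lon_sub, lx, ly, ox, oy, le, oe] at e2
  rw [ld, od, le, oe] at e3
  have hda : det2 d u = 0 := by simp [det2, hd]; ring
  have hanti : ∀ a b : Plane, det2 b a = -det2 a b := fun a b => by simp only [det2]; ring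
  by_cases hst : σ = τ
  · subst hst
    rw [hσ'] at e1 e2 e3
    let V : VShape :=
      { x := x, y := y, leftDir := d, rightDir := e
        left_side := by
          refine (mul_nonneg_iff_of_pos_left hN).1 ?_
          linarith [mul_nonneg hN.le (sub_nonneg.2 ha)]
        right_side := by
          rw [← neg_nonneg]
          refine (mul_nonneg_iff_of_pos_left hN).1 ?_
          linarith [mul_nonneg hN.le (sub_nonneg.2 hXY)]
        wedge := by
          refine (mul_pos_iff_of_pos_left hN).1 ?_
          linarith [mul_pos hN hN] }
    refine ⟨V, Or.inl hda, ?_, rfl, rfl, fun _ => ⟨rfl, rfl⟩, fun h => absurd rfl h⟩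
    have := inCoords_of_left (V := V) hu (c := c) hσ' hτ' ld (by rw [od]; exact hN)
      (by rw [le]; exact hN) (by rw [le, oe]) (by rw [lx, ly]; exact ha)
      (by rw [lx, ly, ox, oy]; linarith)
    rw [lx, ly, ox, oy] at this
    simpa using this
  · have hst' : σ * τ = -1 := by
      rcases hσ with rfl | rfl <;> rcases hτ with rfl | rfl <;>
        first | exact absurd rfl hst | norm_num
    rw [hst'] at e1 e2 e3
    let V : VShape :=
      { x := x, y := y, leftDir := e, rightDir := d
        left_side := by
          refine (mul_nonneg_iff_of_pos_left hN).1 ?_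
          linarith [mul_nonneg hN.le (sub_nonneg.2 hXY)]
        right_side := by
          rw [← neg_nonneg]
          refine (mul_nonneg_iff_of_pos_left hN).1 ?_
          linarith [mul_nonneg hN.le (sub_nonneg.2 ha)]
        wedge := by
          rw [hanti]
          refine (mul_pos_iff_of_pos_left hN).1 ?_
          linarith [mul_pos hN hN] }
    refine ⟨V, Or.inr hda, ?_, rfl, rfl, fun h => absurd h hst, fun _ => ⟨rfl, rfl⟩⟩
    have := inCoords_of_right (V := V) hu (c := c) hσ' hτ' ld (by rw [od]; exact hN)
      (by rw [le]; exact hN) (by rw [le, oe]) (by rw [lx, ly]; exact ha)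
      (by rw [lx, ly, ox, oy]; linarith)
    rw [lx, ly, ox, oy] at this
    simpa using this

end

/-! ## Upper envelopes of lines -/

/-- The value at `c` of the line with intercept `ic t` and slope `sl t`. -/
def lineAt (sl ic : ℕ → ℝ) (t : ℕ) (c : ℝ) : ℝ := ic t + c * sl t

/-- The abscissa at which the lines `t` and `t + 1` meet. -/
noncomputable def breakpoint (sl ic : ℕ → ℝ) (t : ℕ) : ℝ :=
  (ic t - ic (t + 1)) / (sl (t + 1) - sl t)

/-- The lines `0, …, m - 1` are the consecutive pieces of their upper envelope. -/
structure IsEnvelope (m : ℕ) (sl ic : ℕ → ℝ) : Prop where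
  pos : 0 < m
  slope : ∀ t, t + 1 < m → sl t < sl (t + 1)
  brk : ∀ t, t + 2 < m → breakpoint sl ic t ≤ breakpoint sl ic (t + 1)

namespace IsEnvelope

variable {m : ℕ} {sl ic : ℕ → ℝ}

theorem le_succ_iff (h : IsEnvelope m sl ic) {t : ℕ} (ht : t + 1 < m) (c : ℝ) :
    lineAt sl ic t c ≤ lineAt sl ic (t + 1) c ↔ breakpoint sl ic t ≤ c := by
  have hs := sub_pos.2 (h.slope t ht)
  rw [breakpoint, div_le_iff₀ hs, lineAt, lineAt]
  constructor <;> intro h <;> linarith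

theorem succ_le_iff (h : IsEnvelope m sl ic) {t : ℕ} (ht : t + 1 < m) (c : ℝ) :
    lineAt sl ic (t + 1) c ≤ lineAt sl ic t c ↔ c ≤ breakpoint sl ic t := by
  have hs := sub_pos.2 (h.slope t ht)
  rw [breakpoint, le_div_iff₀ hs, lineAt, lineAt]
  constructor <;> intro h <;> linarith

theorem slope_mono (h : IsEnvelope m sl ic) {s t : ℕ} (hst : s ≤ t) (ht : t < m) :
    sl s ≤ sl t := by
  induction t, hst using Nat.le_induction with
  | base => exact le_rfl
  | succ t _ ih => exact (ih (by omega)).trans (h.slope t ht).le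

theorem brk_mono (h : IsEnvelope m sl ic) {s t : ℕ} (hst : s ≤ t) (ht : t + 1 < m) :
    breakpoint sl ic s ≤ breakpoint sl ic t := by
  induction t, hst using Nat.le_induction with
  | base => exact le_rfl
  | succ t _ ih => exact (ih (by omega)).trans (h.brk t ht)

/-- Breakpoints increase, so `c` lies to the left of all breakpoints from `s` on, and each
comparison of neighbouring lines has the same outcome. -/
theorem le_of_le_brk (h : IsEnvelope m sl ic) {s t : ℕ} (hst : s ≤ t) (ht : t < m) {c : ℝ}
    (hc : s + 1 < m → c ≤ breakpoint sl ic s) : lineAt sl ic t c ≤ lineAt sl ic s c := by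
  induction t, hst using Nat.le_induction with
  | base => exact le_rfl
  | succ t hle ih =>
    exact ((h.succ_le_iff ht c).2 ((hc (by omega)).trans (h.brk_mono hle ht))).trans
      (ih (by omega))

theorem le_of_brk_le (h : IsEnvelope m sl ic) {s t : ℕ} (hst : s ≤ t) (ht : t < m) {c : ℝ}
    (hc : ∀ r, r + 1 = t → breakpoint sl ic r ≤ c) : lineAt sl ic s c ≤ lineAt sl ic t c := by
  induction hk : t - s generalizing s with
  | zero => rw [show s = t by omega]
  | succ k ih =>
    obtain ⟨r, rfl⟩ : ∃ r, t = r + 1 := ⟨t - 1, by omega⟩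
    exact ((h.le_succ_iff (by omega) c).2
      ((h.brk_mono (by omega) ht).trans (hc r rfl))).trans (ih (by omega) (by omega))

/-- The piece of the envelope over `c`. -/
theorem exists_piece (h : IsEnvelope m sl ic) (c : ℝ) :
    ∃ t < m, (t + 1 < m → c ≤ breakpoint sl ic t) ∧
      ∀ r, r + 1 = t → breakpoint sl ic r ≤ c := by
  classical
  -- The first index whose breakpoint is not to the left of `c`. The last line `m - 1` has no
  -- breakpoint and always qualifies.
  have hex : ∃ t, t + 1 < m → c ≤ breakpoint sl ic t := ⟨m, fun h => by omega⟩
  refine ⟨Nat.find hex, ?_, Nat.find_spec hex, fun r hr => ?_⟩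
  · have := h.pos
    have : Nat.find hex ≤ m - 1 := Nat.find_min' hex (fun h => by omega)
    omega
  · have := Nat.find_min hex (m := r) (by omega)
    push Not at this
    exact this.2.le

theorem le_of_piece (h : IsEnvelope m sl ic) {s t : ℕ} (hs : s < m) (ht : t < m) {c : ℝ}
    (h1 : t + 1 < m → c ≤ breakpoint sl ic t)
    (h2 : ∀ r, r + 1 = t → breakpoint sl ic r ≤ c) : lineAt sl ic s c ≤ lineAt sl ic t c := by
  rcases le_total s t with hst | hst
  · exact h.le_of_brk_le hst ht h2
  · exact h.le_of_le_brk hst hs h1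

end IsEnvelope

/-! ### Convexity of `√(1 + x * x)` and the infimum of a quotient of an envelope sum by it -/

theorem one_add_mul_self_pos (a : ℝ) : 0 < 1 + a * a := by
  linarith [mul_self_nonneg a]

theorem sqrt_one_add_sq_sub_le (a b : ℝ) : √(1 + a * a) ≤ √(1 + b * b) + |a - b| := by
  rw [Real.sqrt_le_left (by positivity)]
  have h1 : √(1 + b * b) * √(1 + b * b) = 1 + b * b := Real.mul_self_sqrt (one_add_mul_self_pos _).le
  have h2 : |b| ≤ √(1 + b * b) := by
    rw [← Real.sqrt_sq_eq_abs]
    exact Real.sqrt_le_sqrt (by nlinarith)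
  have h3 : |a - b| * |a - b| = (a - b) * (a - b) := abs_mul_abs_self _
  have h4 : b * (a - b) ≤ |b| * |a - b| := by rw [← abs_mul]; exact le_abs_self _
  nlinarith [mul_le_mul_of_nonneg_right h2 (abs_nonneg (a - b))]

theorem sqrt_one_add_sq_convex {a b s : ℝ} (hs0 : 0 ≤ s) (hs1 : s ≤ 1) :
    √(1 + (a + s * (b - a)) * (a + s * (b - a))) ≤ (1 - s) * √(1 + a * a) + s * √(1 + b * b) := by
  have ha := Real.sqrt_nonneg (1 + a * a)
  have hb := Real.sqrt_nonneg (1 + b * b)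
  rw [Real.sqrt_le_left (by nlinarith)]
  have h1 : √(1 + a * a) * √(1 + a * a) = 1 + a * a := Real.mul_self_sqrt (one_add_mul_self_pos _).le
  have h2 : √(1 + b * b) * √(1 + b * b) = 1 + b * b := Real.mul_self_sqrt (one_add_mul_self_pos _).le
  -- Cauchy–Schwarz for `(1, a)` and `(1, b)`; convexity is the triangle inequality for these
  -- vectors.
  have h3 : 1 + a * b ≤ √(1 + a * a) * √(1 + b * b) := by
    rw [← Real.sqrt_mul (one_add_mul_self_pos _).le]
    exact Real.le_sqrt_of_sq_le (by nlinarith [sq_nonneg (a - b)])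
  have h4 : ((1 - s) * √(1 + a * a) + s * √(1 + b * b)) ^ 2 =
      (1 - s) ^ 2 * (√(1 + a * a) * √(1 + a * a)) + s ^ 2 * (√(1 + b * b) * √(1 + b * b)) +
        2 * (s * (1 - s) * (√(1 + a * a) * √(1 + b * b))) := by ring
  rw [h4, h1, h2]
  linarith [mul_le_mul_of_nonneg_left h3 (mul_nonneg hs0 (sub_nonneg.2 hs1))]

/-- An affine function that dominates `μ * √(1 + x ^ 2)` at a point on either side of `c`, or
has a slope that makes it do so at infinity, dominates it at `c`. -/
theorem sqrt_le_affine {μ p q c : ℝ} (hμ : 0 < μ)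
    (hl : (∃ e ≤ c, μ * √(1 + e * e) ≤ p + e * q) ∨ q ≤ -μ)
    (hr : (∃ e, c ≤ e ∧ μ * √(1 + e * e) ≤ p + e * q) ∨ μ ≤ q) :
    μ * √(1 + c * c) ≤ p + c * q := by
  rcases hl with ⟨e, he, hl⟩ | hl <;> rcases hr with ⟨f, hf, hr⟩ | hr
  · obtain ⟨s, hs0, hs1, hs⟩ := exists_convex_param he hf
    have h := sqrt_one_add_sq_convex (a := f) (b := e) hs0 hs1
    rw [← hs] at h
    have e1 : p + c * q = (1 - s) * (p + f * q) + s * (p + e * q) := by rw [hs]; ring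
    rw [e1]
    have := mul_le_mul_of_nonneg_left h hμ.le
    have h1 := mul_le_mul_of_nonneg_left hr (sub_nonneg.2 hs1)
    have h2 := mul_le_mul_of_nonneg_left hl hs0
    linarith
  · have h := mul_le_mul_of_nonneg_left (sqrt_one_add_sq_sub_le c e) hμ.le
    rw [abs_of_nonneg (sub_nonneg.2 he)] at h
    have := mul_le_mul_of_nonneg_right hr (sub_nonneg.2 he)
    linarith
  · have h := mul_le_mul_of_nonneg_left (sqrt_one_add_sq_sub_le c f) hμ.le
    rw [abs_of_nonpos (sub_nonpos.2 hf)] at h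
    have := mul_le_mul_of_nonneg_right hl (sub_nonneg.2 hf)
    linarith
  · linarith

/-- At every breakpoint of the first envelope, the sum of the envelopes is at least
`μ * √(1 + x ^ 2)`. -/
def BreakpointBound (m m' : ℕ) (sl ic sl' ic' : ℕ → ℝ) (μ : ℝ) : Prop :=
  ∀ t, t + 1 < m → ∃ j < m', μ * √(1 + breakpoint sl ic t * breakpoint sl ic t) ≤
    lineAt sl ic t (breakpoint sl ic t) + lineAt sl' ic' j (breakpoint sl ic t)

/-- Let `i` and `j` be the pieces over `c`. On either side of `c`, the nearest breakpoint of the two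
envelopes is one at which both pieces are still maximal, so the bound there concerns the same affine
function. On a side without breakpoints both pieces are extreme and the slope hypothesis takes over.
`sqrt_le_affine` then transfers the bound to `c`. -/
theorem exists_lines_sqrt_le {m m' : ℕ} {sl ic sl' ic' : ℕ → ℝ} (h : IsEnvelope m sl ic)
    (h' : IsEnvelope m' sl' ic') {μ : ℝ} (hμ : 0 < μ)
    (hb : BreakpointBound m m' sl ic sl' ic' μ) (hb' : BreakpointBound m' m sl' ic' sl ic μ)
    (hl : sl 0 + sl' 0 ≤ -μ) (hr : μ ≤ sl (m - 1) + sl' (m' - 1)) (c : ℝ) :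
    ∃ i < m, ∃ j < m', μ * √(1 + c * c) ≤ lineAt sl ic i c + lineAt sl' ic' j c := by
  obtain ⟨i, hi, hi1, hi2⟩ := h.exists_piece c
  obtain ⟨j, hj, hj1, hj2⟩ := h'.exists_piece c
  refine ⟨i, hi, j, hj, ?_⟩
  have eL : ∀ x, lineAt sl ic i x + lineAt sl' ic' j x = (ic i + ic' j) + x * (sl i + sl' j) :=
    fun x => by simp only [lineAt]; ring
  -- Four cases, by side and by the envelope to which the nearest breakpoint belongs.
  have right1 : i + 1 < m → (j + 1 < m' → breakpoint sl ic i ≤ breakpoint sl' ic' j) →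
      ∃ e, c ≤ e ∧ μ * √(1 + e * e) ≤ (ic i + ic' j) + e * (sl i + sl' j) := by
    intro h1 h2
    obtain ⟨k, hk, hk'⟩ := hb i h1
    refine ⟨_, hi1 h1, hk'.trans ?_⟩
    rw [← eL]
    have := h'.le_of_piece hk hj h2 (fun r hr => (hj2 r hr).trans (hi1 h1))
    linarith
  have right2 : j + 1 < m' → (i + 1 < m → breakpoint sl' ic' j ≤ breakpoint sl ic i) →
      ∃ e, c ≤ e ∧ μ * √(1 + e * e) ≤ (ic i + ic' j) + e * (sl i + sl' j) := by
    intro h1 h2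
    obtain ⟨k, hk, hk'⟩ := hb' j h1
    refine ⟨_, hj1 h1, hk'.trans ?_⟩
    rw [← eL]
    have := h.le_of_piece hk hi h2 (fun r hr => (hi2 r hr).trans (hj1 h1))
    linarith
  have left1 : ∀ r, r + 1 = i →
      (∀ q, q + 1 = j → breakpoint sl' ic' q ≤ breakpoint sl ic r) →
      ∃ e ≤ c, μ * √(1 + e * e) ≤ (ic i + ic' j) + e * (sl i + sl' j) := by
    rintro r rfl h2
    obtain ⟨k, hk, hk'⟩ := hb r hi
    refine ⟨_, hi2 r rfl, hk'.trans ?_⟩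
    rw [← eL]
    have h3 := (h.le_succ_iff hi _).2 (le_refl (breakpoint sl ic r))
    have := h'.le_of_piece hk hj (fun hh => (hi2 r rfl).trans (hj1 hh)) h2
    linarith
  have left2 : ∀ r, r + 1 = j →
      (∀ q, q + 1 = i → breakpoint sl ic q ≤ breakpoint sl' ic' r) →
      ∃ e ≤ c, μ * √(1 + e * e) ≤ (ic i + ic' j) + e * (sl i + sl' j) := by
    rintro r rfl h2
    obtain ⟨k, hk, hk'⟩ := hb' r hj
    refine ⟨_, hj2 r rfl, hk'.trans ?_⟩
    rw [← eL]
    have h3 := (h'.le_succ_iff hj _).2 (le_refl (breakpoint sl' ic' r))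
    have := h.le_of_piece hk hi (fun hh => (hj2 r rfl).trans (hi1 hh)) h2
    linarith
  rw [eL]
  refine sqrt_le_affine hμ ?_ ?_
  · rcases Nat.eq_zero_or_eq_succ_pred i with h0 | h0 <;>
      rcases Nat.eq_zero_or_eq_succ_pred j with g0 | g0
    · right; rw [h0, g0]; exact hl
    · left; exact left2 _ g0.symm (fun q hq => by omega)
    · left; exact left1 _ h0.symm (fun q hq => by omega)
    · left
      rcases le_total (breakpoint sl ic i.pred) (breakpoint sl' ic' j.pred) with hle | hle
      · refine left2 _ g0.symm (fun q hq => ?_)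
        rw [show q = i.pred by omega]; exact hle
      · refine left1 _ h0.symm (fun q hq => ?_)
        rw [show q = j.pred by omega]; exact hle
  · by_cases h1 : i + 1 < m <;> by_cases h2 : j + 1 < m'
    · left
      rcases le_total (breakpoint sl ic i) (breakpoint sl' ic' j) with hle | hle
      · exact right1 h1 fun _ => hle
      · exact right2 h2 fun _ => hle
    · left; exact right1 h1 fun h => absurd h h2
    · left; exact right2 h2 fun h => absurd h h1
    · right
      rw [show i = m - 1 by omega, show j = m' - 1 by omega]
      exact hr

/-! ## Minimizing over the breakpoints -/

/-- The line `t` is maximal at `c`. -/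
def IsMaxLine (m : ℕ) (sl ic : ℕ → ℝ) (t : ℕ) (c : ℝ) : Prop :=
  t < m ∧ ∀ k < m, lineAt sl ic k c ≤ lineAt sl ic t c

/-- The squared sum of two lines at `c`, divided by `1 + c ^ 2`. -/
noncomputable def normSq (sl ic : ℕ → ℝ) (i : ℕ) (sl' ic' : ℕ → ℝ) (j : ℕ) (c : ℝ) : ℝ :=
  (lineAt sl ic i c + lineAt sl' ic' j c) * (lineAt sl ic i c + lineAt sl' ic' j c) / (1 + c * c)

/-- `G` is at most the squared sum of two envelopes, divided by `1 + c ^ 2`, at the first `n`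
breakpoints `c` of the first one. -/
def BelowBreakpoints (n m' : ℕ) (sl ic sl' ic' : ℕ → ℝ) (G : ℝ) : Prop :=
  ∀ t < n, ∃ j, IsMaxLine m' sl' ic' j (breakpoint sl ic t) ∧
    G ≤ normSq sl ic t sl' ic' j (breakpoint sl ic t)

theorem isMaxLine_breakpoint {m : ℕ} {sl ic : ℕ → ℝ} (h : IsEnvelope m sl ic) {t : ℕ}
    (ht : t + 1 < m) : IsMaxLine m sl ic t (breakpoint sl ic t) := by
  refine ⟨by omega, fun k hk => h.le_of_piece hk (by omega) (fun _ => le_rfl) ?_⟩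
  rintro r rfl
  exact h.brk r ht

/-- The piece of the second envelope found so far is the best among its predecessors. -/
def PrefixTop (m m' : ℕ) (sl ic sl' ic' : ℕ → ℝ) (t j : ℕ) : Prop :=
  j < m' ∧ (t + 1 < m → ∀ k ≤ j, lineAt sl' ic' k (breakpoint sl ic t) ≤
    lineAt sl' ic' j (breakpoint sl ic t))

section

variable {m m' : ℕ} {sl ic sl' ic' : ℕ → ℝ}

theorem PrefixTop.next_piece {t j : ℕ} (h : PrefixTop m m' sl ic sl' ic' t j) (ht : t + 1 < m)
    (hj : j + 1 < m') (hlt : lineAt sl' ic' j (breakpoint sl ic t) <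
      lineAt sl' ic' (j + 1) (breakpoint sl ic t)) :
    PrefixTop m m' sl ic sl' ic' t (j + 1) := by
  refine ⟨hj, fun _ k hk => ?_⟩
  rcases Nat.le_succ_iff.1 hk with hk | rfl
  · exact (h.2 ht k hk).trans hlt.le
  · exact le_rfl

theorem PrefixTop.isMaxLine {t j : ℕ} (h : PrefixTop m m' sl ic sl' ic' t j) (ht : t + 1 < m)
    (h' : IsEnvelope m' sl' ic') (hlast : j + 1 < m' →
      lineAt sl' ic' (j + 1) (breakpoint sl ic t) ≤ lineAt sl' ic' j (breakpoint sl ic t)) :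
    IsMaxLine m' sl' ic' j (breakpoint sl ic t) := by
  refine ⟨h.1, fun k hk => ?_⟩
  rcases le_total k j with hkj | hkj
  · exact h.2 ht k hkj
  · exact h'.le_of_le_brk hkj hk fun hj => (h'.succ_le_iff hj _).1 (hlast hj)

/-- Earlier pieces have smaller slopes, so the lead of piece `j` over them can only grow as the
breakpoint moves right. Hence the pointer never has to move back. -/
theorem PrefixTop.next_brk {t j : ℕ} (h : PrefixTop m m' sl ic sl' ic' t j)
    (hE : IsEnvelope m sl ic) (h' : IsEnvelope m' sl' ic') :
    PrefixTop m m' sl ic sl' ic' (t + 1) j := by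
  refine ⟨h.1, fun ht k hk => ?_⟩
  have h1 := h.2 (by omega) k hk
  have h2 := h'.slope_mono hk h.1
  have h3 := hE.brk t ht
  simp only [lineAt] at *
  nlinarith [mul_nonneg (sub_nonneg.2 h2) (sub_nonneg.2 h3)]

theorem BelowBreakpoints.mono {n : ℕ} {G G' : ℝ}
    (h : BelowBreakpoints n m' sl ic sl' ic' G) (hG : G' ≤ G) :
    BelowBreakpoints n m' sl ic sl' ic' G' := fun t ht => by
  obtain ⟨j, hj, hle⟩ := h t ht
  exact ⟨j, hj, hG.trans hle⟩

theorem BelowBreakpoints.succ {n j : ℕ} {G : ℝ} (h : BelowBreakpoints n m' sl ic sl' ic' G)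
    (hj : IsMaxLine m' sl' ic' j (breakpoint sl ic n))
    (hG : G ≤ normSq sl ic n sl' ic' j (breakpoint sl ic n)) :
    BelowBreakpoints (n + 1) m' sl ic sl' ic' G := fun t ht => by
  rcases Nat.lt_succ_iff_lt_or_eq.1 ht with ht | rfl
  · exact h t ht
  · exact ⟨j, hj, hG⟩

end

/-! ## Computing an envelope with a stack -/

/-- The arrays `X`, `Y` are sorted lexicographically on `[lo, n)`. -/
def LexSorted (lo n : ℕ) (X Y : ℕ → ℝ) : Prop :=
  ∀ x y, lo ≤ x → x ≤ y → y < n → X x < X y ∨ X x = X y ∧ Y x ≤ Y y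

theorem LexSorted.le {lo n : ℕ} {X Y : ℕ → ℝ} (h : LexSorted lo n X Y) {x y : ℕ} (hx : lo ≤ x)
    (hxy : x ≤ y) (hy : y < n) : X x ≤ X y := by
  rcases h x y hx hxy hy with h | h
  · exact h.le
  · exact h.1.le

/-- The stack `st` of height `m` after the lines `[lo, i)` have been processed. -/
structure StackInv (lo n : ℕ) (X Y : ℕ → ℝ) (st : ℕ → ℕ) (m i : ℕ) : Prop where
  lo_le : lo ≤ i
  le_n : i ≤ n
  height : m ≤ i
  mem : ∀ t < m, lo ≤ st t ∧ st t < i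
  slope : ∀ t, t + 1 < m → X (st t) < X (st (t + 1))
  brk : ∀ t, t + 2 < m →
    breakpoint (X ∘ st) (Y ∘ st) t ≤ breakpoint (X ∘ st) (Y ∘ st) (t + 1)
  dom : ∀ j, lo ≤ j → j < i → ∀ c, (∃ t < m, lineAt X Y j c ≤ lineAt X Y (st t) c) ∨
    (i < n ∧ lineAt X Y j c ≤ lineAt X Y i c)
  bot_zero : m = 0 → i < n → X i = X lo
  bot_pos : 0 < m → X (st 0) = X lo
  top : i = n → 0 < m ∧ st (m - 1) = n - 1

theorem stackInv_init {lo n : ℕ} (h : lo < n) (X Y : ℕ → ℝ) (st : ℕ → ℕ) :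
    StackInv lo n X Y st 0 lo where
  lo_le := le_rfl
  le_n := h.le
  height := Nat.zero_le lo
  mem := fun t ht => absurd ht (Nat.not_lt_zero t)
  slope := fun t ht => absurd ht (Nat.not_lt_zero _)
  brk := fun t ht => absurd ht (Nat.not_lt_zero _)
  dom := fun j h1 h2 => by omega
  bot_zero := fun _ _ => rfl
  bot_pos := fun h => absurd h (lt_irrefl 0)
  top := fun h' => by omega

namespace StackInv

variable {lo n m i : ℕ} {X Y : ℕ → ℝ} {st : ℕ → ℕ}

/-- In the field `dom` the line `i`, which is not yet on the stack, already counts as a dominating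
line. So the top may be dropped once, at each `c` separately, a lower stack line or line `i` is at
least as high. -/
theorem pop (h : StackInv lo n X Y st (m + 1) i) (hi : i < n)
    (hpop : ∀ c, (∃ t < m, lineAt X Y (st m) c ≤ lineAt X Y (st t) c) ∨
      lineAt X Y (st m) c ≤ lineAt X Y i c)
    (h0 : m = 0 → X (st 0) = X i) : StackInv lo n X Y st m i where
  lo_le := h.lo_le
  le_n := h.le_n
  height := by have := h.height; omega
  mem := fun t ht => h.mem t (by omega)
  slope := fun t ht => h.slope t (by omega)
  brk := fun t ht => h.brk t (by omega)
  dom := fun j h1 h2 c => by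
    rcases h.dom j h1 h2 c with ⟨t, ht, hle⟩ | hle
    · rcases Nat.lt_succ_iff_lt_or_eq.1 ht with ht | rfl
      · exact Or.inl ⟨t, ht, hle⟩
      · rcases hpop c with ⟨s, hs, hle'⟩ | hle'
        · exact Or.inl ⟨s, hs, hle.trans hle'⟩
        · exact Or.inr ⟨hi, hle.trans hle'⟩
    · exact Or.inr hle
  bot_zero := fun hm _ => by rw [← h0 hm, h.bot_pos (by omega)]
  bot_pos := fun _ => h.bot_pos (by omega)
  top := fun h' => by omega

theorem pop_one (hs : LexSorted lo n X Y) (h : StackInv lo n X Y st 1 i) (hi : i < n)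
    (hx : ¬ X (st 0) < X i) : StackInv lo n X Y st 0 i := by
  obtain ⟨h1, h2⟩ := h.mem 0 (by omega)
  -- Equal slopes, so the lexicographic order makes the new intercept at least the old one.
  have h3 := (hs _ _ h1 h2.le hi).resolve_left hx
  refine h.pop hi (fun c => Or.inr ?_) (fun _ => h3.1)
  simp only [lineAt, h3.1]
  linarith [h3.2]

/-- In the dual plane, the top is a point on or below the chord from its predecessor to the new
point. Its line is therefore at most a convex combination of the two other lines, hence nowhere
above both. -/
theorem pop_two (hs : LexSorted lo n X Y) (h : StackInv lo n X Y st (m + 2) i) (hi : i < n)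
    (hx : ¬ (Y i - Y (st m)) * (X (st (m + 1)) - X (st m)) <
      (Y (st (m + 1)) - Y (st m)) * (X i - X (st m))) : StackInv lo n X Y st (m + 1) i := by
  obtain ⟨h1, h2⟩ := h.mem (m + 1) (by omega)
  have h3 := hs.le h1 h2.le hi
  have h4 := h.slope m (by omega)
  refine h.pop hi (fun c => ?_) (fun h => by omega)
  by_contra! hcon
  obtain ⟨c1, c2⟩ := hcon
  have c1 := c1 m (by omega)
  simp only [lineAt] at c1 c2
  nlinarith [mul_nonneg (sub_nonneg.2 h3) (sub_nonneg.2 c1.le),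
    mul_pos (sub_pos.2 h4) (sub_pos.2 c2)]

theorem push (h : StackInv lo n X Y st m i) (hi : i < n)
    (h1 : ∀ t, t + 1 = m → X (st t) < X i)
    (h2 : ∀ t, t + 2 = m → (Y (st t) - Y (st (t + 1))) / (X (st (t + 1)) - X (st t)) ≤
      (Y (st (t + 1)) - Y i) / (X i - X (st (t + 1)))) :
    StackInv lo n X Y (Function.update st m i) (m + 1) (i + 1) := by
  have upd : ∀ t, t < m → Function.update st m i t = st t := fun t ht =>
    Function.update_of_ne (by omega) _ _
  have upm : Function.update st m i m = i := Function.update_self _ _ _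
  refine ⟨by have := h.lo_le; omega, by omega, by have := h.height; omega, fun t ht => ?_, fun t ht => ?_, fun t ht => ?_,
    fun j hj1 hj2 c => ?_, fun h => by omega, fun _ => ?_, fun hin => ⟨by omega, ?_⟩⟩
  · rcases Nat.lt_succ_iff_lt_or_eq.1 ht with ht | rfl
    · rw [upd t ht]
      have := h.mem t ht
      omega
    · rw [upm]
      have := h.lo_le
      omega
  · rw [upd t (by omega)]
    rcases Nat.lt_succ_iff_lt_or_eq.1 ht with ht | ht
    · rw [upd _ ht]; exact h.slope t ht
    · rw [ht, upm]; exact h1 t ht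
  · simp only [breakpoint, Function.comp_apply]
    rw [upd t (by omega), upd (t + 1) (by omega)]
    rcases Nat.lt_succ_iff_lt_or_eq.1 ht with ht | ht
    · rw [upd _ ht]; exact h.brk t ht
    · rw [show t + 1 + 1 = m from ht, upm]; exact h2 t ht
  · left
    have key : ∀ k, lineAt X Y j c ≤ lineAt X Y k c → k = i → ∃ t < m + 1,
        lineAt X Y j c ≤ lineAt X Y (Function.update st m i t) c := by
      rintro k hk rfl
      exact ⟨m, by omega, by rwa [upm]⟩
    rcases Nat.lt_succ_iff_lt_or_eq.1 hj2 with hj | rfl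
    · rcases h.dom j hj1 hj c with ⟨t, ht, hle⟩ | ⟨_, hle⟩
      · exact ⟨t, by omega, by rwa [upd t ht]⟩
      · exact key i hle rfl
    · exact key j le_rfl rfl
  · rcases Nat.eq_zero_or_pos m with rfl | hm
    · rw [upm]; exact h.bot_zero rfl hi
    · rw [upd 0 hm]; exact h.bot_pos hm
  · rw [Nat.add_sub_cancel, upm]; omega

theorem push_zero (h : StackInv lo n X Y st 0 i) (hi : i < n) :
    StackInv lo n X Y (Function.update st 0 i) 1 (i + 1) :=
  h.push hi (fun t ht => by omega) (fun t ht => by omega)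

theorem push_one (h : StackInv lo n X Y st 1 i) (hi : i < n) (hx : X (st 0) < X i) :
    StackInv lo n X Y (Function.update st 1 i) 2 (i + 1) :=
  h.push hi (fun t ht => by rwa [show t = 0 by omega]) (fun t ht => by omega)

/-- The strict test is the order of the last two breakpoints with denominators cleared. It also
excludes that the new line has the slope of the top, since then the lexicographic order would make
the test fail. -/
theorem push_two (hs : LexSorted lo n X Y) (h : StackInv lo n X Y st (m + 2) i) (hi : i < n)
    (hx : (Y i - Y (st m)) * (X (st (m + 1)) - X (st m)) <
      (Y (st (m + 1)) - Y (st m)) * (X i - X (st m))) :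
    StackInv lo n X Y (Function.update st (m + 2) i) (m + 3) (i + 1) := by
  obtain ⟨h1, h2⟩ := h.mem (m + 1) (by omega)
  have h4 := h.slope m (by omega)
  have h3 : X (st (m + 1)) < X i := by
    rcases hs _ _ h1 h2.le hi with h3 | ⟨h3, h5⟩
    · exact h3
    · rw [← h3] at hx
      nlinarith [mul_nonneg (sub_nonneg.2 h5) (sub_pos.2 h4).le]
  refine h.push hi (fun t ht => by rwa [show t = m + 1 by omega]) (fun t ht => ?_)
  obtain rfl : t = m := by omega
  rw [div_le_div_iff₀ (sub_pos.2 h4) (sub_pos.2 h3)]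
  linarith

theorem isEnvelope (h : StackInv lo n X Y st m n) : IsEnvelope m (X ∘ st) (Y ∘ st) :=
  ⟨(h.top rfl).1, h.slope, h.brk⟩

theorem exists_le (h : StackInv lo n X Y st m n) {j : ℕ} (h1 : lo ≤ j) (h2 : j < n) (c : ℝ) :
    ∃ t < m, lineAt X Y j c ≤ lineAt X Y (st t) c :=
  (h.dom j h1 h2 c).resolve_right fun h => lt_irrefl n h.1

end StackInv

namespace RealRAM

/-! ## The program for upper envelopes

Natural-number variables: `0` number of lines, `1` the next line, `2` the height of the stack. -/

/-- Put the next line on the stack. -/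
def hullPush (st : ℕ) : Cmd :=
  .seq (.natStore st (.var 2) (.var 1)) <|
  .seq (.natAssign 2 (.add (.var 2) (.const 1))) <|
  .natAssign 1 (.add (.var 1) (.const 1))

/-- Remove the top of the stack. -/
def hullPop : Cmd := .natAssign 2 (.sub (.var 2) (.const 1))

/-- The next line makes the top of the stack redundant, in the case of at least two lines on the
stack, unless this test succeeds. -/
def hullTest (ax ay st : ℕ) : Test :=
  .realLt
    (.mul (.sub (.get ay (.var 1)) (.get ay (.get st (.sub (.var 2) (.const 2)))))
      (.sub (.get ax (.get st (.sub (.var 2) (.const 1))))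
        (.get ax (.get st (.sub (.var 2) (.const 2))))))
    (.mul (.sub (.get ay (.get st (.sub (.var 2) (.const 1))))
        (.get ay (.get st (.sub (.var 2) (.const 2)))))
      (.sub (.get ax (.var 1)) (.get ax (.get st (.sub (.var 2) (.const 2))))))

/-- The upper envelope of the lines with slopes in the array `ax` and intercepts in `ay`, starting
with the line whose index is in variable `1`. The indices of its pieces are put on the stack. -/
def hull (ax ay st : ℕ) : Cmd :=
  .seq (.natAssign 2 (.const 0)) <|
  .loop (.natLt (.var 1) (.var 0)) <|
    .ite (.natLt (.const 1) (.var 2))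
      (.ite (hullTest ax ay st) (hullPush st) hullPop)
      (.ite (.and (.natLt (.const 0) (.var 2))
          (.not (.realLt (.get ax (.get st (.const 0))) (.get ax (.var 1)))))
        hullPop (hullPush st))

theorem hull_spec (ax ay st : ℕ) {lo : ℕ} {s : State} (h1 : s.natVar 1 = lo)
    (hlo : lo < s.natVar 0) (hs : LexSorted lo (s.natVar 0) (s.realArr ax) (s.realArr ay)) :
    WP (hull ax ay st) (fun t T => StackInv lo (s.natVar 0) (s.realArr ax) (s.realArr ay)
      (t.natArr st) (t.natVar 2) (s.natVar 0) ∧ T ≤ 200 * s.natVar 0) s := by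
  generalize hn : s.natVar 0 = n at *
  generalize hX : s.realArr ax = X at *
  generalize hY : s.realArr ay = Y at *
  rw [hull, wp_seq, wp_natAssign]
  refine (wp_loop (fun r => r.natVar 0 = n ∧ r.realArr ax = X ∧ r.realArr ay = Y ∧
      StackInv lo n X Y (r.natArr st) (r.natVar 2) (r.natVar 1))
    -- Amortization: a push uses up one line, worth two units, and raises the height by one; a pop
    -- lowers the height by one. The potential falls by one unit in either case.
    (fun r => 60 * (2 * (n - r.natVar 1) + r.natVar 2)) ?_ ?_).mono ?_
  · rintro r ⟨rn, rX, rY, hI⟩ hb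
    simp only [Test.Holds, NExp.val, rn] at hb
    generalize hi : r.natVar 1 = i at *
    generalize hm : r.natVar 2 = m at *
    rcases m with _ | _ | m
    · simp [hullPush, hullPop, hm, hi, rn, rX, rY]
      exact ⟨hI.push_zero hb, by omega⟩
    · simp [hullPush, hullPop, hm, hi, rn, rX, rY]
      refine ⟨fun hx => ⟨hI.pop_one hs hb (not_lt.2 hx), by omega⟩,
        fun hx => ⟨hI.push_one hb hx, by omega⟩⟩
    · simp [hullPush, hullPop, hullTest, hm, hi, rn, rX, rY]
      refine ⟨fun hx => ⟨hI.push_two hs hb hx, by omega⟩,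
        fun hx => ⟨hI.pop_two hs hb (not_lt.2 hx), by omega⟩⟩
  · simp [hn, hX, hY, h1]
    exact stackInv_init hlo X Y _
  · rintro t T ⟨⟨tn, tX, tY, hI⟩, hb, hT⟩
    simp [tn] at hb
    have := hI.le_n
    rw [show t.natVar 1 = n by omega] at hI
    simp at hT ⊢
    exact ⟨hI, by omega⟩

/-! ## Scanning the breakpoints of an envelope

Natural-number variables: `3` the current breakpoint, `4` the piece of the second envelope.
Real variables: `10` the least value found, `11` where it was found. -/

/-- Evaluate the sum of the two envelopes at the current breakpoint. -/
def walkEval (ax ay st : ℕ) : Cmd :=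
  .seq (.realAssign 14 (.add (.add (.get ay (.get st (.var 3)))
    (.mul (.var 12) (.get ax (.get st (.var 3))))) (.var 13))) <|
  .seq (.realAssign 15 (.div (.mul (.var 14) (.var 14))
    (.add (.const 1) (.mul (.var 12) (.var 12))))) <|
  .seq (.ite (.realLt (.var 15) (.var 10))
    (.seq (.realAssign 10 (.var 15)) (.realAssign 11 (.var 12))) .skip) <|
  .natAssign 3 (.add (.var 3) (.const 1))

/-- Minimize the squared sum of two envelopes, divided by `1 + c ^ 2`, over the breakpoints `c` of
the first one. -/
def walk (ax ay st mv ax' ay' st' mv' : ℕ) : Cmd :=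
  .seq (.natAssign 3 (.const 0)) <|
  .seq (.natAssign 4 (.const 0)) <|
  .loop (.natLt (.add (.var 3) (.const 1)) (.var mv)) <|
    .seq (.realAssign 12 (.div
      (.sub (.get ay (.get st (.var 3))) (.get ay (.get st (.add (.var 3) (.const 1)))))
      (.sub (.get ax (.get st (.add (.var 3) (.const 1)))) (.get ax (.get st (.var 3)))))) <|
    .seq (.realAssign 13 (.add (.get ay' (.get st' (.var 4)))
      (.mul (.var 12) (.get ax' (.get st' (.var 4)))))) <|
    .ite (.and (.natLt (.add (.var 4) (.const 1)) (.var mv'))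
        (.realLt (.var 13) (.add (.get ay' (.get st' (.add (.var 4) (.const 1))))
          (.mul (.var 12) (.get ax' (.get st' (.add (.var 4) (.const 1))))))))
      (.natAssign 4 (.add (.var 4) (.const 1)))
      (walkEval ax ay st)

/-- The relation `P` between the recorded value and its direction is left open, because two walks
share the same record: what the first one establishes is the starting point of the second. -/
theorem walk_spec (ax ay st mv ax' ay' st' mv' : ℕ) (hv3 : mv ≠ 3) (hv4 : mv ≠ 4)
    (hv3' : mv' ≠ 3) (hv4' : mv' ≠ 4) {s : State} {m m' : ℕ} {sl ic sl' ic' : ℕ → ℝ}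
    (hm : s.natVar mv = m) (hm' : s.natVar mv' = m')
    (hsl : s.realArr ax ∘ s.natArr st = sl) (hic : s.realArr ay ∘ s.natArr st = ic)
    (hsl' : s.realArr ax' ∘ s.natArr st' = sl') (hic' : s.realArr ay' ∘ s.natArr st' = ic')
    (h : IsEnvelope m sl ic) (h' : IsEnvelope m' sl' ic') (P : ℝ → ℝ → Prop)
    (hP : ∀ i j c, IsMaxLine m sl ic i c → IsMaxLine m' sl' ic' j c →
      P (normSq sl ic i sl' ic' j c) c)
    (h0 : P (s.realVar 10) (s.realVar 11)) :
    WP (walk ax ay st mv ax' ay' st' mv') (fun t T => P (t.realVar 10) (t.realVar 11) ∧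
      t.realVar 10 ≤ s.realVar 10 ∧ BelowBreakpoints (m - 1) m' sl ic sl' ic' (t.realVar 10) ∧
      T ≤ 100 * (m + m') + 100) s := by
  rw [walk, wp_seq, wp_natAssign, wp_seq, wp_natAssign]
  refine (wp_loop (fun r => r.natVar mv = m ∧ r.natVar mv' = m' ∧
      r.realArr ax ∘ r.natArr st = sl ∧ r.realArr ay ∘ r.natArr st = ic ∧
      r.realArr ax' ∘ r.natArr st' = sl' ∧ r.realArr ay' ∘ r.natArr st' = ic' ∧
      P (r.realVar 10) (r.realVar 11) ∧ r.realVar 10 ≤ s.realVar 10 ∧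
      r.natVar 3 < m ∧
      BelowBreakpoints (r.natVar 3) m' sl ic sl' ic' (r.realVar 10) ∧
      PrefixTop m m' sl ic sl' ic' (r.natVar 3) (r.natVar 4))
    -- Every iteration advances the breakpoint or the pointer, and neither ever moves back.
    (fun r => 90 * ((m - r.natVar 3) + (m' - r.natVar 4))) ?_ ?_).mono ?_
  · rintro r ⟨rm, rm', rX, rY, rX', rY', rP, rle, rt, rB, rT⟩ hb
    simp only [Test.Holds, NExp.val, rm] at hb
    have eX : ∀ k, r.realArr ax (r.natArr st k) = sl k := fun k => congrFun rX k
    have eY : ∀ k, r.realArr ay (r.natArr st k) = ic k := fun k => congrFun rY k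
    have eX' : ∀ k, r.realArr ax' (r.natArr st' k) = sl' k := fun k => congrFun rX' k
    have eY' : ∀ k, r.realArr ay' (r.natArr st' k) = ic' k := fun k => congrFun rY' k
    simp [walkEval, hv3, hv4, hv3', hv4', rm, rm', rX, rY, rX', rY', eX, eY, eX', eY', rP]
    generalize r.natVar 3 = t at *
    generalize r.natVar 4 = j at *
    rw [← breakpoint]
    set e := breakpoint sl ic t with he
    simp only [← lineAt.eq_1]
    refine ⟨fun h1 h2 => ?_, fun hlast => ?_⟩
    · exact ⟨⟨rle, rt, rB, rT.next_piece hb h1 h2⟩, by omega⟩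
    · have hj : IsMaxLine m' sl' ic' j e := rT.isMaxLine hb h' fun hj => hlast hj
      have hi : IsMaxLine m sl ic t e := isMaxLine_breakpoint h hb
      have hN := rT.next_brk h h'
      rw [← normSq]
      refine ⟨fun hlt => ⟨⟨hP t j e hi hj, hlt.le.trans rle, hb, ?_, hN⟩, by omega⟩,
        fun hle => ⟨⟨rle, hb, rB.succ hj hle, hN⟩, by omega⟩⟩
      exact (rB.mono hlt.le).succ hj le_rfl
  · simp [hv3, hv4, hv3', hv4', hm, hm', hsl, hic, hsl', hic', h0]
    refine ⟨h.pos, fun t ht => absurd ht (Nat.not_lt_zero t), h'.pos, fun _ k hk => ?_⟩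
    rw [Nat.le_zero.1 hk]
  · rintro t T ⟨⟨tm, tm', -, -, -, -, tP, tle, tt, tB, tT⟩, hb, hT⟩
    simp only [Test.Holds, NExp.val, tm] at hb
    simp at hT ⊢
    have := h.pos
    rw [show t.natVar 3 = m - 1 by omega] at tB
    exact ⟨tP, tle, tB, by omega⟩

end RealRAM

/-! ## Splitting a sorted sequence of points -/

/-- In the direction with parameter `c`, the points from index `k` on and all points lie in a strip
whose width is at most `√m`, up to the factor `1 + ε / 3`. -/
def GoodSplit (n : ℕ) (A B : ℕ → ℝ) (ε : ℝ) (k : ℕ) (m c : ℝ) : Prop :=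
  ∀ i j, k ≤ i → i < n → j < n →
    lineAt A B i c - lineAt A B j c ≤ (1 + ε / 3) * √(m * (1 + c * c))

/-- The squared width of a strip that is bounded by all points and by the points from index `k` on
is at least `m`, in every direction. -/
def SplitBound (n : ℕ) (A B : ℕ → ℝ) (k : ℕ) (m : ℝ) : Prop :=
  ∀ c, ∃ i j, k ≤ i ∧ i < n ∧ j < n ∧ √(m * (1 + c * c)) ≤ lineAt A B i c - lineAt A B j c

/-- The arrays `X`, `Y` are the arrays `A`, `B` negated and reversed. -/
def NegRev (n : ℕ) (A B X Y : ℕ → ℝ) : Prop :=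
  ∀ i < n, X i = -A (n - 1 - i) ∧ Y i = -B (n - 1 - i)

section

variable {n : ℕ} {A B X Y : ℕ → ℝ} {ε : ℝ} {k : ℕ} {m c : ℝ}

theorem SplitBound.mono (h : SplitBound n A B k m) {m' : ℝ} (hm : m' ≤ m) :
    SplitBound n A B k m' := fun c => by
  obtain ⟨i, j, h1, h2, h3, h4⟩ := h c
  exact ⟨i, j, h1, h2, h3, (Real.sqrt_le_sqrt
    (mul_le_mul_of_nonneg_right hm (one_add_mul_self_pos c).le)).trans h4⟩

theorem NegRev.lexSorted (h : NegRev n A B X Y) (hs : LexSorted 0 n A B) :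
    LexSorted 0 n X Y := fun x y _ hxy hy => by
  rw [(h x (by omega)).1, (h x (by omega)).2, (h y hy).1, (h y hy).2]
  rcases hs (n - 1 - y) (n - 1 - x) (Nat.zero_le _) (by omega) (by omega) with h | ⟨h1, h2⟩
  · exact Or.inl (neg_lt_neg h)
  · exact Or.inr ⟨by rw [h1], neg_le_neg h2⟩

theorem NegRev.lineAt_eq (h : NegRev n A B X Y) {i : ℕ} (hi : i < n) (c : ℝ) :
    lineAt X Y i c = -lineAt A B (n - 1 - i) c := by
  rw [lineAt, lineAt, (h i hi).1, (h i hi).2]; ring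

theorem NegRev.lineAt_rev (h : NegRev n A B X Y) {i : ℕ} (hi : i < n) (c : ℝ) :
    lineAt X Y (n - 1 - i) c = -lineAt A B i c := by
  rw [h.lineAt_eq (by omega), show n - 1 - (n - 1 - i) = i by omega]

theorem normSq_comm (sl ic : ℕ → ℝ) (i : ℕ) (sl' ic' : ℕ → ℝ) (j : ℕ) (c : ℝ) :
    normSq sl ic i sl' ic' j c = normSq sl' ic' j sl ic i c := by
  rw [normSq, normSq, add_comm]

/-- With `c = -N` a difference of lines is `B i - B j + N * (A j - A i) ≤ S + N * M`. The choice of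
`N` makes `S = (ε / 3) * (N * M)`, and `N * M ≤ √(m * (1 + c * c))` because `N = |c|` and `M * M ≤
m`. -/
theorem goodSplit_limit (hε : 0 < ε) {S M : ℝ} (hM : 0 < M) (hw : A (n - 1) - A k ≤ M)
    (hs : LexSorted 0 n A B) (hS : ∀ i < n, ∀ j < n, B i - B j ≤ S) (hm : M * M ≤ m) (hc : c = 0 - 3 * S / (ε * M)) : GoodSplit n A B ε k m c := by
  intro i j hi hin hj
  have hS0 : 0 ≤ S := by have := hS i hin i hin; linarith
  set N := 3 * S / (ε * M) with hN
  have hN0 : 0 ≤ N := by positivity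
  have hNS : N * (ε * M) = 3 * S := div_mul_cancel₀ _ (by positivity)
  have h1 : A k ≤ A i := hs.le (Nat.zero_le _) hi hin
  have h2 : A j ≤ A (n - 1) := hs.le (Nat.zero_le _) (by omega) (by omega)
  have h3 := hS i hin j hj
  have h4 : M * N ≤ √(m * (1 + c * c)) := by
    refine Real.le_sqrt_of_sq_le ?_
    have : M * M * (1 + c * c) ≤ m * (1 + c * c) :=
      mul_le_mul_of_nonneg_right hm (one_add_mul_self_pos c).le
    rw [show c = -N by rw [hc]; ring] at *
    nlinarith [mul_self_nonneg M]
  have h5 : lineAt A B i c - lineAt A B j c = B i - B j + N * (A j - A i) := by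
    rw [lineAt, lineAt, hc]; ring
  have h6 : N * (A j - A i) ≤ N * M := mul_le_mul_of_nonneg_left (by linarith) hN0
  have h7 := mul_le_mul_of_nonneg_left h4 (show 0 ≤ 1 + ε / 3 by positivity)
  rw [h5]
  linarith

/-- At a breakpoint the strip width is computed exactly, so the factor `1 + ε / 3` is mere slack,
kept to match the limit direction. -/
theorem goodSplit_of_isMaxLine {lo : ℕ} {st st' : ℕ → ℕ} {m m' : ℕ} (hε : 0 < ε)
    (hR : NegRev n A B X Y) (h : StackInv lo n A B st m n) (h' : StackInv 0 n X Y st' m' n)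
    {i j : ℕ} {w : ℝ} (hi : IsMaxLine m (A ∘ st) (B ∘ st) i c)
    (hj : IsMaxLine m' (X ∘ st') (Y ∘ st') j c) :
    GoodSplit n A B ε lo (max w (normSq (A ∘ st) (B ∘ st) i (X ∘ st') (Y ∘ st') j c)) c := by
  intro p q hp hpn hq
  obtain ⟨a, ha, ha'⟩ := h.exists_le hp hpn c
  obtain ⟨b, hb, hb'⟩ := h'.exists_le (Nat.zero_le (n - 1 - q)) (by omega) c
  rw [hR.lineAt_rev hq] at hb'
  have h1 := ha'.trans (hi.2 a ha)
  have h2 := hb'.trans (hj.2 b hb)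
  set z := lineAt (A ∘ st) (B ∘ st) i c + lineAt (X ∘ st') (Y ∘ st') j c with hz
  have hpos := one_add_mul_self_pos c
  have h3 : z ≤ √(max w (normSq (A ∘ st) (B ∘ st) i (X ∘ st') (Y ∘ st') j c) * (1 + c * c)) := by
    refine (Real.le_sqrt_of_sq_le (le_of_eq ?_)).trans
      (Real.sqrt_le_sqrt (mul_le_mul_of_nonneg_right (le_max_right _ _) hpos.le))
    rw [normSq, ← hz, div_mul_cancel₀ _ hpos.ne']; ring
  have h4 := Real.sqrt_nonneg
    (max w (normSq (A ∘ st) (B ∘ st) i (X ∘ st') (Y ∘ st') j c) * (1 + c * c))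
  nlinarith

/-- This is `exists_lines_sqrt_le` for `μ = √G`: finitely many comparisons at breakpoints, and one
for the limits, bound the width in every direction. The pieces found are then turned back into two
points. -/
theorem splitBound_of_below {lo : ℕ} {st st' : ℕ → ℕ} {m m' : ℕ} {G : ℝ}
    (hs : LexSorted 0 n A B) (hlo : lo < n) (hR : NegRev n A B X Y)
    (h : StackInv lo n A B st m n) (h' : StackInv 0 n X Y st' m' n)
    (hG : G ≤ (A (n - 1) - A lo) * (A (n - 1) - A lo))
    (h1 : BelowBreakpoints (m - 1) m' (A ∘ st) (B ∘ st) (X ∘ st') (Y ∘ st') G)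
    (h2 : BelowBreakpoints (m' - 1) m (X ∘ st') (Y ∘ st') (A ∘ st) (B ∘ st) G) :
    SplitBound n A B lo G := by
  intro c
  -- For `G ≤ 0` the real square root is zero by convention, and any point serves as both `i` and
  -- `j`.
  rcases le_or_gt G 0 with hG0 | hG0
  · refine ⟨lo, lo, le_rfl, hlo, hlo, ?_⟩
    rw [Real.sqrt_eq_zero_of_nonpos
      (mul_nonpos_of_nonpos_of_nonneg hG0 (one_add_mul_self_pos c).le), sub_self]
  have nonneg : ∀ i j c, IsMaxLine m (A ∘ st) (B ∘ st) i c → IsMaxLine m' (X ∘ st') (Y ∘ st') j c →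
      0 ≤ lineAt (A ∘ st) (B ∘ st) i c + lineAt (X ∘ st') (Y ∘ st') j c := by
    intro i j c hi hj
    obtain ⟨a, ha, ha'⟩ := h.exists_le le_rfl hlo c
    obtain ⟨b, hb, hb'⟩ := h'.exists_le (Nat.zero_le (n - 1 - lo)) (by omega) c
    rw [hR.lineAt_rev hlo] at hb'
    have h1 := ha'.trans (hi.2 a ha)
    have h2 := hb'.trans (hj.2 b hb)
    linarith
  have conv : ∀ z c : ℝ, 0 ≤ z → G ≤ z * z / (1 + c * c) → √G * √(1 + c * c) ≤ z := by
    intro z c hz hle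
    rw [le_div_iff₀ (one_add_mul_self_pos c)] at hle
    rw [← Real.sqrt_mul hG0.le, Real.sqrt_le_left hz, pow_two]
    exact hle
  have hd : 0 ≤ A (n - 1) - A lo :=
    sub_nonneg.2 (hs.le (Nat.zero_le _) (by omega) (by omega))
  have hGd : √G ≤ A (n - 1) - A lo := by
    rw [Real.sqrt_le_left hd, pow_two]; exact hG
  have hd' : A 0 ≤ A lo := hs.le le_rfl (by omega) hlo
  obtain ⟨i, hi, j, hj, hij⟩ := exists_lines_sqrt_le h.isEnvelope h'.isEnvelope
    (Real.sqrt_pos.2 hG0) (fun t ht => by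
      obtain ⟨j, hj, hle⟩ := h1 t (by omega)
      exact ⟨j, hj.1, conv _ _ (nonneg _ _ _ (isMaxLine_breakpoint h.isEnvelope ht) hj) hle⟩)
    (fun t ht => by
      obtain ⟨j, hj, hle⟩ := h2 t (by omega)
      refine ⟨j, hj.1, conv _ _ ?_ hle⟩
      rw [add_comm]
      exact nonneg _ _ _ hj (isMaxLine_breakpoint h'.isEnvelope ht))
    (by
      simp only [Function.comp_apply]
      -- The smallest slopes add up to `A lo - A (n - 1)`, so the limit at `-∞` is exactly what `hG`
      -- controls.
      rw [h.bot_pos (h.top rfl).1, h'.bot_pos (h'.top rfl).1, (hR 0 (by omega)).1]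
      simp only [Nat.sub_zero]
      linarith)
    (by
      simp only [Function.comp_apply]
      -- The largest slopes add up to `A (n - 1) - A 0`, which is no smaller; the limit at `+∞`
      -- needs no candidate of its own.
      rw [(h.top rfl).2, (h'.top rfl).2, (hR (n - 1) (by omega)).1, Nat.sub_self]
      linarith) c
  rw [← Real.sqrt_mul hG0.le] at hij
  have hj' := (h'.mem j hj).2
  refine ⟨st i, n - 1 - st' j, (h.mem i hi).1, (h.mem i hi).2, by omega, hij.trans ?_⟩
  have e2 : lineAt (X ∘ st') (Y ∘ st') j c = lineAt X Y (st' j) c := rfl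
  rw [e2, hR.lineAt_eq hj']
  exact le_of_eq (sub_eq_add_neg _ _).symm

end

/-- The split `k` and the direction `c` attain the value `m`, up to the factor `1 + ε / 3`. -/
structure Attained (n : ℕ) (A B : ℕ → ℝ) (ε : ℝ) (k : ℕ) (m c : ℝ) : Prop where
  one_le : 1 ≤ k
  lt : k < n
  width_le : (A (k - 1) - A 0) * (A (k - 1) - A 0) ≤ m
  good : GoodSplit n A B ε k m c

/-- No split before `lo` or from `hi` on has a value less than `m`. -/
structure Remaining (n : ℕ) (A B : ℕ → ℝ) (lo hi : ℕ) (m : ℝ) : Prop where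
  one_le : 1 ≤ lo
  le : lo ≤ hi
  lt : hi < n
  before : lo = 1 ∨ SplitBound n A B (lo - 1) m
  after : m ≤ (A (hi - 1) - A 0) * (A (hi - 1) - A 0)

theorem Remaining.mono {n : ℕ} {A B : ℕ → ℝ} {lo hi : ℕ} {m m' : ℝ}
    (h : Remaining n A B lo hi m) (hm : m' ≤ m) : Remaining n A B lo hi m' :=
  ⟨h.one_le, h.le, h.lt, h.before.imp_right fun h => h.mono hm, hm.trans h.after⟩

/-- Here `d` is the length of the search interval, and the logarithm of `d + 1` bounds the number of
remaining rounds. -/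
theorem clog_half {d d' : ℕ} (hd : 0 < d) (h : d' ≤ d / 2) :
    Nat.clog 2 (d' + 1) + 1 ≤ Nat.clog 2 (d + 1) := by
  rw [Nat.clog_of_two_le (le_refl 2) (show 2 ≤ d + 1 by omega)]
  exact Nat.succ_le_succ (Nat.clog_mono_right 2 (by omega))

namespace RealRAM

/-! ## The best direction for one split

The sorted points are in the arrays `2` and `3`, the negated and reversed points in the arrays `6`
and `7`, with their envelope in the array `1` and its height in variable `11`. The split is in
variable `7`, the number `ε` in real variable `2` and a bound for the spread of array `3` in real
variable `3`. -/

/-- The widths of the two parts of the split, and the value of the limit direction. -/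
def evalInit : Cmd :=
  .seq (.realAssign 16 (.sub (.get 2 (.sub (.var 7) (.const 1))) (.get 2 (.const 0)))) <|
  .seq (.realAssign 17 (.sub (.get 2 (.sub (.var 0) (.const 1))) (.get 2 (.var 7)))) <|
  .seq (.ite (.realLt (.var 16) (.var 17)) (.realAssign 18 (.var 17)) (.realAssign 18 (.var 16))) <|
  .seq (.realAssign 10 (.mul (.var 17) (.var 17))) <|
  .seq (.realAssign 11 (.sub (.const 0)
    (.div (.mul (.const 3) (.var 3)) (.mul (.var 2) (.var 18))))) <|
  .seq (.realAssign 21 (.mul (.var 16) (.var 16))) <|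
  .natAssign 1 (.var 7)

/-- Minimize over all directions for the split in variable `7`. -/
def evalSplit : Cmd :=
  .seq evalInit <|
  .seq (hull 2 3 0) <|
  .seq (walk 2 3 0 2 6 7 1 11) (walk 6 7 1 11 2 3 0 2)

/-- What the evaluation of a split requires. -/
structure EvalPre (n : ℕ) (A B X Y : ℕ → ℝ) (ε S : ℝ) (s : State) : Prop where
  n_eq : s.natVar 0 = n
  A_eq : s.realArr 2 = A
  B_eq : s.realArr 3 = B
  X_eq : s.realArr 6 = X
  Y_eq : s.realArr 7 = Y
  ε_eq : s.realVar 2 = ε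
  S_eq : s.realVar 3 = S
  ε_pos : 0 < ε
  sorted : LexSorted 0 n A B
  negRev : NegRev n A B X Y
  stack : StackInv 0 n X Y (s.natArr 1) (s.natVar 11) n
  spread : ∀ i < n, ∀ j < n, B i - B j ≤ S
  gap : ∀ k, 1 ≤ k → k < n → A 0 < A (k - 1) ∨ A k < A (n - 1)

theorem EvalPre.of_frame {n : ℕ} {A B X Y : ℕ → ℝ} {ε S : ℝ} {s t : State}
    (h : EvalPre n A B X Y ε S s) {c : Cmd} (hf : Frame c s t)
    (h1 : 0 ∉ c.natVars ∧ 11 ∉ c.natVars) (h2 : 1 ∉ c.natArrs)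
    (h3 : 2 ∉ c.realVars ∧ 3 ∉ c.realVars)
    (h4 : 2 ∉ c.realArrs ∧ 3 ∉ c.realArrs ∧ 6 ∉ c.realArrs ∧ 7 ∉ c.realArrs) :
    EvalPre n A B X Y ε S t where
  n_eq := (hf.natVar 0 h1.1).trans h.n_eq
  A_eq := (hf.realArr 2 h4.1).trans h.A_eq
  B_eq := (hf.realArr 3 h4.2.1).trans h.B_eq
  X_eq := (hf.realArr 6 h4.2.2.1).trans h.X_eq
  Y_eq := (hf.realArr 7 h4.2.2.2).trans h.Y_eq
  ε_eq := (hf.realVar 2 h3.1).trans h.ε_eq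
  S_eq := (hf.realVar 3 h3.2).trans h.S_eq
  ε_pos := h.ε_pos
  sorted := h.sorted
  negRev := h.negRev
  stack := by rw [hf.natVar 11 h1.2, hf.natArr 1 h2]; exact h.stack
  spread := h.spread
  gap := h.gap

theorem evalInit_spec {n : ℕ} {A B X Y : ℕ → ℝ} {ε S : ℝ} {s : State}
    (h : EvalPre n A B X Y ε S s) {k : ℕ} (hk : s.natVar 7 = k) (hk1 : 1 ≤ k) (hkn : k < n) :
    WP evalInit (fun t T =>
      t.realVar 21 = (A (k - 1) - A 0) * (A (k - 1) - A 0) ∧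
      t.realVar 10 = (A (n - 1) - A k) * (A (n - 1) - A k) ∧
      GoodSplit n A B ε k (max (t.realVar 21) (t.realVar 10)) (t.realVar 11) ∧
      t.natVar 1 = k ∧ T ≤ 60) s := by
  have hw : 0 ≤ A (k - 1) - A 0 :=
    sub_nonneg.2 (h.sorted.le le_rfl (Nat.zero_le _) (by omega))
  have hl : 0 ≤ A (n - 1) - A k :=
    sub_nonneg.2 (h.sorted.le (Nat.zero_le _) (by omega) (by omega))
  have hg := h.gap k hk1 hkn
  simp [evalInit, h.n_eq, h.A_eq, h.ε_eq, h.S_eq, hk]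
  refine ⟨fun hlt => ?_, fun hle => ?_⟩
  · refine goodSplit_limit h.ε_pos (M := A (n - 1) - A k) (by linarith) le_rfl
      h.sorted h.spread (le_max_right _ _) (by ring)
  · refine goodSplit_limit h.ε_pos (M := A (k - 1) - A 0) ?_ (by linarith)
      h.sorted h.spread (le_max_left _ _) (by ring)
    -- Neither width is negative and `gap` makes one of them positive, hence so is the larger one.
    rcases hg with hg | hg <;> linarith

theorem evalSplit_spec {n : ℕ} {A B X Y : ℕ → ℝ} {ε S : ℝ} {s : State}
    (h : EvalPre n A B X Y ε S s) {k : ℕ} (hk : s.natVar 7 = k) (hk1 : 1 ≤ k) (hkn : k < n) :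
    WP evalSplit (fun t T =>
      t.realVar 21 = (A (k - 1) - A 0) * (A (k - 1) - A 0) ∧
      SplitBound n A B k (t.realVar 10) ∧
      GoodSplit n A B ε k (max (t.realVar 21) (t.realVar 10)) (t.realVar 11) ∧
      T ≤ 900 * n) s := by
  rw [evalSplit, wp_seq]
  refine (evalInit_spec h hk hk1 hkn).frame.mono ?_
  rintro s1 T1 ⟨⟨e1, e2, e3, e4, hT1⟩, hf1⟩
  have p1 := h.of_frame hf1 (by decide) (by decide) (by decide) (by decide)
  rw [wp_seq]
  refine (hull_spec 2 3 0 e4 (by rw [p1.n_eq]; exact hkn) (by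
    rw [p1.n_eq, p1.A_eq, p1.B_eq]
    exact fun x y _ hxy hy => h.sorted x y (Nat.zero_le _) hxy hy)).frame.mono ?_
  rintro s2 T2 ⟨⟨hQ, hT2⟩, hf2⟩
  rw [p1.n_eq] at hQ hT2
  rw [p1.A_eq, p1.B_eq] at hQ
  have p2 := p1.of_frame hf2 (by decide) (by decide) (by decide) (by decide)
  have r21 : s2.realVar 21 = s1.realVar 21 := hf2.realVar 21 (by decide)
  have r10 : s2.realVar 10 = s1.realVar 10 := hf2.realVar 10 (by decide)
  have r11 : s2.realVar 11 = s1.realVar 11 := hf2.realVar 11 (by decide)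
  have hE := hQ.isEnvelope
  have hF := p2.stack.isEnvelope
  have hm := hQ.height
  have hm' := p2.stack.height
  rw [wp_seq]
  refine (walk_spec 2 3 0 2 6 7 1 11 (by decide) (by decide) (by decide) (by decide) rfl rfl
    (by rw [p2.A_eq]) (by rw [p2.B_eq]) (by rw [p2.X_eq]) (by rw [p2.Y_eq]) hE hF
    (fun G c => GoodSplit n A B ε k (max (s1.realVar 21) G) c)
    (fun i j c hi hj => goodSplit_of_isMaxLine h.ε_pos h.negRev hQ p2.stack hi hj)
    (by rw [r10, r11]; exact e3)).frame.mono ?_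
  rintro s3 T3 ⟨⟨hG3, hle3, hB3, hT3⟩, hf3⟩
  have p3 := p2.of_frame hf3 (by decide) (by decide) (by decide) (by decide)
  have m3 : s3.natVar 2 = s2.natVar 2 := hf3.natVar 2 (by decide)
  have m3' : s3.natVar 11 = s2.natVar 11 := hf3.natVar 11 (by decide)
  have a3 : s3.natArr 0 = s2.natArr 0 := hf3.natArr 0 (by decide)
  have a3' : s3.natArr 1 = s2.natArr 1 := hf3.natArr 1 (by decide)
  have r21' : s3.realVar 21 = s2.realVar 21 := hf3.realVar 21 (by decide)
  refine (walk_spec 6 7 1 11 2 3 0 2 (by decide) (by decide) (by decide) (by decide) m3' m3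
    (by rw [p3.X_eq, a3']) (by rw [p3.Y_eq, a3']) (by rw [p3.A_eq, a3]) (by rw [p3.B_eq, a3])
    hF hE (fun G c => GoodSplit n A B ε k (max (s1.realVar 21) G) c)
    (fun i j c hi hj => by
      rw [normSq_comm]
      exact goodSplit_of_isMaxLine h.ε_pos h.negRev hQ p2.stack hj hi) hG3).frame.mono ?_
  rintro s4 T4 ⟨⟨hG4, hle4, hB4, hT4⟩, hf4⟩
  have r21'' : s4.realVar 21 = s3.realVar 21 := hf4.realVar 21 (by decide)
  refine ⟨by rw [r21'', r21', r21, e1], ?_, by rw [r21'', r21', r21]; exact hG4, by omega⟩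
  -- The record only decreases, so the final value is also below the breakpoints of the first walk
  -- and below the initial value, the squared limit.
  refine splitBound_of_below h.sorted hkn h.negRev hQ p2.stack ?_ (hB3.mono hle4) hB4
  rw [← e2, ← r10]
  exact hle4.trans hle3

/-! ## Binary search for the best split -/

/-- Start with the split before the last point. -/
def searchInit : Cmd :=
  .seq (.natAssign 5 (.const 1)) <|
  .seq (.natAssign 6 (.sub (.var 0) (.const 1))) <|
  .seq (.natAssign 8 (.sub (.var 0) (.const 1))) <|
  .seq (.realAssign 16 (.sub (.get 2 (.sub (.var 6) (.const 1))) (.get 2 (.const 0)))) <|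
  .seq (.realAssign 19 (.mul (.var 16) (.var 16))) <|
  .realAssign 20 (.sub (.const 0) (.div (.mul (.const 3) (.var 3)) (.mul (.var 2) (.var 16))))

/-- Update the best split and halve the search interval. -/
def searchUpdate : Cmd :=
  .seq (.ite (.realLt (.var 10) (.var 21)) (.realAssign 22 (.var 21)) (.realAssign 22 (.var 10))) <|
  .seq (.ite (.realLt (.var 22) (.var 19))
    (.seq (.realAssign 19 (.var 22)) (.seq (.realAssign 20 (.var 11)) (.natAssign 8 (.var 7))))
    .skip) <|
  .ite (.realLt (.var 21) (.var 10)) (.natAssign 5 (.add (.var 7) (.const 1)))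
    (.natAssign 6 (.var 7))

/-- Find the best split. -/
def search : Cmd :=
  .seq searchInit <|
  .loop (.natLt (.var 5) (.var 6)) <|
    .seq (.natAssign 7 (.half (.add (.var 5) (.var 6)))) <|
    .seq evalSplit searchUpdate

/-- After the update the best value is at most the larger of the two squared widths at `k`. If the
second is larger, splits up to `k` cannot improve on it, since their second strip must contain even
more points. Otherwise splits from `k` on cannot, since their first strip is at least as wide. -/
theorem searchUpdate_spec {n : ℕ} {A B : ℕ → ℝ} {ε : ℝ} {lo hi k : ℕ} {s : State}
    (h5 : s.natVar 5 = lo) (h6 : s.natVar 6 = hi) (h7 : s.natVar 7 = k)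
    (hlo : lo ≤ k) (hhi : k < hi)
    (hA : Attained n A B ε (s.natVar 8) (s.realVar 19) (s.realVar 20))
    (hR : Remaining n A B lo hi (s.realVar 19))
    (h21 : s.realVar 21 = (A (k - 1) - A 0) * (A (k - 1) - A 0))
    (hB : SplitBound n A B k (s.realVar 10))
    (hG : GoodSplit n A B ε k (max (s.realVar 21) (s.realVar 10)) (s.realVar 11)) :
    WP searchUpdate (fun t T =>
      Attained n A B ε (t.natVar 8) (t.realVar 19) (t.realVar 20) ∧
      Remaining n A B (t.natVar 5) (t.natVar 6) (t.realVar 19) ∧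
      ((t.natVar 5 = k + 1 ∧ t.natVar 6 = hi) ∨ (t.natVar 5 = lo ∧ t.natVar 6 = k)) ∧
      T ≤ 30) s := by
  have h1 := hR.one_le
  have h2 := hR.lt
  have new : Attained n A B ε k (max (s.realVar 21) (s.realVar 10)) (s.realVar 11) :=
    ⟨by omega, by omega, by rw [← h21]; exact le_max_left _ _, hG⟩
  have up : ∀ m ≤ s.realVar 19, m ≤ s.realVar 10 → Remaining n A B (k + 1) hi m :=
    fun m hm hm' => ⟨by omega, by omega, h2, Or.inr (hB.mono hm'), hm.trans hR.after⟩
  have down : ∀ m ≤ s.realVar 19, m ≤ s.realVar 21 → Remaining n A B lo k m :=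
    fun m hm hm' => ⟨h1, hlo, by omega, (hR.mono hm).before, by rw [← h21]; exact hm'⟩
  simp [searchUpdate, h5, h6, h7]
  generalize s.realVar 21 = w at *
  generalize s.realVar 10 = G at *
  generalize s.realVar 19 = m at *
  refine ⟨fun a => ⟨fun b => ⟨fun c => absurd c a.not_gt, fun _ => ?_⟩,
    fun b => ⟨fun c => absurd c a.not_gt, fun _ => ?_⟩⟩,
    fun a => ⟨fun b => ⟨fun c => ?_, fun c => ?_⟩, fun b => ⟨fun c => ?_, fun c => ?_⟩⟩⟩
  · rw [max_eq_left a.le] at new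
    exact ⟨new, down _ b.le le_rfl⟩
  · exact ⟨hA, down _ le_rfl b⟩
  · rw [max_eq_right a] at new
    exact ⟨new, up _ b.le le_rfl⟩
  · rw [max_eq_right a] at new
    exact ⟨new, down _ b.le c⟩
  · exact ⟨hA, up _ le_rfl b⟩
  · exact ⟨hA, down _ le_rfl (b.trans c)⟩

theorem search_spec {n : ℕ} {A B X Y : ℕ → ℝ} {ε S : ℝ} {s : State}
    (h : EvalPre n A B X Y ε S s) (hn : 2 ≤ n) :
    WP search (fun t T => Attained n A B ε (t.natVar 8) (t.realVar 19) (t.realVar 20) ∧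
      (∃ k, Remaining n A B k k (t.realVar 19)) ∧
      T ≤ 1000 * n * (Nat.clog 2 n + 1)) s := by
  have init : WP searchInit (fun t T => EvalPre n A B X Y ε S t ∧
      Attained n A B ε (t.natVar 8) (t.realVar 19) (t.realVar 20) ∧
      Remaining n A B (t.natVar 5) (t.natVar 6) (t.realVar 19) ∧ T ≤ 50) s := by
    have hA : WP searchInit (fun t T =>
        Attained n A B ε (t.natVar 8) (t.realVar 19) (t.realVar 20) ∧
        Remaining n A B (t.natVar 5) (t.natVar 6) (t.realVar 19) ∧ T ≤ 50) s := by
      simp [searchInit, h.n_eq, h.A_eq, h.ε_eq, h.S_eq]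
      have hw : 0 ≤ A (n - 1 - 1) - A 0 :=
        sub_nonneg.2 (h.sorted.le le_rfl (Nat.zero_le _) (by omega))
      -- For the last split the limit of the second width is zero, so the first width is the
      -- positive one and serves as `M`.
      have hg := (h.gap (n - 1) (by omega) (by omega)).resolve_right (lt_irrefl _)
      refine ⟨⟨by omega, by omega, le_rfl, ?_⟩, ⟨le_rfl, by omega, by omega, Or.inl rfl, le_rfl⟩⟩
      exact goodSplit_limit h.ε_pos (M := A (n - 1 - 1) - A 0) (by linarith)
        (by linarith) h.sorted h.spread le_rfl (by ring)
    refine hA.frame.mono ?_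
    rintro t T ⟨h1, hf⟩
    exact ⟨h.of_frame hf (by decide) (by decide) (by decide) (by decide), h1⟩
  rw [search, wp_seq]
  refine init.mono ?_
  rintro s1 T1 ⟨p1, hA1, hR1, hT1⟩
  refine (wp_loop (fun r => EvalPre n A B X Y ε S r ∧
      Attained n A B ε (r.natVar 8) (r.realVar 19) (r.realVar 20) ∧
      Remaining n A B (r.natVar 5) (r.natVar 6) (r.realVar 19))
    (fun r => (950 * n) * Nat.clog 2 (r.natVar 6 - r.natVar 5 + 1)) ?_ ⟨p1, hA1, hR1⟩).mono ?_
  · rintro r ⟨pr, hA, hR⟩ hb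
    simp only [Test.Holds, NExp.val] at hb
    have hone := hR.one_le
    have hlt := hR.lt
    rw [wp_seq, wp_natAssign, wp_seq]
    have p2 : EvalPre n A B X Y ε S (r.setNatVar 7 (NExp.val r (.half (.add (.var 5) (.var 6))))) :=
      pr.of_frame (Exec.natAssign r 7 (.half (.add (.var 5) (.var 6)))).frame
        (by decide) (by decide) (by decide) (by decide)
    have h7 : (r.setNatVar 7 (NExp.val r (.half (.add (.var 5) (.var 6))))).natVar 7 =
        (r.natVar 5 + r.natVar 6) / 2 := by simp
    refine (evalSplit_spec p2 h7 (by omega) (by omega)).frame.mono ?_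
    rintro s3 T3 ⟨⟨e1, e2, e3, hT3⟩, hf3⟩
    have p3 := p2.of_frame hf3 (by decide) (by decide) (by decide) (by decide)
    have n5 : s3.natVar 5 = r.natVar 5 := (hf3.natVar 5 (by decide)).trans (by simp)
    have n6 : s3.natVar 6 = r.natVar 6 := (hf3.natVar 6 (by decide)).trans (by simp)
    have n7 := (hf3.natVar 7 (by decide)).trans h7
    have n8 : s3.natVar 8 = r.natVar 8 := (hf3.natVar 8 (by decide)).trans (by simp)
    have r19 : s3.realVar 19 = r.realVar 19 := (hf3.realVar 19 (by decide)).trans (by simp)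
    have r20 : s3.realVar 20 = r.realVar 20 := (hf3.realVar 20 (by decide)).trans (by simp)
    rw [← n8, ← r19, ← r20] at hA
    rw [← r19] at hR
    refine (searchUpdate_spec n5 n6 n7 (by omega) (by omega) hA hR e1 e2 e3).frame.mono ?_
    rintro s4 T4 ⟨⟨hA4, hR4, hcase, hT4⟩, hf4⟩
    refine ⟨⟨p3.of_frame hf4 (by decide) (by decide) (by decide) (by decide), hA4, hR4⟩, ?_⟩
    have hhalf : Nat.clog 2 (s4.natVar 6 - s4.natVar 5 + 1) + 1 ≤
        Nat.clog 2 (r.natVar 6 - r.natVar 5 + 1) := clog_half (by omega) (by omega)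
    have := Nat.mul_le_mul_left (950 * n) hhalf
    simp only [NExp.cost, Test.cost]
    rw [Nat.mul_add] at this
    omega
  · rintro t T ⟨⟨-, hA, hR⟩, hb, hT⟩
    simp only [Test.Holds, NExp.val] at hb
    have hle := hR.le
    refine ⟨hA, ⟨t.natVar 5, ?_⟩, ?_⟩
    · have e : t.natVar 6 = t.natVar 5 := by omega
      rwa [e] at hR
    · have h1 := hR1.one_le
      have h2 := hR1.lt
      have : Nat.clog 2 (s1.natVar 6 - s1.natVar 5 + 1) ≤ Nat.clog 2 n :=
        Nat.clog_mono_right 2 (by omega)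
      have := Nat.mul_le_mul_left (950 * n) this
      simp only [NExp.cost, Test.cost] at hT
      have e : 1000 * n * (Nat.clog 2 n + 1) =
        950 * n * Nat.clog 2 n + 50 * (n * Nat.clog 2 n) + 1000 * n := by ring
      omega

end RealRAM

/-! ## Merging sorted runs -/

/-- On `[0, n)`, the sequence `f` is sorted within every block of length `w`. -/
def SortedRuns {α : Type*} [Preorder α] (w n : ℕ) (f : ℕ → α) : Prop :=
  ∀ q x y, q * w ≤ x → x ≤ y → y < (q + 1) * w → y < n → f x ≤ f y

/-- The sequences `f` and `g` have the same values on `[0, n)`. -/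
structure SameRange {α : Type*} (n : ℕ) (f g : ℕ → α) : Prop where
  mem : ∀ x < n, ∃ y < n, g x = f y
  covers : ∀ y < n, ∃ x < n, g x = f y

theorem SameRange.refl {α : Type*} (n : ℕ) (f : ℕ → α) : SameRange n f f :=
  ⟨fun x hx => ⟨x, hx, rfl⟩, fun y hy => ⟨y, hy, rfl⟩⟩

theorem SameRange.trans {α : Type*} {n : ℕ} {f g h : ℕ → α} (h1 : SameRange n f g)
    (h2 : SameRange n g h) : SameRange n f h := by
  constructor
  · intro x hx
    obtain ⟨y, hy, e⟩ := h2.mem x hx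
    obtain ⟨z, hz, e'⟩ := h1.mem y hy
    exact ⟨z, hz, e.trans e'⟩
  · intro y hy
    obtain ⟨x, hx, e⟩ := h1.covers y hy
    obtain ⟨z, hz, e'⟩ := h2.covers x hx
    exact ⟨z, hz, e'.trans e⟩

/-- The runs `[lo, lo + w)` and `[lo + w, lo + 2 * w)` of `f` are being merged; the elements before
`i` and `j` have been written to the first `p` places of `g`. -/
structure MergeInv {α : Type*} [Preorder α] (w n : ℕ) (f g : ℕ → α) (lo i j p : ℕ) : Prop where
  block : ∃ q, lo = q * (2 * w)
  left : lo ≤ i ∧ i ≤ lo + w ∧ (i ≤ n ∨ i = lo)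
  right : lo + w ≤ j ∧ j ≤ lo + 2 * w ∧ (j ≤ n ∨ j = lo + w)
  pos_eq : p = min lo n + (i - lo) + (j - (lo + w))
  sorted : SortedRuns (2 * w) p g
  le_left : ∀ x, lo ≤ x → x < p → ∀ y, i ≤ y → y < lo + w → y < n → g x ≤ f y
  le_right : ∀ x, lo ≤ x → x < p → ∀ y, j ≤ y → y < lo + 2 * w → y < n → g x ≤ f y
  mem : ∀ x < p, ∃ y < n, g x = f y
  covers : ∀ y < n, y < i ∨ (lo + w ≤ y ∧ y < j) → ∃ x < p, g x = f y

section

variable {α : Type*} [LinearOrder α] {w n : ℕ} {f g : ℕ → α} {lo i j p : ℕ}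

theorem mergeInv_init (w n : ℕ) (f g : ℕ → α) : MergeInv w n f g 0 0 w 0 where
  block := ⟨0, by simp⟩
  left := by omega
  right := by omega
  pos_eq := by simp
  sorted := fun q x y _ _ _ h => absurd h (Nat.not_lt_zero y)
  le_left := fun x _ h => absurd h (Nat.not_lt_zero x)
  le_right := fun x _ h => absurd h (Nat.not_lt_zero x)
  mem := fun x h => absurd h (Nat.not_lt_zero x)
  covers := fun y _ h => by omega

/-- The new element shares its block only with elements from `lo` on, because `lo` is itself a block
boundary. -/
theorem sortedRuns_update {k : ℕ} (hb : ∃ q, lo = q * (2 * w)) (hlo : lo ≤ p)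
    (hs : SortedRuns (2 * w) p g) (hk : ∀ x, lo ≤ x → x < p → g x ≤ f k) :
    SortedRuns (2 * w) (p + 1) (Function.update g p (f k)) := by
  intro q x y hx hxy hy hyp
  rcases Nat.lt_succ_iff_lt_or_eq.1 hyp with h | rfl
  · rw [Function.update_of_ne (by omega), Function.update_of_ne (by omega)]
    exact hs q x y hx hxy hy h
  · rcases hxy.lt_or_eq with h | rfl
    · rw [Function.update_self, Function.update_of_ne h.ne]
      obtain ⟨r, rfl⟩ := hb
      have h1 : r * (2 * w) < (q + 1) * (2 * w) := hlo.trans_lt hy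
      have h2 : r < q + 1 := Nat.lt_of_mul_lt_mul_right h1
      exact hk x ((Nat.mul_le_mul_right _ (by omega)).trans hx) h
    · exact le_rfl

theorem MergeInv.takeLeft (hf : SortedRuns w n f) (h : MergeInv w n f g lo i j p) (hlo : lo < n)
    (hi : i < lo + w) (hin : i < n) (hle : j < lo + 2 * w → j < n → f i ≤ f j) :
    MergeInv w n f (Function.update g p (f i)) lo (i + 1) j (p + 1) := by
  have hl := h.left
  have hr := h.right
  have hp := h.pos_eq
  rw [min_eq_left hlo.le] at hp
  obtain ⟨q, hq⟩ := h.block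
  -- The two runs are the blocks `2 * q` and `2 * q + 1` of length `w`.
  have e1 : 2 * q * w = lo := by rw [hq]; ring
  have e2 : (2 * q + 1) * w = lo + w := by rw [hq]; ring
  have e3 : (2 * q + 1 + 1) * w = lo + 2 * w := by rw [hq]; ring
  have upd : ∀ x, x < p → Function.update g p (f i) x = g x := fun x hx =>
    Function.update_of_ne (by omega) _ _
  refine ⟨h.block, by omega, hr, by rw [min_eq_left hlo.le]; omega,
    sortedRuns_update h.block (by omega) h.sorted
      (fun x h1 h2 => h.le_left x h1 h2 i le_rfl hi hin),
    fun x h1 h2 y h3 h4 h5 => ?_, fun x h1 h2 y h3 h4 h5 => ?_, fun x hx => ?_,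
    fun y hy hy' => ?_⟩
  · rcases Nat.lt_succ_iff_lt_or_eq.1 h2 with h2 | rfl
    · rw [upd x h2]; exact h.le_left x h1 h2 y (by omega) h4 h5
    · rw [Function.update_self]
      exact hf (2 * q) i y (by omega) (by omega) (by omega) h5
  · rcases Nat.lt_succ_iff_lt_or_eq.1 h2 with h2 | rfl
    · rw [upd x h2]; exact h.le_right x h1 h2 y h3 h4 h5
    · rw [Function.update_self]
      exact (hle (by omega) (by omega)).trans
        (hf (2 * q + 1) j y (by omega) h3 (by omega) h5)
  · rcases Nat.lt_succ_iff_lt_or_eq.1 hx with hx | rfl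
    · rw [upd x hx]; exact h.mem x hx
    · exact ⟨i, hin, Function.update_self _ _ _⟩
  · by_cases hyi : y = i
    · exact ⟨p, by omega, by rw [Function.update_self, hyi]⟩
    · obtain ⟨x, hx, e⟩ := h.covers y hy (by omega)
      exact ⟨x, by omega, by rw [upd x hx, e]⟩

theorem MergeInv.takeRight (hf : SortedRuns w n f) (h : MergeInv w n f g lo i j p) (hlo : lo < n)
    (hj : j < lo + 2 * w) (hjn : j < n) (hle : i < lo + w → i < n → f j ≤ f i) :
    MergeInv w n f (Function.update g p (f j)) lo i (j + 1) (p + 1) := by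
  have hl := h.left
  have hr := h.right
  have hp := h.pos_eq
  rw [min_eq_left hlo.le] at hp
  obtain ⟨q, hq⟩ := h.block
  have e1 : 2 * q * w = lo := by rw [hq]; ring
  have e2 : (2 * q + 1) * w = lo + w := by rw [hq]; ring
  have e3 : (2 * q + 1 + 1) * w = lo + 2 * w := by rw [hq]; ring
  have upd : ∀ x, x < p → Function.update g p (f j) x = g x := fun x hx =>
    Function.update_of_ne (by omega) _ _
  refine ⟨h.block, hl, by omega, by rw [min_eq_left hlo.le]; omega,
    sortedRuns_update h.block (by omega) h.sorted
      (fun x h1 h2 => h.le_right x h1 h2 j le_rfl hj hjn),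
    fun x h1 h2 y h3 h4 h5 => ?_, fun x h1 h2 y h3 h4 h5 => ?_, fun x hx => ?_,
    fun y hy hy' => ?_⟩
  · rcases Nat.lt_succ_iff_lt_or_eq.1 h2 with h2 | rfl
    · rw [upd x h2]; exact h.le_left x h1 h2 y h3 h4 h5
    · rw [Function.update_self]
      exact (hle (by omega) (by omega)).trans
        (hf (2 * q) i y (by omega) h3 (by omega) h5)
  · rcases Nat.lt_succ_iff_lt_or_eq.1 h2 with h2 | rfl
    · rw [upd x h2]; exact h.le_right x h1 h2 y (by omega) h4 h5
    · rw [Function.update_self]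
      exact hf (2 * q + 1) j y (by omega) (by omega) (by omega) h5
  · rcases Nat.lt_succ_iff_lt_or_eq.1 hx with hx | rfl
    · rw [upd x hx]; exact h.mem x hx
    · exact ⟨j, hjn, Function.update_self _ _ _⟩
  · by_cases hyj : y = j
    · exact ⟨p, by omega, by rw [Function.update_self, hyj]⟩
    · obtain ⟨x, hx, e⟩ := h.covers y hy (by omega)
      exact ⟨x, by omega, by rw [upd x hx, e]⟩

theorem MergeInv.nextBlock (h : MergeInv w n f g lo i j p) (hw : 0 < w) (hlo : lo < n)
    (hi : ¬ (i < lo + w ∧ i < n)) (hj : ¬ (j < lo + 2 * w ∧ j < n)) :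
    MergeInv w n f g (lo + 2 * w) (lo + 2 * w) (lo + 2 * w + w) p := by
  have hl := h.left
  have hr := h.right
  have hp := h.pos_eq
  rw [min_eq_left hlo.le] at hp
  -- The last pair of runs may stick out beyond `n`; the minimum accounts for the missing elements.
  have hmin : p = min (lo + 2 * w) n := by
    rcases le_total (lo + 2 * w) n with h | h
    · rw [min_eq_left h]; omega
    · rw [min_eq_right h]; omega
  have hp' : p ≤ lo + 2 * w := hmin ▸ min_le_left _ _
  refine ⟨?_, by omega, by omega, by omega, h.sorted, fun x h1 h2 => by omega,
    fun x h1 h2 => by omega, h.mem, fun y hy hy' => h.covers y hy (by omega)⟩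
  obtain ⟨q, hq⟩ := h.block
  exact ⟨q + 1, by rw [hq]; ring⟩

theorem MergeInv.finish (h : MergeInv w n f g lo i j p) (hlo : n ≤ lo) :
    SortedRuns (2 * w) n g ∧ SameRange n f g := by
  have hl := h.left
  have hr := h.right
  have hp := h.pos_eq
  rw [min_eq_right hlo] at hp
  obtain rfl : p = n := by omega
  exact ⟨h.sorted, h.mem, fun y hy => h.covers y hy (by omega)⟩

end

/-- The points with coordinates in `A` and `B`, ordered lexicographically. -/
def lexSeq (A B : ℕ → ℝ) (i : ℕ) : ℝ ×ₗ ℝ := toLex (A i, B i)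

theorem lexSeq_update (A B : ℕ → ℝ) (p : ℕ) (a b : ℝ) :
    lexSeq (Function.update A p a) (Function.update B p b) =
      Function.update (lexSeq A B) p (toLex (a, b)) := by
  funext i
  by_cases h : i = p
  · subst h; simp [lexSeq]
  · simp [lexSeq, h]

theorem lexSeq_lt_iff {A B : ℕ → ℝ} {i j : ℕ} :
    lexSeq A B i < lexSeq A B j ↔ A i < A j ∨ (¬ A j < A i ∧ B i < B j) := by
  rw [lexSeq, lexSeq, Prod.Lex.toLex_lt_toLex]
  constructor
  · rintro (h | ⟨h, h'⟩)
    · exact Or.inl h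
    · exact Or.inr ⟨h.not_gt, h'⟩
  · rintro (h | ⟨h, h'⟩)
    · exact Or.inl h
    · rcases lt_or_eq_of_le (not_lt.1 h) with h | h
      · exact Or.inl h
      · exact Or.inr ⟨h, h'⟩

theorem lexSorted_of_sortedRuns {n w : ℕ} {A B : ℕ → ℝ} (hw : n ≤ w)
    (h : SortedRuns w n (lexSeq A B)) : LexSorted 0 n A B := fun x y _ hxy hy => by
  have := h 0 x y (by simp) hxy (by omega) hy
  rwa [lexSeq, lexSeq, Prod.Lex.toLex_le_toLex] at this

namespace RealRAM

/-! ## Bottom-up merge sort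

The arrays `2` and `3` are sorted lexicographically, with the help of the arrays `4` and `5`.
Natural-number variables: `12` length of the sorted runs, `13` start of the first run, `17` and
`18` ends of the two runs, `14` and `15` positions in the runs, `16` position in the output. -/

/-- Copy the point with index in variable `v` to the output. -/
def mergeTake (v : ℕ) : Cmd :=
  .seq (.realStore 4 (.var 16) (.get 2 (.var v))) <|
  .seq (.realStore 5 (.var 16) (.get 3 (.var v))) <|
  .seq (.natAssign v (.add (.var v) (.const 1))) <|
  .natAssign 16 (.add (.var 16) (.const 1))

/-- Go to the next pair of runs. -/
def mergeNext : Cmd :=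
  .seq (.natAssign 13 (.var 18)) <|
  .seq (.natAssign 14 (.var 18)) <|
  .seq (.natAssign 17 (.add (.var 18) (.var 12))) <|
  .seq (.natAssign 15 (.var 17)) <|
  .natAssign 18 (.add (.var 17) (.var 12))

/-- The right run is not exhausted. -/
def rightTest : Test := .and (.natLt (.var 15) (.var 18)) (.natLt (.var 15) (.var 0))

/-- The next point of the right run is less than the next point of the left run. -/
def lexTest : Test :=
  .not (.and (.not (.realLt (.get 2 (.var 15)) (.get 2 (.var 14))))
    (.not (.and (.not (.realLt (.get 2 (.var 14)) (.get 2 (.var 15))))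
      (.realLt (.get 3 (.var 15)) (.get 3 (.var 14))))))

/-- Start with the first pair of runs. -/
def mergeInit : Cmd :=
  .seq (.natAssign 13 (.const 0)) <|
  .seq (.natAssign 14 (.const 0)) <|
  .seq (.natAssign 15 (.var 12)) <|
  .seq (.natAssign 16 (.const 0)) <|
  .seq (.natAssign 17 (.var 12)) <|
  .natAssign 18 (.add (.var 12) (.var 12))

/-- Merge pairs of sorted runs. -/
def mergePass : Cmd :=
  .seq mergeInit <|
  .loop (.natLt (.var 13) (.var 0)) <|
    .ite (.and (.and (.natLt (.var 14) (.var 17)) (.natLt (.var 14) (.var 0)))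
        (.not (.and rightTest lexTest)))
      (mergeTake 14)
      (.ite rightTest (mergeTake 15) mergeNext)

theorem lexTest_iff {s : State} : lexTest.Holds s ↔
    lexSeq (s.realArr 2) (s.realArr 3) (s.natVar 15) <
      lexSeq (s.realArr 2) (s.realArr 3) (s.natVar 14) := by
  rw [lexSeq_lt_iff]
  simp only [lexTest, Test.Holds, RExp.val, NExp.val]
  tauto

theorem mergePass_spec {s : State} {n w : ℕ} {f : ℕ → ℝ ×ₗ ℝ} (hn : s.natVar 0 = n)
    (hw : s.natVar 12 = w) (hw0 : 0 < w) (hfs : lexSeq (s.realArr 2) (s.realArr 3) = f)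
    (hf : SortedRuns w n f) :
    WP mergePass (fun t T => SortedRuns (2 * w) n (lexSeq (t.realArr 4) (t.realArr 5)) ∧
      SameRange n f (lexSeq (t.realArr 4) (t.realArr 5)) ∧ T ≤ 200 * n + 50) s := by
  rw [mergePass, wp_seq]
  have init : WP mergeInit (fun t T => t.natVar 0 = n ∧ t.natVar 12 = w ∧
      lexSeq (t.realArr 2) (t.realArr 3) = f ∧
      t.natVar 17 = t.natVar 13 + w ∧ t.natVar 18 = t.natVar 13 + 2 * w ∧
      MergeInv w n f (lexSeq (t.realArr 4) (t.realArr 5)) (t.natVar 13) (t.natVar 14)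
        (t.natVar 15) (t.natVar 16) ∧ T ≤ 30) s := by
    simp [mergeInit, hn, hw, hfs]
    exact ⟨by omega, mergeInv_init w n f _⟩
  refine init.mono ?_
  rintro s1 T1 ⟨n1, w1, f1, m1, h1, I1, hT1⟩
  refine (wp_loop (fun t => t.natVar 0 = n ∧ t.natVar 12 = w ∧
      lexSeq (t.realArr 2) (t.realArr 3) = f ∧
      t.natVar 17 = t.natVar 13 + w ∧ t.natVar 18 = t.natVar 13 + 2 * w ∧
      MergeInv w n f (lexSeq (t.realArr 4) (t.realArr 5)) (t.natVar 13) (t.natVar 14)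
        (t.natVar 15) (t.natVar 16))
    -- Every iteration either writes one element or moves on to the next pair of runs.
    (fun r => 80 * ((n - r.natVar 16) + (n - r.natVar 13))) ?_ ⟨n1, w1, f1, m1, h1, I1⟩).mono ?_
  · rintro r ⟨rn, rw', rf, rm, rh, I⟩ hb
    simp only [Test.Holds, NExp.val, rn] at hb
    have hl := I.left
    have hr := I.right
    have hp := I.pos_eq
    rw [min_eq_left hb.le] at hp
    have ef : ∀ i, toLex (r.realArr 2 i, r.realArr 3 i) = f i := fun i => congrFun rf i
    rw [wp_ite]
    constructor
    · rintro ⟨⟨hi, hin⟩, hle⟩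
      simp only [Test.Holds, NExp.val, rn, rm] at hi hin
      have hle' : r.natVar 15 < r.natVar 13 + 2 * w → r.natVar 15 < n →
          f (r.natVar 14) ≤ f (r.natVar 15) := by
        intro h1 h2
        by_contra! hcon
        refine hle ⟨?_, lexTest_iff.2 (by rw [rf]; exact hcon)⟩
        simpa [rightTest, rn, rh] using ⟨h1, h2⟩
      simp [mergeTake, rn, rw', rf, rm, rh, lexSeq_update, ef, rightTest, lexTest]
      exact ⟨I.takeLeft hf hb hi hin hle', by omega⟩
    · intro hnot
      rw [wp_ite]
      constructor
      · rintro ⟨hj, hjn⟩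
        simp only [Test.Holds, NExp.val, rn, rh] at hj hjn
        have hle' : r.natVar 14 < r.natVar 13 + w → r.natVar 14 < n →
            f (r.natVar 15) ≤ f (r.natVar 14) := by
          intro h1 h2
          by_contra! hcon
          refine hnot ⟨by simpa [rn, rm] using ⟨h1, h2⟩, fun h => ?_⟩
          have := lexTest_iff.1 h.2
          rw [rf] at this
          exact lt_asymm hcon this
        simp [mergeTake, rn, rw', rf, rm, rh, lexSeq_update, ef, rightTest, lexTest]
        exact ⟨I.takeRight hf hb hj hjn hle', by omega⟩
      · intro hj
        have hj' : ¬ (r.natVar 15 < r.natVar 13 + 2 * w ∧ r.natVar 15 < n) := by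
          simpa [rightTest, rn, rh] using hj
        have hi' : ¬ (r.natVar 14 < r.natVar 13 + w ∧ r.natVar 14 < n) := by
          rintro ⟨h1, h2⟩
          exact hnot ⟨by simpa [rn, rm] using ⟨h1, h2⟩, fun h => hj h.1⟩
        simp [mergeNext, rn, rw', rf, rh, rightTest, lexTest]
        exact ⟨⟨by omega, I.nextBlock hw0 hb hi' hj'⟩, by omega⟩
  · rintro t T ⟨⟨tn, -, -, -, -, I⟩, hb, hT⟩
    simp only [Test.Holds, NExp.val, tn] at hb
    obtain ⟨h1, h2⟩ := I.finish (not_lt.1 hb)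
    simp at hT
    exact ⟨h1, h2, by omega⟩

/-- Copy the arrays `4` and `5` to the arrays `2` and `3`. -/
def copyBack : Cmd :=
  .seq (.natAssign 13 (.const 0)) <|
  .loop (.natLt (.var 13) (.var 0)) <|
    .seq (.realStore 2 (.var 13) (.get 4 (.var 13))) <|
    .seq (.realStore 3 (.var 13) (.get 5 (.var 13))) <|
    .natAssign 13 (.add (.var 13) (.const 1))

theorem copyBack_spec {s : State} {n : ℕ} (hn : s.natVar 0 = n) :
    WP copyBack (fun t T => (∀ x < n, lexSeq (t.realArr 2) (t.realArr 3) x =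
      lexSeq (s.realArr 4) (s.realArr 5) x) ∧ T ≤ 20 * n + 10) s := by
  rw [copyBack, wp_seq, wp_natAssign]
  refine (wp_loop (fun t => t.natVar 0 = n ∧ t.realArr 4 = s.realArr 4 ∧
      t.realArr 5 = s.realArr 5 ∧ ∀ x < t.natVar 13, lexSeq (t.realArr 2) (t.realArr 3) x =
        lexSeq (s.realArr 4) (s.realArr 5) x)
    (fun r => 20 * (n - r.natVar 13)) ?_ ?_).mono ?_
  · rintro r ⟨rn, r4, r5, hI⟩ hb
    simp only [Test.Holds, NExp.val, rn] at hb
    simp [rn, r4, r5, lexSeq_update]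
    refine ⟨fun x hx => ?_, by omega⟩
    rcases Nat.le_iff_lt_or_eq.1 hx with h | h
    · rw [Function.update_of_ne h.ne]; exact hI x h
    · rw [h, Function.update_self]; rfl
  · simp [hn]
  · rintro t T ⟨⟨tn, -, -, hI⟩, hb, hT⟩
    simp only [Test.Holds, NExp.val, tn] at hb
    simp at hT ⊢
    exact ⟨fun x hx => hI x (by omega), by omega⟩

/-- Sort the arrays `2` and `3` lexicographically. -/
def sort : Cmd :=
  .seq (.natAssign 12 (.const 1)) <|
  .loop (.natLt (.var 12) (.var 0)) <|
    .seq mergePass <| .seq copyBack <| .natAssign 12 (.add (.var 12) (.var 12))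

theorem sort_spec {s : State} {n : ℕ} (hn : s.natVar 0 = n) (hn1 : 1 ≤ n) :
    WP sort (fun t T => LexSorted 0 n (t.realArr 2) (t.realArr 3) ∧
      SameRange n (lexSeq (s.realArr 2) (s.realArr 3)) (lexSeq (t.realArr 2) (t.realArr 3)) ∧
      T ≤ 300 * n * (Nat.log 2 n + 1) + 10) s := by
  rw [sort, wp_seq, wp_natAssign]
  refine (wp_loop (fun t => t.natVar 0 = n ∧ 0 < t.natVar 12 ∧
      SortedRuns (t.natVar 12) n (lexSeq (t.realArr 2) (t.realArr 3)) ∧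
      SameRange n (lexSeq (s.realArr 2) (s.realArr 3)) (lexSeq (t.realArr 2) (t.realArr 3)))
    -- Each pass doubles the run length and so raises its logarithm by one.
    (fun r => 300 * n * (Nat.log 2 n + 1 - Nat.log 2 (r.natVar 12))) ?_ ?_).mono ?_
  · rintro r ⟨rn, rw0, rS, rR⟩ hb
    simp only [Test.Holds, NExp.val, rn] at hb
    rw [wp_seq]
    refine (mergePass_spec rn rfl rw0 rfl rS).frame.mono ?_
    rintro s1 T1 ⟨⟨hS1, hR1, hT1⟩, hf1⟩
    have n1 : s1.natVar 0 = n := (hf1.natVar 0 (by decide)).trans rn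
    have w1 : s1.natVar 12 = r.natVar 12 := hf1.natVar 12 (by decide)
    rw [wp_seq]
    refine (copyBack_spec n1).frame.mono ?_
    rintro s2 T2 ⟨⟨hC, hT2⟩, hf2⟩
    have n2 : s2.natVar 0 = n := (hf2.natVar 0 (by decide)).trans n1
    have w2 : s2.natVar 12 = r.natVar 12 := (hf2.natVar 12 (by decide)).trans w1
    have hlog : Nat.log 2 (r.natVar 12 + r.natVar 12) = Nat.log 2 (r.natVar 12) + 1 := by
      rw [← mul_two]
      exact Nat.log_mul_base (by norm_num) rw0.ne'
    have hle : Nat.log 2 (r.natVar 12) ≤ Nat.log 2 n := Nat.log_mono_right hb.le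
    obtain ⟨d, hd⟩ : ∃ d, Nat.log 2 n = Nat.log 2 (r.natVar 12) + d :=
      Nat.exists_eq_add_of_le hle
    simp [n2, w2, rw0, hlog, hd]
    refine ⟨⟨fun q x y h1 h2 h3 h4 => ?_, ⟨fun x hx => ?_, fun y hy => ?_⟩⟩, ?_⟩
    · rw [hC x (by omega), hC y h4]
      rw [← two_mul] at h1 h3
      exact hS1 q x y h1 h2 h3 h4
    · rw [hC x hx]; exact (rR.trans hR1).mem x hx
    · obtain ⟨x, hx, e⟩ := (rR.trans hR1).covers y hy
      exact ⟨x, hx, by rw [hC x hx, e]⟩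
    · have e2 : Nat.log 2 (r.natVar 12) + d + 1 - Nat.log 2 (r.natVar 12) = d + 1 := by omega
      rw [e2, Nat.mul_add]
      omega
  · simp [hn]
    refine ⟨fun q x y h1 h2 h3 h4 => ?_, SameRange.refl _ _⟩
    rw [show x = y by omega]
  · rintro t T ⟨⟨tn, -, hS, hR⟩, hb, hT⟩
    simp only [Test.Holds, NExp.val, tn] at hb
    simp at hT ⊢
    exact ⟨lexSorted_of_sortedRuns (not_lt.1 hb) hS, hR, by omega⟩

end RealRAM

/-! ## V-shapes and splits of the sorted points -/

/-- The sequences `A`, `B` list the coordinates of the points. -/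
def ListsCoords {n : ℕ} (p : Fin n → Plane) (u : Plane) (σ τ : ℝ) (A B : ℕ → ℝ) : Prop :=
  (∀ x < n, ∃ i, A x = lat σ u (p i) ∧ B x = lon τ u (p i)) ∧
    ∀ i, ∃ x < n, A x = lat σ u (p i) ∧ B x = lon τ u (p i)

/-- The value `m` is a lower bound for the scaled squared widths of the V-shapes that cover the
points and have coordinates with the signs `σ` and `τ`. -/
def IsWidthBound {n : ℕ} (p : Fin n → Plane) (u : Plane) (σ τ m : ℝ) : Prop :=
  ∀ (V : VShape) (ax ay c X Y : ℝ), InCoords V u σ τ ax ay c X Y → V.Covers p →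
    m ≤ (V.width * ‖u‖) ^ 2

theorem ListsCoords.of_sameRange {n : ℕ} {p : Fin n → Plane} {u : Plane} {σ τ : ℝ}
    {A B A' B' : ℕ → ℝ} (h : ListsCoords p u σ τ A B)
    (hS : SameRange n (lexSeq A B) (lexSeq A' B')) : ListsCoords p u σ τ A' B' := by
  have e : ∀ x y, lexSeq A' B' x = lexSeq A B y → A' x = A y ∧ B' x = B y := fun x y hxy => by
    simpa [lexSeq] using hxy
  constructor
  · intro x hx
    obtain ⟨y, hy, hxy⟩ := hS.mem x hx
    rw [(e x y hxy).1, (e x y hxy).2]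
    exact h.1 y hy
  · intro i
    obtain ⟨y, hy, h1, h2⟩ := h.2 i
    obtain ⟨x, hx, hxy⟩ := hS.covers y hy
    exact ⟨x, hx, by rw [(e x y hxy).1, h1], by rw [(e x y hxy).2, h2]⟩

theorem IsWidthBound.mono {n : ℕ} {p : Fin n → Plane} {u : Plane} {σ τ m m' : ℝ}
    (h : IsWidthBound p u σ τ m) (hm : m' ≤ m) : IsWidthBound p u σ τ m' :=
  fun V ax ay c X Y hV hc => hm.trans (h V ax ay c X Y hV hc)

section

variable {n : ℕ} {p : Fin n → Plane} {u : Plane} {σ τ : ℝ} {A B : ℕ → ℝ}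

/-- Suppose that the search has ended at `k`. If the first strip reaches the point `k - 1`, its
width is at least `A (k - 1) - A 0`, which `after` bounds. If not, all points from `k - 1` on lie in
the second strip and `before` applies. -/
theorem isWidthBound_of_remaining (hL : ListsCoords p u σ τ A B) (hs : LexSorted 0 n A B)
    {k : ℕ} {m : ℝ} (hR : Remaining n A B k k m) : IsWidthBound p u σ τ m := by
  intro V ax ay c X Y hV hcov
  have h1 := hR.one_le
  have hkn := hR.lt
  have pt : ∀ x < n, ay ≤ A x ∧ Y ≤ B x + c * A x ∧ (A x ≤ ax ∨ B x + c * A x ≤ X) := by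
    intro x hx
    obtain ⟨i, hA, hB⟩ := hL.1 x hx
    rw [hA, hB]
    exact (hV.mem_iff _).1 (hcov i)
  rw [hV.width_eq]
  by_cases hx : A (k - 1) ≤ ax
  · have h2 := (pt 0 (by omega)).1
    have h3 : A 0 ≤ A (k - 1) := hs.le le_rfl (Nat.zero_le _) (by omega)
    have h4 := le_max_left (ax - ay) ((X - Y) / √(1 + c * c))
    refine hR.after.trans ?_
    nlinarith
  · rcases hR.before with rfl | hB
    · refine hR.after.trans ?_
      -- For `k = 1` the bound `after` is zero and there is nothing to prove.
      rw [Nat.sub_self, sub_self, zero_mul]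
      positivity
    · rcases le_or_gt m 0 with hm | hm
      · exact hm.trans (sq_nonneg _)
      obtain ⟨i, j, hi, hin, hj, hle⟩ := hB c
      have h2 := hs.le (Nat.zero_le _) hi hin
      have h3 := (pt i hin).2.2.resolve_left (by linarith)
      have h4 := (pt j hj).2.1
      have hpos := Real.sqrt_pos.2 (one_add_mul_self_pos c)
      rw [Real.sqrt_mul hm.le] at hle
      have h5 : √m ≤ (X - Y) / √(1 + c * c) := by
        rw [le_div_iff₀ hpos]
        simp only [lineAt] at hle
        linarith
      have h6 := h5.trans (le_max_right (ax - ay) ((X - Y) / √(1 + c * c)))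
      calc m = √m ^ 2 := (Real.sq_sqrt hm.le).symm
        _ ≤ _ := pow_le_pow_left₀ (Real.sqrt_nonneg m) h6 2

theorem covers_of_attained (hL : ListsCoords p u σ τ A B) (hs : LexSorted 0 n A B) {k : ℕ}
    {c X Y : ℝ} (hk : k < n) {V : VShape} (hV : InCoords V u σ τ (A (k - 1)) (A 0) c X Y)
    (hX : ∀ i, k ≤ i → i < n → lineAt A B i c ≤ X) (hY : ∀ i < n, Y ≤ lineAt A B i c) :
    V.Covers p := by
  intro i
  obtain ⟨x, hx, hA, hB⟩ := hL.2 i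
  rw [hV.mem_iff, ← hA, ← hB]
  refine ⟨hs.le le_rfl (Nat.zero_le _) hx, hY x hx, ?_⟩
  rcases lt_or_ge x k with h | h
  · exact Or.inl (hs.le (Nat.zero_le _) (by omega) (by omega))
  · exact Or.inr (hX x h hx)

theorem width_le_of_attained {ε : ℝ} (hε : 0 < ε) {k : ℕ} {m c X Y : ℝ}
    (hA : Attained n A B ε k m c) {V : VShape}
    (hV : InCoords V u σ τ (A (k - 1)) (A 0) c X Y)
    (hX : ∃ i, k ≤ i ∧ i < n ∧ X = lineAt A B i c) (hY : ∃ j < n, Y = lineAt A B j c) :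
    (V.width * ‖u‖) ^ 2 ≤ (1 + ε / 3) ^ 2 * m := by
  obtain ⟨i, hi, hin, rfl⟩ := hX
  obtain ⟨j, hj, rfl⟩ := hY
  have hm : 0 ≤ m := (mul_self_nonneg _).trans hA.width_le
  have h1 := hA.good i j hi hin hj
  have hpos := Real.sqrt_pos.2 (one_add_mul_self_pos c)
  have h2 : A (k - 1) - A 0 ≤ √m := Real.le_sqrt_of_sq_le (by rw [pow_two]; exact hA.width_le)
  have h3 := Real.sqrt_nonneg m
  rw [Real.sqrt_mul hm, ← mul_assoc, ← div_le_iff₀ hpos] at h1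
  have h4 : V.width * ‖u‖ ≤ (1 + ε / 3) * √m := by
    rw [hV.width_eq]
    exact max_le (by nlinarith) h1
  have h0 : 0 ≤ V.width * ‖u‖ := by
    rw [hV.width_eq]
    exact (sub_nonneg.2 hV.lat_le).trans (le_max_left _ _)
  calc (V.width * ‖u‖) ^ 2 ≤ ((1 + ε / 3) * √m) ^ 2 := pow_le_pow_left₀ h0 h4 2
    _ = (1 + ε / 3) ^ 2 * m := by rw [mul_pow, Real.sq_sqrt hm]

/-! ### The use of general position -/

theorem collinear_of_lat_eq (hu : u ≠ 0) (hσ : σ * σ = 1) {x y z : Plane}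
    (hy : lat σ u y = lat σ u x) (hz : lat σ u z = lat σ u x) : Collinear ℝ {x, y, z} := by
  have hN := plane_norm_sq_pos hu
  rw [collinear_iff_of_mem (p₀ := x) (by simp)]
  refine ⟨u, fun q hq => ?_⟩
  have hq' : lat σ u q = lat σ u x := by
    rcases hq with rfl | rfl | rfl
    · rfl
    · exact hy
    · exact hz
  refine ⟨(lon 1 u q - lon 1 u x) / (u 0 * u 0 + u 1 * u 1),
    eq_of_lat_lon (τ := 1) hσ (one_mul 1) hu ?_ ?_⟩
  · rw [hq']
    simp [lat, det2]
    left
    ring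
  · have : lon 1 u (((lon 1 u q - lon 1 u x) / (u 0 * u 0 + u 1 * u 1)) • u +ᵥ x) =
        (lon 1 u q - lon 1 u x) / (u 0 * u 0 + u 1 * u 1) * (u 0 * u 0 + u 1 * u 1) +
          lon 1 u x := by
      simp only [lon, vadd_eq_add, PiLp.add_apply, PiLp.smul_apply, smul_eq_mul]
      ring
    rw [this, div_mul_cancel₀ _ hN.ne']
    ring

/-- If both inequalities fail, every point lies on one of two lines parallel to `u`, and one of
these contains three of the at least five points. -/
theorem gap_of_generalPosition (hp : GeneralPosition p) (hn : 5 ≤ n) (hu : u ≠ 0)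
    (hσ : σ * σ = 1) (hL : ListsCoords p u σ τ A B) (hs : LexSorted 0 n A B) (k : ℕ)
    (hk1 : 1 ≤ k) (hkn : k < n) : A 0 < A (k - 1) ∨ A k < A (n - 1) := by
  by_contra! hcon
  obtain ⟨h1, h2⟩ := hcon
  have two : ∀ i, lat σ u (p i) = A 0 ∨ lat σ u (p i) = A (n - 1) := by
    intro i
    obtain ⟨x, hx, hA, -⟩ := hL.2 i
    rw [← hA]
    rcases lt_or_ge x k with h | h
    · exact Or.inl (((hs.le (Nat.zero_le _) (by omega) (by omega)).trans h1).antisymm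
        (hs.le le_rfl (Nat.zero_le _) hx))
    · exact Or.inr ((hs.le (Nat.zero_le _) (by omega) (by omega)).antisymm
        (h2.trans (hs.le (Nat.zero_le _) h hx)))
  classical
  obtain ⟨b, hb⟩ := Fintype.exists_lt_card_fiber_of_mul_lt_card
    (f := fun i : Fin n => decide (lat σ u (p i) = A 0)) (n := 2)
    (by rw [Fintype.card_bool, Fintype.card_fin]; omega)
  obtain ⟨i, j, l, hi, hj, hl, hij, hil, hjl⟩ := Finset.two_lt_card_iff.1 hb
  simp only [Finset.mem_filter, Finset.mem_univ, true_and] at hi hj hl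
  have same : ∀ x y, decide (lat σ u (p x) = A 0) = b → decide (lat σ u (p y) = A 0) = b →
      lat σ u (p x) = lat σ u (p y) := by
    intro x y hx hy
    rw [← hy, decide_eq_decide] at hx
    by_cases h : lat σ u (p x) = A 0
    · rw [h, hx.1 h]
    · rw [(two x).resolve_left h, (two y).resolve_left fun h' => h (hx.2 h')]
  exact hp.not_collinear i j l hij hjl hil
    (collinear_of_lat_eq hu hσ (same j i hj hi) (same l i hl hi))

end

namespace RealRAM

/-- The input of the algorithm is in memory. -/
structure HasInput {n : ℕ} (p : Fin n → Plane) (u : Plane) (ε : ℝ) (s : State) : Prop where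
  n_eq : s.natVar 0 = n
  u0_eq : s.realVar 0 = u 0
  u1_eq : s.realVar 1 = u 1
  ε_eq : s.realVar 2 = ε
  p0_eq : ∀ i : Fin n, s.realArr 0 i = p i 0
  p1_eq : ∀ i : Fin n, s.realArr 1 i = p i 1

theorem HasInput.of_frame {n : ℕ} {p : Fin n → Plane} {u : Plane} {ε : ℝ} {s t : State}
    (h : HasInput p u ε s) {c : Cmd} (hf : Frame c s t) (h1 : 0 ∉ c.natVars)
    (h2 : 0 ∉ c.realVars ∧ 1 ∉ c.realVars ∧ 2 ∉ c.realVars)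
    (h3 : 0 ∉ c.realArrs ∧ 1 ∉ c.realArrs) : HasInput p u ε t where
  n_eq := (hf.natVar 0 h1).trans h.n_eq
  u0_eq := (hf.realVar 0 h2.1).trans h.u0_eq
  u1_eq := (hf.realVar 1 h2.2.1).trans h.u1_eq
  ε_eq := (hf.realVar 2 h2.2.2).trans h.ε_eq
  p0_eq := fun i => by rw [hf.realArr 0 h3.1]; exact h.p0_eq i
  p1_eq := fun i => by rw [hf.realArr 1 h3.2]; exact h.p1_eq i

/-! ## Coordinates of the points -/

/-- Compute the coordinates of the points, and a bound for the spread of the second ones. -/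
def coords (σ τ : ℚ) : Cmd :=
  .seq (.natAssign 1 (.const 0)) <|
  .seq (.realAssign 3 (.const 0)) <|
  .loop (.natLt (.var 1) (.var 0)) <|
    .seq (.realStore 2 (.var 1) (.mul (.const σ) (.sub (.mul (.var 0) (.get 1 (.var 1)))
      (.mul (.var 1) (.get 0 (.var 1)))))) <|
    .seq (.realStore 3 (.var 1) (.mul (.const τ) (.add (.mul (.var 0) (.get 0 (.var 1)))
      (.mul (.var 1) (.get 1 (.var 1)))))) <|
    .seq (.realAssign 3 (.add (.var 3)
      (.add (.const 1) (.mul (.get 3 (.var 1)) (.get 3 (.var 1)))))) <|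
    .natAssign 1 (.add (.var 1) (.const 1))

theorem coords_spec (σ τ : ℚ) {n : ℕ} {p : Fin n → Plane} {u : Plane} {ε : ℝ} {s : State}
    (h : HasInput p u ε s) :
    WP (coords σ τ) (fun t T => ListsCoords p u σ τ (t.realArr 2) (t.realArr 3) ∧
      (∀ i < n, ∀ j < n, t.realArr 3 i - t.realArr 3 j ≤ t.realVar 3) ∧ T ≤ 60 * n + 20) s := by
  rw [coords, wp_seq, wp_natAssign, wp_seq, wp_realAssign]
  refine (wp_loop (fun t => HasInput p u ε t ∧ 0 ≤ t.realVar 3 ∧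
      ∀ i : Fin n, (i : ℕ) < t.natVar 1 → t.realArr 2 i = lat σ u (p i) ∧
        t.realArr 3 i = lon τ u (p i) ∧
        1 + lon τ u (p i) * lon τ u (p i) ≤ t.realVar 3)
    (fun r => 60 * (n - r.natVar 1)) ?_ ?_).mono ?_
  · rintro r ⟨rI, r3, hr⟩ hb
    have rn := rI.n_eq
    simp only [Test.Holds, NExp.val, rn] at hb
    have ep := rI.p0_eq ⟨_, hb⟩
    have ep' := rI.p1_eq ⟨_, hb⟩
    simp only at ep ep'
    have e1 : (σ : ℝ) * (u 0 * p ⟨_, hb⟩ 1 - u 1 * p ⟨_, hb⟩ 0) = lat σ u (p ⟨_, hb⟩) := rfl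
    have e2 : (τ : ℝ) * (u 0 * p ⟨_, hb⟩ 0 + u 1 * p ⟨_, hb⟩ 1) = lon τ u (p ⟨_, hb⟩) := rfl
    simp [rI.u0_eq, rI.u1_eq, ep, ep', e1, e2]
    have hpos := one_add_mul_self_pos (lon τ u (p ⟨_, hb⟩))
    refine ⟨⟨⟨?_, ?_, ?_, ?_, ?_, ?_⟩, by linarith, fun i hi => ?_⟩, by omega⟩
    · simp [rn]
    · simp [rI.u0_eq]
    · simp [rI.u1_eq]
    · simp [rI.ε_eq]
    · simpa using rI.p0_eq
    · simpa using rI.p1_eq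
    · rcases Nat.le_iff_lt_or_eq.1 hi with hi | hi
      · obtain ⟨h1, h2, h3⟩ := hr i hi
        rw [Function.update_of_ne hi.ne, Function.update_of_ne hi.ne]
        exact ⟨h1, h2, by linarith⟩
      · have : i = ⟨_, hb⟩ := Fin.ext hi
        subst this
        simp
        linarith
  · refine ⟨⟨?_, ?_, ?_, ?_, ?_, ?_⟩, ?_, ?_⟩
    · simp [h.n_eq]
    · simp [h.u0_eq]
    · simp [h.u1_eq]
    · simp [h.ε_eq]
    · simpa using h.p0_eq
    · simpa using h.p1_eq
    · simp
    · simp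
  · rintro t T ⟨⟨tI, -, ht⟩, hb, hT⟩
    simp only [Test.Holds, NExp.val, tI.n_eq] at hb
    simp at hT ⊢
    have ht' : ∀ i : Fin n, t.realArr 2 i = lat σ u (p i) ∧ t.realArr 3 i = lon τ u (p i) ∧
        1 + lon τ u (p i) * lon τ u (p i) ≤ t.realVar 3 := fun i => ht i (by omega)
    refine ⟨⟨fun x hx => ⟨⟨x, hx⟩, (ht' ⟨x, hx⟩).1, (ht' ⟨x, hx⟩).2.1⟩,
      fun i => ⟨i, i.2, (ht' i).1, (ht' i).2.1⟩⟩, fun i hi j hj => ?_, by omega⟩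
    obtain ⟨-, h2, h3⟩ := ht' ⟨i, hi⟩
    obtain ⟨-, h2', h3'⟩ := ht' ⟨j, hj⟩
    simp only at h2 h2'
    rw [h2, h2']
    -- From `2 * b ≤ 1 + b * b` and `-2 * b ≤ 1 + b * b`: a running sum of `1 + b * b` bounds every
    -- difference, without computing extremes.
    nlinarith [sq_nonneg (lon τ u (p ⟨i, hi⟩) - 1), sq_nonneg (lon τ u (p ⟨j, hj⟩) + 1)]

/-! ## The envelope of the negated points -/

/-- Negate and reverse the sorted points. -/
def negRev : Cmd :=
  .seq (.natAssign 1 (.const 0)) <|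
  .loop (.natLt (.var 1) (.var 0)) <|
    .seq (.realStore 6 (.var 1) (.sub (.const 0)
      (.get 2 (.sub (.sub (.var 0) (.const 1)) (.var 1))))) <|
    .seq (.realStore 7 (.var 1) (.sub (.const 0)
      (.get 3 (.sub (.sub (.var 0) (.const 1)) (.var 1))))) <|
    .natAssign 1 (.add (.var 1) (.const 1))

theorem negRev_spec {s : State} {n : ℕ} (hn : s.natVar 0 = n) :
    WP negRev (fun t T => NegRev n (s.realArr 2) (s.realArr 3) (t.realArr 6) (t.realArr 7) ∧
      T ≤ 40 * n + 10) s := by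
  rw [negRev, wp_seq, wp_natAssign]
  refine (wp_loop (fun t => t.natVar 0 = n ∧ t.realArr 2 = s.realArr 2 ∧
      t.realArr 3 = s.realArr 3 ∧ ∀ x < t.natVar 1,
        t.realArr 6 x = -s.realArr 2 (n - 1 - x) ∧ t.realArr 7 x = -s.realArr 3 (n - 1 - x))
    (fun r => 40 * (n - r.natVar 1)) ?_ ?_).mono ?_
  · rintro r ⟨rn, r2, r3, hI⟩ hb
    simp only [Test.Holds, NExp.val, rn] at hb
    simp [rn, r2, r3]
    refine ⟨fun x hx => ?_, by omega⟩
    rcases Nat.le_iff_lt_or_eq.1 hx with h | rfl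
    · rw [Function.update_of_ne h.ne, Function.update_of_ne h.ne]; exact hI x h
    · simp
  · simp [hn]
  · rintro t T ⟨⟨tn, -, -, hI⟩, hb, hT⟩
    simp only [Test.Holds, NExp.val, tn] at hb
    simp at hT ⊢
    exact ⟨fun x hx => hI x (by omega), by omega⟩

/-- Prepare the search in the sorted points. -/
def prepare : Cmd :=
  .seq negRev <| .seq (.natAssign 1 (.const 0)) <| .seq (hull 6 7 1) <| .natAssign 11 (.var 2)

theorem prepare_spec {s : State} {n : ℕ} (hn : s.natVar 0 = n) (hn1 : 1 ≤ n)
    (hs : LexSorted 0 n (s.realArr 2) (s.realArr 3)) :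
    WP prepare (fun t T => NegRev n (s.realArr 2) (s.realArr 3) (t.realArr 6) (t.realArr 7) ∧
      StackInv 0 n (t.realArr 6) (t.realArr 7) (t.natArr 1) (t.natVar 11) n ∧
      T ≤ 240 * n + 20) s := by
  rw [prepare, wp_seq]
  refine (negRev_spec hn).frame.mono ?_
  rintro s1 T1 ⟨⟨hR, hT1⟩, hf1⟩
  have n1 : s1.natVar 0 = n := (hf1.natVar 0 (by decide)).trans hn
  rw [wp_seq, wp_natAssign, wp_seq]
  refine (hull_spec 6 7 1 (s := s1.setNatVar 1 0) (lo := 0) (by simp) (by simp [n1]; omega) (by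
    simpa [n1] using hR.lexSorted hs)).frame.mono ?_
  rintro s2 T2 ⟨⟨hI, hT2⟩, hf2⟩
  have r6 : s2.realArr 6 = s1.realArr 6 := hf2.realArr 6 (by decide)
  have r7 : s2.realArr 7 = s1.realArr 7 := hf2.realArr 7 (by decide)
  simp [n1] at hI hT2
  simp [r6, r7]
  exact ⟨hR, hI, by omega⟩

/-! ## Output -/

/-- Compute the bounds of the second strip for the split in variable `8` and the direction in real
variable `20`. -/
def scan : Cmd :=
  .seq (.realAssign 23 (.add (.get 3 (.var 8)) (.mul (.var 20) (.get 2 (.var 8))))) <|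
  .seq (.realAssign 24 (.add (.get 3 (.const 0)) (.mul (.var 20) (.get 2 (.const 0))))) <|
  .seq (.natAssign 1 (.const 0)) <|
  .loop (.natLt (.var 1) (.var 0)) <|
    .seq (.realAssign 25 (.add (.get 3 (.var 1)) (.mul (.var 20) (.get 2 (.var 1))))) <|
    .seq (.ite (.realLt (.var 25) (.var 24)) (.realAssign 24 (.var 25)) .skip) <|
    .seq (.ite (.and (.not (.natLt (.var 1) (.var 8))) (.realLt (.var 23) (.var 25)))
      (.realAssign 23 (.var 25)) .skip) <|
    .natAssign 1 (.add (.var 1) (.const 1))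

theorem scan_spec {s : State} {n k : ℕ} {A B : ℕ → ℝ} {c : ℝ} (hn : s.natVar 0 = n)
    (hA : s.realArr 2 = A) (hB : s.realArr 3 = B) (hk : s.natVar 8 = k) (hkn : k < n)
    (hc : s.realVar 20 = c) :
    WP scan (fun t T => (∀ i, k ≤ i → i < n → lineAt A B i c ≤ t.realVar 23) ∧
      (∀ i < n, t.realVar 24 ≤ lineAt A B i c) ∧
      (∃ i, k ≤ i ∧ i < n ∧ t.realVar 23 = lineAt A B i c) ∧
      (∃ j < n, t.realVar 24 = lineAt A B j c) ∧ T ≤ 60 * n + 30) s := by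
  rw [scan, wp_seq, wp_realAssign, wp_seq, wp_realAssign, wp_seq, wp_natAssign]
  refine (wp_loop (fun t => t.natVar 0 = n ∧ t.realArr 2 = A ∧ t.realArr 3 = B ∧
      t.natVar 8 = k ∧ t.realVar 20 = c ∧
      (∀ i, k ≤ i → i < t.natVar 1 → lineAt A B i c ≤ t.realVar 23) ∧
      (∀ i < t.natVar 1, t.realVar 24 ≤ lineAt A B i c) ∧
      (∃ i, k ≤ i ∧ i < n ∧ t.realVar 23 = lineAt A B i c) ∧
      (∃ j < n, t.realVar 24 = lineAt A B j c))
    (fun r => 60 * (n - r.natVar 1)) ?_ ?_).mono ?_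
  · rintro r ⟨rn, rA, rB, rk, rc, h1, h2, h3, h4⟩ hb
    simp only [Test.Holds, NExp.val, rn] at hb
    simp [rn, rA, rB, rk, rc]
    simp only [← lineAt.eq_1]
    generalize r.natVar 1 = x at *
    have new1 : ∀ v, r.realVar 23 ≤ v → (k ≤ x → lineAt A B x c ≤ v) →
        ∀ i, k ≤ i → i ≤ x → lineAt A B i c ≤ v := by
      intro v hv hx i hki hi
      rcases Nat.le_iff_lt_or_eq.1 hi with h | rfl
      · exact (h1 i hki h).trans hv
      · exact hx hki
    have new2 : ∀ v ≤ r.realVar 24, v ≤ lineAt A B x c → ∀ i ≤ x, v ≤ lineAt A B i c := by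
      intro v hv hx i hi
      rcases Nat.le_iff_lt_or_eq.1 hi with h | rfl
      · exact hv.trans (h2 i h)
      · exact hx
    refine ⟨fun a => ⟨fun b b' => ?_, fun b => ?_⟩, fun a => ⟨fun b b' => ?_, fun b => ?_⟩⟩
    · exact ⟨⟨new1 _ b'.le fun _ => le_rfl, new2 _ a.le le_rfl, ⟨x, b, hb, rfl⟩, ⟨x, hb, rfl⟩⟩,
        by omega⟩
    · exact ⟨⟨new1 _ le_rfl b, new2 _ a.le le_rfl, h3, ⟨x, hb, rfl⟩⟩, by omega⟩
    · exact ⟨⟨new1 _ b'.le fun _ => le_rfl, new2 _ le_rfl a, ⟨x, b, hb, rfl⟩, h4⟩, by omega⟩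
    · exact ⟨⟨new1 _ le_rfl b, new2 _ le_rfl a, h3, h4⟩, by omega⟩
  · simp [hn, hA, hB, hk, hc]
    exact ⟨⟨k, le_rfl, hkn, rfl⟩, ⟨0, by omega, rfl⟩⟩
  · rintro t T ⟨⟨tn, -, -, -, -, h1, h2, h3, h4⟩, hb, hT⟩
    simp only [Test.Holds, NExp.val, tn] at hb
    simp only [Test.cost, NExp.cost, RExp.cost, natVar_setNatVar, if_true] at hT ⊢
    exact ⟨fun i hk hi => h1 i hk (by omega), fun i hi => h2 i (by omega), h3, h4, by omega⟩

/-- Store the point with coordinates `a` and `b`. -/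
def storePoint (σ τ : ℚ) (v : ℕ) (a b : RExp) : Cmd :=
  .seq (.realAssign v (.div (.sub (.mul (.mul (.const τ) b) (.var 0))
      (.mul (.mul (.const σ) a) (.var 1)))
    (.add (.mul (.var 0) (.var 0)) (.mul (.var 1) (.var 1))))) <|
  .realAssign (v + 1) (.div (.add (.mul (.mul (.const τ) b) (.var 1))
      (.mul (.mul (.const σ) a) (.var 0)))
    (.add (.mul (.var 0) (.var 0)) (.mul (.var 1) (.var 1))))

/-- Store the directions along and across. -/
def storeDirs (σ τ : ℚ) (d e : ℕ) : Cmd :=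
  .seq (.realAssign d (.mul (.const τ) (.var 0))) <|
  .seq (.realAssign (d + 1) (.mul (.const τ) (.var 1))) <|
  .seq (.realAssign e (.sub (.sub (.const 0) (.mul (.const σ) (.var 1)))
    (.mul (.mul (.var 20) (.const τ)) (.var 0)))) <|
  .realAssign (e + 1) (.sub (.mul (.const σ) (.var 0))
    (.mul (.mul (.var 20) (.const τ)) (.var 1)))

/-- Store the V-shape for the split in variable `8`, the direction in real variable `20` and the
bounds in the real variables `23` and `24`, in the real variables `40, …, 47`, and its value in the
real variable `48`. -/
def store (σ τ : ℚ) : Cmd :=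
  .seq (.realAssign 26 (.get 2 (.sub (.var 8) (.const 1)))) <|
  .seq (.realAssign 27 (.get 2 (.const 0))) <|
  .seq (storePoint σ τ 40 (.var 26) (.sub (.var 23) (.mul (.var 20) (.var 26)))) <|
  .seq (storePoint σ τ 42 (.var 27) (.sub (.var 24) (.mul (.var 20) (.var 27)))) <|
  .seq (if σ = τ then storeDirs σ τ 44 46 else storeDirs σ τ 46 44) <|
  .realAssign 48 (.var 19)

/-- The V-shape `V` is stored in the real variables `40, …, 47`. -/
def Stored (t : State) (V : VShape) : Prop :=
  V.x = !₂[t.realVar 40, t.realVar 41] ∧ V.y = !₂[t.realVar 42, t.realVar 43] ∧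
    V.leftDir = !₂[t.realVar 44, t.realVar 45] ∧ V.rightDir = !₂[t.realVar 46, t.realVar 47]

theorem store_spec {σ τ : ℚ} {u : Plane} {s : State} (h0 : s.realVar 0 = u 0)
    (h1 : s.realVar 1 = u 1) {V : VShape} {ax ay c X Y : ℝ} (hc : s.realVar 20 = c)
    (hX : s.realVar 23 = X) (hY : s.realVar 24 = Y) (hax : s.realArr 2 (s.natVar 8 - 1) = ax)
    (hay : s.realArr 2 0 = ay) (hx : V.x = ofCoords σ τ u ax (X - c * ax))
    (hy : V.y = ofCoords σ τ u ay (Y - c * ay))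
    (hst : (σ : ℝ) = τ → V.leftDir = !₂[τ * u 0, τ * u 1] ∧
      V.rightDir = !₂[-(σ * u 1) - c * τ * u 0, σ * u 0 - c * τ * u 1])
    (hne : (σ : ℝ) ≠ τ → V.rightDir = !₂[τ * u 0, τ * u 1] ∧
      V.leftDir = !₂[-(σ * u 1) - c * τ * u 0, σ * u 0 - c * τ * u 1]) :
    WP (store σ τ) (fun t T => Stored t V ∧ t.realVar 48 = s.realVar 19 ∧ T ≤ 150) s := by
  by_cases h : σ = τ
  · have h' : (σ : ℝ) = τ := by rw [h]
    obtain ⟨e1, e2⟩ := hst h'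
    subst h
    simp [store, storePoint, storeDirs, h0, h1, hc, hX, hY, hax, hay, Stored, hx, hy, e1, e2,
      ofCoords]
  · have h' : (σ : ℝ) ≠ τ := fun h' => h (by exact_mod_cast h')
    obtain ⟨e1, e2⟩ := hne h'
    simp [store, storePoint, storeDirs, h, h0, h1, hc, hX, hY, hax, hay, Stored, hx, hy, e1, e2,
      ofCoords]

/-! ## The algorithm -/

/-- Keep the V-shape that was found if it is the first or the best one. -/
def keepBest (σ τ : ℚ) : Cmd :=
  .ite (.and (.not (.realLt (.var 48) (.const 0))) (.not (.realLt (.var 19) (.var 48))))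
    .skip (store σ τ)

/-- Find the best V-shape for one choice of signs. -/
def step (σ τ : ℚ) : Cmd :=
  .seq (coords σ τ) <| .seq sort <| .seq prepare <| .seq search <| .seq scan (keepBest σ τ)

/-- The variables `40, …, 48` hold a V-shape and a value that is a lower bound for the choices of
signs in `D`, or a negative value if `D` is empty. -/
def BestFor {n : ℕ} (p : Fin n → Plane) (u : Plane) (ε : ℝ) (D : ℝ → ℝ → Prop) (s : State) :
    Prop :=
  (s.realVar 48 < 0 ∧ ∀ σ τ, ¬ D σ τ) ∨
    (0 ≤ s.realVar 48 ∧
      (∃ V : VShape, Stored s V ∧ V.HasArmInDirection u ∧ V.Covers p ∧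
        (V.width * ‖u‖) ^ 2 ≤ (1 + ε / 3) ^ 2 * s.realVar 48) ∧
      ∀ σ τ, D σ τ → IsWidthBound p u σ τ (s.realVar 48))

theorem BestFor.of_frame {n : ℕ} {p : Fin n → Plane} {u : Plane} {ε : ℝ} {D : ℝ → ℝ → Prop}
    {s t : State} (h : BestFor p u ε D s) {c : Cmd} (hf : Frame c s t)
    (hc : ∀ v, 40 ≤ v → v ≤ 48 → v ∉ c.realVars) : BestFor p u ε D t := by
  have e := fun v h1 h2 => hf.realVar v (hc v h1 h2)
  simpa only [BestFor, Stored, e 40 (by decide) (by decide), e 41 (by decide) (by decide),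
    e 42 (by decide) (by decide), e 43 (by decide) (by decide), e 44 (by decide) (by decide),
    e 45 (by decide) (by decide), e 46 (by decide) (by decide), e 47 (by decide) (by decide),
    e 48 (by decide) (by decide)] using h

/-- The value in variable `48` is the minimum over the sign choices so far, hence a lower bound for
all of them. A negative entry means that no V-shape has been stored yet. -/
theorem keepBest_spec {σ τ : ℚ} (hσ : (σ : ℝ) = 1 ∨ (σ : ℝ) = -1)
    (hτ : (τ : ℝ) = 1 ∨ (τ : ℝ) = -1) {n : ℕ} {p : Fin n → Plane} {u : Plane} (hu : u ≠ 0)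
    {ε : ℝ} (hε : 0 < ε) {D : ℝ → ℝ → Prop} {s : State} (hI : HasInput p u ε s)
    (hD : BestFor p u ε D s) {A B : ℕ → ℝ} {c X Y m : ℝ} {k : ℕ}
    (hL : ListsCoords p u σ τ A B) (hs : LexSorted 0 n A B)
    (hA : s.realArr 2 = A) (hk : s.natVar 8 = k) (hc : s.realVar 20 = c) (hm : s.realVar 19 = m)
    (hX : s.realVar 23 = X) (hY : s.realVar 24 = Y) (hatt : Attained n A B ε k m c)
    (hrem : ∃ k, Remaining n A B k k m) (hX1 : ∀ i, k ≤ i → i < n → lineAt A B i c ≤ X)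
    (hY1 : ∀ i < n, Y ≤ lineAt A B i c) (hX2 : ∃ i, k ≤ i ∧ i < n ∧ X = lineAt A B i c)
    (hY2 : ∃ j < n, Y = lineAt A B j c) :
    WP (keepBest σ τ) (fun t T => BestFor p u ε (fun a b => D a b ∨ (a = σ ∧ b = τ)) t ∧
      T ≤ 170) s := by
  obtain ⟨k', hk'⟩ := hrem
  have hnew := isWidthBound_of_remaining hL hs hk'
  rw [keepBest, wp_ite]
  constructor
  · rintro ⟨h1, h2⟩
    simp [hm] at h1 h2
    simp only [wp_skip, Test.cost, RExp.cost]
    refine ⟨Or.inr ?_, by decide⟩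
    rcases hD with hD | ⟨h3, hV, hle⟩
    · exact absurd hD.1 (not_lt.2 h1)
    · refine ⟨h1, hV, ?_⟩
      rintro a b (hab | ⟨rfl, rfl⟩)
      · exact hle a b hab
      · exact hnew.mono h2
  · intro hnot
    have hXY : Y ≤ X := by
      obtain ⟨i, -, hi, rfl⟩ := hX2
      exact hY1 i hi
    have hay : A 0 ≤ A (k - 1) := hs.le le_rfl (Nat.zero_le _) (by have := hatt.lt; omega)
    obtain ⟨V, hdir, hV, hx, hy, hst, hne⟩ := exists_vshape hu hσ hτ (c := c) hay hXY
    refine (store_spec hI.u0_eq hI.u1_eq hc hX hY (by rw [hA, hk]) (by rw [hA]) hx hy hst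
      hne).mono ?_
    rintro t T ⟨hS, h48, hT⟩
    rw [hm] at h48
    refine ⟨Or.inr ?_, by simp only [Test.cost, RExp.cost]; omega⟩
    rw [h48]
    refine ⟨(mul_self_nonneg _).trans hatt.width_le,
      ⟨V, hS, hdir, covers_of_attained hL hs hatt.lt hV hX1 hY1,
        width_le_of_attained hε hatt hV hX2 hY2⟩, ?_⟩
    rintro a b (hab | ⟨rfl, rfl⟩)
    · rcases hD with hD | ⟨h3, -, hle⟩
      · exact absurd hab (hD.2 a b)
      · refine (hle a b hab).mono ?_
        by_contra! hcon
        exact hnot ⟨by simpa using h3, by simpa [hm] using hcon.le⟩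
    · exact hnew

theorem step_spec {σ τ : ℚ} (hσ : (σ : ℝ) = 1 ∨ (σ : ℝ) = -1)
    (hτ : (τ : ℝ) = 1 ∨ (τ : ℝ) = -1) {n : ℕ} {p : Fin n → Plane} {u : Plane} {ε : ℝ}
    (hn : 5 ≤ n) (hp : GeneralPosition p) (hu : u ≠ 0) (hε : 0 < ε) {D : ℝ → ℝ → Prop}
    {s : State} (hI : HasInput p u ε s) (hD : BestFor p u ε D s) :
    WP (step σ τ) (fun t T => HasInput p u ε t ∧
      BestFor p u ε (fun a b => D a b ∨ (a = σ ∧ b = τ)) t ∧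
      T ≤ 2000 * n * (Nat.clog 2 n + 1)) s := by
  have hσ' : (σ : ℝ) * σ = 1 := by rcases hσ with h | h <;> rw [h] <;> norm_num
  suffices h : WP (step σ τ) (fun t T =>
      BestFor p u ε (fun a b => D a b ∨ (a = σ ∧ b = τ)) t ∧
        T ≤ 2000 * n * (Nat.clog 2 n + 1)) s by
    refine h.frame.mono ?_
    rintro t T ⟨h1, hf⟩
    refine ⟨hI.of_frame hf ?_ ?_ ?_, h1⟩ <;>
      (by_cases hst : σ = τ <;>
        simp [step, coords, sort, mergePass, mergeInit, mergeTake, mergeNext, copyBack, prepare,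
          negRev, hull, hullPush, hullPop, search, searchInit, searchUpdate, evalSplit, evalInit,
          walk, walkEval, scan, keepBest, store, storePoint, storeDirs, Cmd.natVars,
          Cmd.realVars, Cmd.realArrs, hst])
  rw [step, wp_seq]
  refine (coords_spec σ τ hI).frame.mono ?_
  rintro s1 T1 ⟨⟨hL1, hS1, hT1⟩, hf1⟩
  have I1 := hI.of_frame hf1 (by simp [coords, Cmd.natVars]) (by simp [coords, Cmd.realVars])
    (by simp [coords, Cmd.realArrs])
  have D1 := hD.of_frame hf1 (fun v _ _ => by simp [coords, Cmd.realVars]; omega)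
  rw [wp_seq]
  refine (sort_spec I1.n_eq (by omega)).frame.mono ?_
  rintro s2 T2 ⟨⟨hs, hR2, hT2⟩, hf2⟩
  have I2 := I1.of_frame hf2 (by decide) (by decide) (by decide)
  have D2 := D1.of_frame hf2 (by decide)
  have hL := hL1.of_sameRange hR2
  have r3 : s2.realVar 3 = s1.realVar 3 := hf2.realVar 3 (by decide)
  have hS2 : ∀ i < n, ∀ j < n, s2.realArr 3 i - s2.realArr 3 j ≤ s2.realVar 3 := by
    intro i hi j hj
    obtain ⟨x, hx, e⟩ := hR2.mem i hi
    obtain ⟨y, hy, e'⟩ := hR2.mem j hj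
    simp [lexSeq] at e e'
    rw [e.2, e'.2, r3]
    exact hS1 x hx y hy
  rw [wp_seq]
  refine (prepare_spec I2.n_eq (by omega) hs).frame.mono ?_
  rintro s3 T3 ⟨⟨hN, hSt, hT3⟩, hf3⟩
  have I3 := I2.of_frame hf3 (by decide) (by decide) (by decide)
  have D3 := D2.of_frame hf3 (by decide)
  have P3 : EvalPre n (s2.realArr 2) (s2.realArr 3) (s3.realArr 6) (s3.realArr 7) ε
      (s2.realVar 3) s3 :=
    { n_eq := I3.n_eq
      A_eq := hf3.realArr 2 (by decide)
      B_eq := hf3.realArr 3 (by decide)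
      X_eq := rfl
      Y_eq := rfl
      ε_eq := I3.ε_eq
      S_eq := hf3.realVar 3 (by decide)
      ε_pos := hε
      sorted := hs
      negRev := hN
      stack := hSt
      spread := hS2
      gap := gap_of_generalPosition hp hn hu hσ' hL hs }
  rw [wp_seq]
  refine (search_spec P3 (by omega)).frame.mono ?_
  rintro s4 T4 ⟨⟨hatt, hrem, hT4⟩, hf4⟩
  have I4 := I3.of_frame hf4 (by decide) (by decide) (by decide)
  have D4 := D3.of_frame hf4 (by decide)
  have P4 := P3.of_frame hf4 (by decide) (by decide) (by decide) (by decide)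
  rw [wp_seq]
  refine (scan_spec I4.n_eq P4.A_eq P4.B_eq rfl hatt.lt rfl).frame.mono ?_
  rintro s5 T5 ⟨⟨hX1, hY1, hX2, hY2, hT5⟩, hf5⟩
  have I5 := I4.of_frame hf5 (by decide) (by decide) (by decide)
  have D5 := D4.of_frame hf5 (by decide)
  have P5 := P4.of_frame hf5 (by decide) (by decide) (by decide) (by decide)
  refine (keepBest_spec hσ hτ hu hε I5 D5 hL hs P5.A_eq (hf5.natVar 8 (by decide))
    (hf5.realVar 20 (by decide)) (hf5.realVar 19 (by decide)) rfl rfl hatt hrem hX1 hY1 hX2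
    hY2).mono ?_
  rintro s6 T6 ⟨hB, hT6⟩
  refine ⟨hB, ?_⟩
  have hlog : Nat.log 2 n ≤ Nat.clog 2 n := Nat.log_le_clog 2 n
  -- Sorting is counted with the floor of the logarithm and searching with its ceiling; the latter
  -- bounds both.
  have h1 := Nat.mul_le_mul_left (300 * n) (Nat.succ_le_succ hlog)
  have h2 : n * 1 ≤ n * (Nat.clog 2 n + 1) := Nat.mul_le_mul_left n (by omega)
  simp only [Nat.succ_eq_add_one, mul_assoc] at h1 hT2 hT4 ⊢
  omega

/-- Write the V-shape to the output variables. -/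
def output : Cmd :=
  .seq (.realAssign 0 (.var 40)) <| .seq (.realAssign 1 (.var 41)) <|
  .seq (.realAssign 2 (.var 42)) <| .seq (.realAssign 3 (.var 43)) <|
  .seq (.realAssign 4 (.var 44)) <| .seq (.realAssign 5 (.var 45)) <|
  .seq (.realAssign 6 (.var 46)) <| .realAssign 7 (.var 47)

theorem output_spec {s : State} {V : VShape} (h : Stored s V) :
    WP output (fun t T => Outputs t V ∧ T ≤ 20) s := by
  obtain ⟨h1, h2, h3, h4⟩ := h
  simp [output, Outputs, h1, h2, h3, h4]

/-- The V-shape algorithm. -/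
def vshapeProg : Cmd :=
  .seq (.realAssign 48 (.const (-1))) <|
  .seq (step 1 1) <| .seq (step 1 (-1)) <| .seq (step (-1) 1) <| .seq (step (-1) (-1)) output

theorem hasInput_inputState {n : ℕ} (p : Fin n → Plane) (u : Plane) (ε : ℝ) (r : ℝ) :
    HasInput p u ε ((inputState p u ε).setRealVar 48 r) := by
  constructor <;> simp [inputState]

theorem vshapeProg_spec {n : ℕ} {p : Fin n → Plane} {u : Plane} {ε : ℝ} (hn : 5 ≤ n)
    (hp : GeneralPosition p) (hu : u ≠ 0) (hε : 0 < ε) :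
    WP vshapeProg (fun t T => ∃ V : VShape, Outputs t V ∧ V.HasArmInDirection u ∧ V.Covers p ∧
      (∀ V' : VShape, V'.Covers p → V'.HasArmInDirection u →
        (V.width * ‖u‖) ^ 2 ≤ (1 + ε / 3) ^ 2 * (V'.width * ‖u‖) ^ 2) ∧
      T ≤ 9000 * n * (Nat.clog 2 n + 1)) (inputState p u ε) := by
  have pos : ((1 : ℚ) : ℝ) = 1 ∨ ((1 : ℚ) : ℝ) = -1 := Or.inl (by norm_num)
  have neg : ((-1 : ℚ) : ℝ) = 1 ∨ ((-1 : ℚ) : ℝ) = -1 := Or.inr (by norm_num)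
  rw [vshapeProg, wp_seq, wp_realAssign, wp_seq]
  refine (step_spec (D := fun _ _ => False) pos pos hn hp hu hε (hasInput_inputState p u ε _)
    (Or.inl ⟨by simp, by simp⟩)).mono ?_
  rintro s1 T1 ⟨I1, D1, hT1⟩
  rw [wp_seq]
  refine (step_spec pos neg hn hp hu hε I1 D1).mono ?_
  rintro s2 T2 ⟨I2, D2, hT2⟩
  rw [wp_seq]
  refine (step_spec neg pos hn hp hu hε I2 D2).mono ?_
  rintro s3 T3 ⟨I3, D3, hT3⟩
  rw [wp_seq]
  refine (step_spec neg neg hn hp hu hε I3 D3).mono ?_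
  rintro s4 T4 ⟨-, D4, hT4⟩
  rcases D4 with ⟨-, hD⟩ | ⟨-, ⟨V, hV, hdir, hcov, hw⟩, hle⟩
  · exact absurd (Or.inr ⟨rfl, rfl⟩) (hD ((-1 : ℚ) : ℝ) ((-1 : ℚ) : ℝ))
  refine (output_spec hV).mono ?_
  rintro t T5 ⟨hO, hT5⟩
  refine ⟨V, hO, hdir, hcov, fun V' hcov' hdir' => ?_, ?_⟩
  · obtain ⟨σ, τ, ax, ay, c, X, Y, hσ, hτ, hV'⟩ := exists_inCoords hu hdir'
    refine hw.trans (mul_le_mul_of_nonneg_left ?_ (sq_nonneg _))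
    refine hle σ τ ?_ V' ax ay c X Y hV' hcov'
    -- The four runs exhaust the sign choices that a competing V-shape can have.
    rcases hσ with rfl | rfl <;> rcases hτ with rfl | rfl <;> simp
  · have h2 : 5 * 1 ≤ n * (Nat.clog 2 n + 1) := Nat.mul_le_mul hn (by omega)
    simp only [RExp.cost, mul_assoc] at *
    omega

end RealRAM

/-! ### From binary logarithms and squared widths to the theorem -/

theorem clog_le_log {n : ℕ} (hn : 5 ≤ n) : ((Nat.clog 2 n + 1 : ℕ) : ℝ) ≤ 4 * Real.log n := by
  have hn0 : (0 : ℝ) < n := by positivity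
  have h1 : Nat.clog 2 n ≤ Nat.log 2 n + 1 := by
    rw [Nat.clog_le_iff_le_pow (by norm_num)]
    exact (Nat.lt_pow_succ_log_self (by norm_num) n).le
  have h2 : (Nat.log 2 n : ℝ) * Real.log 2 ≤ Real.log n := by
    rw [← Real.log_pow]
    refine Real.log_le_log (by positivity) ?_
    exact_mod_cast Nat.pow_log_le_self 2 (by omega)
  have h3 : 2 * Real.log 2 ≤ Real.log n := by
    have : (2 : ℝ) * Real.log 2 = Real.log ((2 : ℝ) ^ 2) := by rw [Real.log_pow]; norm_num
    rw [this]
    refine Real.log_le_log (by positivity) ?_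
    have : (5 : ℝ) ≤ n := by exact_mod_cast hn
    linarith
  -- Both `Nat.log 2 n` and `2` are at most `Real.log n / Real.log 2`, hence at most `2 * Real.log
  -- n`; this gives the factor 4.
  have h4 : (1 / 2 : ℝ) < Real.log 2 := by linarith [Real.log_two_gt_d9]
  have h5 : ((Nat.clog 2 n + 1 : ℕ) : ℝ) ≤ (Nat.log 2 n : ℝ) + 2 := by
    exact_mod_cast Nat.succ_le_succ h1
  have h6 : (0 : ℝ) ≤ Nat.log 2 n := by positivity
  nlinarith

theorem mainTheorem6 :
    ∃ (prog : RealRAM.Cmd) (C : ℝ),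
      ∀ (n : ℕ) (p : Fin n → Plane) (u : Plane) (ε : ℝ),
        5 ≤ n → GeneralPosition p → u ≠ 0 → 0 < ε →
          ∃ (t : RealRAM.State) (T : ℕ) (V : VShape),
            RealRAM.Exec prog (RealRAM.inputState p u ε) t T ∧
            RealRAM.Outputs t V ∧
            (T : ℝ) ≤ C * (n * Real.log n + n / Real.sqrt ε * Real.log (1 / ε) ^ 2) ∧
            V.Covers p ∧
            V.HasArmInDirection u ∧
            ∀ V' : VShape, V'.Covers p → V'.HasArmInDirection u →
              V.width ≤ (1 + ε / 3) * V'.width := by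
  -- The constant is 9000 from the step count times 4 from `clog_le_log`.
  refine ⟨RealRAM.vshapeProg, 36000, fun n p u ε hn hp hu hε => ?_⟩
  obtain ⟨t, T, hexec, V, hO, hdir, hcov, hmin, hT⟩ := RealRAM.vshapeProg_spec hn hp hu hε
  refine ⟨t, T, V, hexec, hO, ?_, hcov, hdir, fun V' hcov' hdir' => ?_⟩
  · have h1 := clog_le_log hn
    have h2 : (T : ℝ) ≤ 9000 * n * ((Nat.clog 2 n + 1 : ℕ) : ℝ) := by exact_mod_cast hT
    -- The first summand alone bounds the running time, so the second only has to be nonnegative.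
    have h3 : 0 ≤ n / Real.sqrt ε * Real.log (1 / ε) ^ 2 := by positivity
    have h4 : (n : ℝ) * ((Nat.clog 2 n + 1 : ℕ) : ℝ) ≤ n * (4 * Real.log n) :=
      mul_le_mul_of_nonneg_left h1 (by positivity)
    linarith
  · have hu' : 0 < ‖u‖ := norm_pos_iff.2 hu
    have h := hmin V' hcov' hdir'
    have hw' : 0 ≤ V'.width := by
      rw [VShape.width, VShape.armWidth]
      exact le_max_of_le_left (by positivity)
    rw [← mul_pow] at h
    have h' := abs_le_of_sq_le_sq h (by positivity)
    exact le_of_mul_le_mul_right (((le_abs_self _).trans h').trans_eq (by ring)) hu'
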